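/- Let $k$ be an algebraically closed field of characteristic zero and let $A$ be a connected finite-dimensional $k$-algebra (nonzero, with no central idempotents other than $0$ and $1$) that is basic, i.e. $A$ is a direct sum of pairwise non-isomorphic indecomposable projective left modules. Let $1=\sum_{x\in Q_0}e_x$ be a decomposition of the unit of $A$ into primitive pairwise orthogonal idempotents and let $Q$ be the ordinary quiver of $A$: its set of vertices is $Q_0$ and the number of arrows $x\to y$ is $\dim_k e_yRe_x/e_yR^2e_x$, where $R$ is the radical of $A$. Assume that $Q$ has no double bypass: there are no arrows $\alpha,\beta$ and oriented paths $u\neq\alpha$ parallel to $\alpha$ and $v\neq\beta$ parallel to $\beta$ such that $\beta$ appears in $u$. Let $kQ$ be the path algebra and $kQ^+$ its ideal generated by the arrows. An ideal $I$ of $kQ$ is admissible if $(kQ^+)^n\subseteq I\subseteq (kQ^+)^2$ for some $n\geq 2$. An admissible presentation of $A$ is an isomorphism of $k$-algebras $\varphi\colon kQ/I\to A$ with $I$ admissible; it respects the vertices if, for every $x\in Q_0$, the image $f_x$ under $\varphi$ of the class of the trivial path at $x$ satisfies $Af_x\simeq Ae_x$ as left $A$-modules (for instance $f_x=e_x$).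 A minimal relation of $I$ is a nonzero element $r=\sum_{i=1}^n t_iu_i\in I$, where the $u_i$ are distinct parallel paths and $t_i\in k^*$, such that $\sum_{i\in E}t_iu_i\notin I$ for every non-empty proper subset $E$ of $\{1,\dots,n\}$. Let $\sim_I$ be the smallest equivalence relation on the walks in $Q$ (formal products of composable arrows and formal inverses of arrows) that is compatible with concatenation and such that $\alpha\alpha^{-1}\sim_I e_y$ and $\alpha^{-1}\alpha\sim_I e_x$ for every arrow $\alpha\colon x\to y$ (here $e_x$, $e_y$ are trivial walks), and $u\sim_I v$ whenever $u,v$ are paths that appear in a same minimal relation of $I$. The fundamental group $\pi_1(Q,I,x_0)$ is the group of $\sim_I$-classes of walks from $x_0$ to $x_0$. Then there is an admissible presentation $kQ/I_0\simeq A$ that respects the vertices, such that: (1) for every admissible presentation $kQ/I\simeq A$ that respects the vertices and every $x_0\in Q_0$, the identity map on walks induces a surjective group morphism $\pi_1(Q,I_0,x_0)\twoheadrightarrow\pi_1(Q,I,x_0)$; (2) for every admissible presentation $kQ/I\simeq A$ and all $x_0,y_0\in Q_0$, there is a surjective group morphism $\pi_1(Q,I_0,x_0)\twoheadrightarrow\pi_1(Q,I,y_0)$.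 -/

import Mathlib

open Quiver

/-! ### Quivers: bypasses -/

/-- The arrow `β` appears in the path `u`. -/
def ArrowAppears {V : Type*} [Quiver V] {a b x y : V} (β : a ⟶ b) (u : Quiver.Path x y) : Prop :=
  ∃ (p : Quiver.Path x a) (q : Quiver.Path b y), u = p.comp (β.toPath.comp q)

/-- `(α, u)` is a bypass: `u` is a path parallel to the arrow `α` and different from `α`. -/
def IsBypass {V : Type*} [Quiver V] {x y : V} (α : x ⟶ y) (u : Quiver.Path x y) : Prop :=
  u ≠ α.toPath

/-- The quiver has no double bypass: there are no bypasses `(α, u)` and `(β, v)` such that the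
arrow `β` appears in the path `u`. -/
def NoDoubleBypass (V : Type*) [Quiver V] : Prop :=
  ∀ ⦃x y : V⦄ (α : x ⟶ y) (u : Quiver.Path x y) ⦃a b : V⦄ (β : a ⟶ b) (v : Quiver.Path a b),
    IsBypass α u → IsBypass β v → ¬ ArrowAppears β u

/-! ### The path algebra of a quiver with finitely many vertices -/

/-- The path algebra `kQ = ⨁_{x,y} kQ(x, y)`, where `kQ(x, y)` is the vector space with basis the
oriented paths from `x` to `y`. The component of `f` in `kQ(x, y)` is `f x y`. -/
def PathAlgebra (k V : Type*) [Field k] [Quiver V] : Type _ :=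
  ∀ x y : V, Quiver.Path x y →₀ k

namespace PathAlgebra

noncomputable section

variable {k V : Type*} [Field k] [Quiver V]

instance : AddCommGroup (PathAlgebra k V) :=
  inferInstanceAs (AddCommGroup (∀ x y : V, Quiver.Path x y →₀ k))

instance : Module k (PathAlgebra k V) :=
  inferInstanceAs (Module k (∀ x y : V, Quiver.Path x y →₀ k))

@[ext]
theorem ext {f g : PathAlgebra k V} (h : ∀ x y, f x y = g x y) : f = g :=
  funext fun x => funext fun y => h x y

@[simp]
theorem add_apply (f g : PathAlgebra k V) (x y : V) : (f + g) x y = f x y + g x y := rfl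

@[simp]
theorem zero_apply (x y : V) : (0 : PathAlgebra k V) x y = 0 := rfl

@[simp]
theorem smul_apply (c : k) (f : PathAlgebra k V) (x y : V) : (c • f) x y = c • f x y := rfl

/-- The bilinear extension of the concatenation of paths: `concat x y z p q` is `p` followed by
`q`. -/
def concat (k : Type*) {V : Type*} [Field k] [Quiver V] (x y z : V) :
    (Quiver.Path x y →₀ k) →ₗ[k] (Quiver.Path y z →₀ k) →ₗ[k] (Quiver.Path x z →₀ k) :=
  Finsupp.linearCombination k fun p : Quiver.Path x y =>
    Finsupp.lmapDomain k k fun q : Quiver.Path y z => p.comp q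

@[simp]
theorem concat_single_single {x y z : V} (p : Quiver.Path x y) (q : Quiver.Path y z) (a b : k) :
    concat k x y z (Finsupp.single p a) (Finsupp.single q b) =
      Finsupp.single (p.comp q) (a * b) := by
  simp [concat]

theorem concat_assoc {w x y z : V} (f : Quiver.Path w x →₀ k) (g : Quiver.Path x y →₀ k) (h : Quiver.Path y z →₀ k) :
    concat k w y z (concat k w x y f g) h = concat k w x z f (concat k x y z g h) := by
  induction f using Finsupp.induction_linear with
  | zero => simp
  | add f₁ f₂ h₁ h₂ => simp [h₁, h₂]
  | single p a =>
    induction g using Finsupp.induction_linear with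
    | zero => simp
    | add g₁ g₂ h₁ h₂ => simp [h₁, h₂]
    | single q b =>
      induction h using Finsupp.induction_linear with
      | zero => simp
      | add g₁ g₂ h₁ h₂ => rw [map_add, h₁, h₂, map_add, map_add]
      | single r c => simp only [concat_single_single, Quiver.Path.comp_assoc, mul_assoc]

theorem nil_concat {x y : V} (f : Quiver.Path x y →₀ k) :
    concat k x x y (Finsupp.single Quiver.Path.nil 1) f = f := by
  induction f using Finsupp.induction_linear with
  | zero => simp
  | add f₁ f₂ h₁ h₂ => simp [h₁, h₂]
  | single p a => simp

theorem concat_nil {x y : V} (f : Quiver.Path x y →₀ k) :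
    concat k x y y f (Finsupp.single Quiver.Path.nil 1) = f := by
  induction f using Finsupp.induction_linear with
  | zero => simp
  | add f₁ f₂ h₁ h₂ => simp [h₁, h₂]
  | single p a => simp

section Fintype

variable [Fintype V]

/-- Products are written as compositions of maps: in `f * g`, the paths of `g` come first. -/
instance : Mul (PathAlgebra k V) where
  mul f g := fun x y => ∑ z, concat k x z y (g x z) (f z y)

theorem mul_apply (f g : PathAlgebra k V) (x y : V) :
    (f * g) x y = ∑ z, concat k x z y (g x z) (f z y) := rfl

variable [DecidableEq V]

/-- The unit is the sum of the trivial paths. -/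
instance : One (PathAlgebra k V) where
  one := fun x => Pi.single (M := fun y => Quiver.Path x y →₀ k) x (Finsupp.single Quiver.Path.nil 1)

instance : Ring (PathAlgebra k V) where
  __ := (inferInstance : AddCommGroup (PathAlgebra k V))
  left_distrib f g h := by
    ext1 x y; simp [mul_apply, Finset.sum_add_distrib]
  right_distrib f g h := by
    ext1 x y; simp [mul_apply, Finset.sum_add_distrib]
  zero_mul f := by ext1 x y; simp [mul_apply]
  mul_zero f := by ext1 x y; simp [mul_apply]
  mul_assoc f g h := by
    ext1 x y
    simp only [mul_apply, map_sum, LinearMap.sum_apply, concat_assoc]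
    rw [Finset.sum_comm]
  one_mul f := by
    ext1 x y
    rw [mul_apply, Finset.sum_eq_single y]
    · exact (congrArg _ (Pi.single_eq_same (M := fun z => Quiver.Path y z →₀ k) _ _)).trans (concat_nil _)
    · intro z _ hz
      exact (congrArg _ (Pi.single_eq_of_ne (M := fun y => Quiver.Path z y →₀ k) hz.symm _)).trans (map_zero _)
    · simp
  mul_one f := by
    ext1 x y
    rw [mul_apply, Finset.sum_eq_single x]
    · exact (congrArg (fun g => concat k x x y g (f x y))
        (Pi.single_eq_same (M := fun z => Quiver.Path x z →₀ k) _ _)).trans (nil_concat _)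
    · intro z _ hz
      exact (congrArg (fun g => concat k x z y g (f z y))
        (Pi.single_eq_of_ne (M := fun y => Quiver.Path x y →₀ k) hz _)).trans (by simp)
    · simp

instance : Algebra k (PathAlgebra k V) :=
  Algebra.ofModule
    (fun c f g => by ext1 x y; simp [mul_apply, Finset.smul_sum])
    (fun c f g => by ext1 x y; simp [mul_apply, Finset.smul_sum])

/-- The inclusion `kQ(x, y) ⊆ kQ`. -/
def incl {x y : V} (r : Quiver.Path x y →₀ k) : PathAlgebra k V :=
  Pi.single (M := fun a => ∀ b, Quiver.Path a b →₀ k) x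
    (Pi.single (M := fun b => Quiver.Path x b →₀ k) y r)

/-- A path, as an element of the path algebra. -/
def ofPath (k : Type*) {V : Type*} [Field k] [Quiver V] [DecidableEq V] {x y : V}
    (p : Quiver.Path x y) : PathAlgebra k V :=
  incl (Finsupp.single p 1)

/-- The ideal `kQ⁺` of the path algebra generated by the arrows. -/
def arrowIdeal (k V : Type*) [Field k] [Quiver V] [Fintype V] [DecidableEq V] :
    Ideal (PathAlgebra k V) :=
  (TwoSidedIdeal.span
    {f : PathAlgebra k V | ∃ (x y : V) (α : x ⟶ y), f = ofPath k α.toPath}).asIdeal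

end Fintype

end

end PathAlgebra

/-! ### Admissible ideals -/

/-- An admissible ideal: a two-sided ideal `I` of `kQ` with `(kQ⁺)ⁿ ⊆ I ⊆ (kQ⁺)²` for some
`n ≥ 2`. -/
structure AdmissibleIdeal (k V : Type*) [Field k] [Quiver V] [Fintype V] [DecidableEq V] where
  ideal : Ideal (PathAlgebra k V)
  isTwoSided : ideal.IsTwoSided
  exists_pow_le : ∃ n : ℕ, 2 ≤ n ∧ PathAlgebra.arrowIdeal k V ^ n ≤ ideal
  le_sq : ideal ≤ PathAlgebra.arrowIdeal k V ^ 2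

attribute [instance] AdmissibleIdeal.isTwoSided

/-! ### Homotopy of walks and the fundamental group of a bound quiver -/

section Homotopy

variable {k V : Type*} [Field k] [Quiver V] [Fintype V] [DecidableEq V]

/-- `r = ∑ tᵢ uᵢ` (with distinct parallel paths `uᵢ` and nonzero `tᵢ`) is a minimal relation of `I`:
it is a nonzero element of `I`, and no subsum over a nonempty proper subset of the `uᵢ` is in `I`.
-/
def IsMinimalRelation (I : Ideal (PathAlgebra k V)) {x y : V} (r : Quiver.Path x y →₀ k) : Prop :=
  r ≠ 0 ∧ PathAlgebra.incl r ∈ I ∧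
    ∀ E : Finset (Quiver.Path x y), E.Nonempty → E ⊂ r.support →
      PathAlgebra.incl (∑ p ∈ E, Finsupp.single p (r p)) ∉ I

/-- Walks from `x` to `y`: formal products of arrows and of formal inverses of arrows. -/
abbrev Walk {V : Type*} [Quiver V] (x y : Symmetrify V) : Type _ :=
  Quiver.Path x y

/-- A path, as a walk. -/
abbrev pathToWalk {V : Type*} [Quiver V] {x y : V} (p : Quiver.Path x y) :
    Walk (Symmetrify.of.obj x) (Symmetrify.of.obj y) :=
  Symmetrify.of.mapPath p

/-- The homotopy relation of `(Q, I)`: the smallest equivalence relation on walks that is compatible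
with concatenation, contains `α⁻¹α ∼ e_x` and `αα⁻¹ ∼ e_y` for every arrow `α : x ⟶ y`, and relates
any two paths that appear in a same minimal relation. -/
inductive Homotopic (I : Ideal (PathAlgebra k V)) : ∀ {x y : Symmetrify V}, Walk x y → Walk x y → Prop
  | refl {x y : Symmetrify V} (u : Walk x y) : Homotopic I u u
  | symm {x y : Symmetrify V} {u v : Walk x y} : Homotopic I u v → Homotopic I v u
  | trans {x y : Symmetrify V} {u v w : Walk x y} : Homotopic I u v → Homotopic I v w → Homotopic I u w
  | comp {x y z : Symmetrify V} {u u' : Walk x y} {v v' : Walk y z} :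
      Homotopic I u u' → Homotopic I v v' → Homotopic I (u.comp v) (u'.comp v')
  | arrow_inv {x y : V} (α : x ⟶ y) :
      Homotopic I ((Symmetrify.of.map α).toPath.comp (Quiver.reverse (Symmetrify.of.map α)).toPath)
        Quiver.Path.nil
  | inv_arrow {x y : V} (α : x ⟶ y) :
      Homotopic I ((Quiver.reverse (Symmetrify.of.map α)).toPath.comp (Symmetrify.of.map α).toPath)
        Quiver.Path.nil
  | relation {x y : V} (r : Quiver.Path x y →₀ k) (hr : IsMinimalRelation I r) {p q : Quiver.Path x y}
      (hp : p ∈ r.support) (hq : q ∈ r.support) : Homotopic I (pathToWalk p) (pathToWalk q)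

variable (I : Ideal (PathAlgebra k V))

theorem Homotopic.comp_reverse {x y : Symmetrify V} (u : Walk x y) :
    Homotopic I (u.comp u.reverse) (Quiver.Path.nil : Walk x x) := by
  induction u with
  | nil => exact .refl _
  | @cons b c p a ih =>
    have h : Homotopic I ((Hom.toPath a).comp (Hom.toPath (Quiver.reverse a)))
        (Quiver.Path.nil : Walk b b) := by
      rcases a with α | α
      · exact .arrow_inv α
      · exact .inv_arrow α
    have h2 := Homotopic.comp (Homotopic.comp (Homotopic.refl (I := I) p) h)
      (Homotopic.refl (I := I) p.reverse)
    have h3 : (Quiver.Path.cons p a).comp (Quiver.Path.cons p a).reverse =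
        (p.comp ((Hom.toPath a).comp (Hom.toPath (Quiver.reverse a)))).comp p.reverse := by
      rw [Quiver.Path.reverse]
      rw [← Quiver.Path.comp_toPath_eq_cons]
      simp only [Quiver.Path.comp_assoc]
    rw [h3]
    exact h2.trans (by simpa using ih)

theorem Homotopic.reverse_comp {x y : Symmetrify V} (u : Walk x y) :
    Homotopic I (u.reverse.comp u) (Quiver.Path.nil : Walk y y) := by
  simpa using Homotopic.comp_reverse I u.reverse

theorem Homotopic.reverse {x y : Symmetrify V} {u v : Walk x y} (h : Homotopic I u v) :
    Homotopic I u.reverse v.reverse := by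
  have h1 : Homotopic I (u.reverse.comp (v.comp v.reverse)) u.reverse := by
    simpa using Homotopic.comp (Homotopic.refl (I := I) u.reverse) (Homotopic.comp_reverse I v)
  have h2 : Homotopic I ((u.reverse.comp u).comp v.reverse) v.reverse := by
    simpa using Homotopic.comp (Homotopic.reverse_comp I u) (Homotopic.refl (I := I) v.reverse)
  have h3 : Homotopic I ((u.reverse.comp u).comp v.reverse) (u.reverse.comp (v.comp v.reverse)) := by
    rw [Quiver.Path.comp_assoc]
    exact .comp (.refl _) (.comp h (.refl _))
  exact h1.symm.trans (h3.symm.trans h2)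

/-- Walks starting and ending at `x₀`. -/
abbrev ClosedWalk {V : Type*} [Quiver V] (x₀ : V) : Type _ :=
  Walk (Symmetrify.of.obj x₀) (Symmetrify.of.obj x₀)

/-- The homotopy relation on the closed walks at `x₀`. -/
def homotopySetoid (x₀ : V) : Setoid (ClosedWalk x₀) where
  r := Homotopic I
  iseqv := ⟨.refl, .symm, .trans⟩

/-- The fundamental group `π₁(Q, I, x₀)`: homotopy classes of closed walks at `x₀`. -/
def BoundQuiverPi1 (x₀ : V) : Type _ :=
  Quotient (homotopySetoid I x₀)

/-- The homotopy class of a closed walk. -/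
def BoundQuiverPi1.mk {x₀ : V} (w : ClosedWalk x₀) : BoundQuiverPi1 I x₀ :=
  Quotient.mk (homotopySetoid I x₀) w

/-- The product is induced by concatenation; as for paths, in `[u] * [v]` the walk `v` comes
first. -/
instance (x₀ : V) : Group (BoundQuiverPi1 I x₀) where
  mul := Quotient.map₂ (fun u v => v.comp u) fun _ _ h _ _ h' => Homotopic.comp h' h
  one := BoundQuiverPi1.mk I Quiver.Path.nil
  inv := Quotient.map (fun u => u.reverse) fun _ _ h => Homotopic.reverse I h
  mul_assoc a b c := by
    induction a using Quotient.inductionOn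
    induction b using Quotient.inductionOn
    induction c using Quotient.inductionOn
    exact congrArg (BoundQuiverPi1.mk I) (Quiver.Path.comp_assoc _ _ _).symm
  one_mul a := by
    induction a using Quotient.inductionOn
    exact congrArg (BoundQuiverPi1.mk I) (Quiver.Path.comp_nil _)
  mul_one a := by
    induction a using Quotient.inductionOn
    exact congrArg (BoundQuiverPi1.mk I) (Quiver.Path.nil_comp _)
  inv_mul_cancel a := by
    induction a using Quotient.inductionOn
    exact Quotient.sound (Homotopic.comp_reverse I _)

end Homotopy

/-! ### Finite-dimensional algebras and their ordinary quivers -/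

section Algebras

/-- A primitive idempotent: a nonzero idempotent that is not the sum of two nonzero orthogonal
idempotents. -/
def IsPrimitiveIdempotent {A : Type*} [Ring A] (e : A) : Prop :=
  IsIdempotentElem e ∧ e ≠ 0 ∧
    ∀ f g : A, IsIdempotentElem f → IsIdempotentElem g → f * g = 0 → g * f = 0 → e = f + g →
      f = 0 ∨ g = 0

/-- A decomposition of the unit into a sum of primitive pairwise orthogonal idempotents. -/
def IsPrimitiveDecomposition {A ι : Type*} [Ring A] [Fintype ι] (e : ι → A) : Prop :=
  CompleteOrthogonalIdempotents e ∧ ∀ i, IsPrimitiveIdempotent (e i)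

/-- The left modules `A e` and `A f` are isomorphic. -/
def ProjIso {A : Type*} [Ring A] (e f : A) : Prop :=
  Nonempty ((Ideal.span {e} : Ideal A) ≃ₗ[A] (Ideal.span {f} : Ideal A))

/-- `A` is basic: it is the direct sum of pairwise non-isomorphic indecomposable projective left
modules `A eᵢ`, for a decomposition `1 = ∑ eᵢ` into primitive orthogonal idempotents. -/
def IsBasicAlgebra (A : Type*) [Ring A] : Prop :=
  ∃ (n : ℕ) (e : Fin n → A), IsPrimitiveDecomposition e ∧ ∀ i j, i ≠ j → ¬ ProjIso (e i) (e j)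

/-- `A` is connected: it is nonzero and its only central idempotents are `0` and `1`, that is, `A` is
not a product of two nonzero algebras. -/
def IsConnectedAlgebra (A : Type*) [Ring A] : Prop :=
  Nontrivial A ∧ ∀ c : A, IsIdempotentElem c → (∀ a, c * a = a * c) → c = 0 ∨ c = 1

/-- The subspace `f X e` of `A`, for a left ideal `X`. -/
def peirceSpace (k : Type*) {A : Type*} [Field k] [Ring A] [Algebra k A] (f : A) (X : Ideal A) (e : A) :
    Submodule k A :=
  (X.restrictScalars k).map (LinearMap.mulLeftRight k (f, e))

/-- `Q` (with vertex set `V`) is the ordinary quiver of `A`, the vertex `x` standing for the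
idempotent `e x`: the number of arrows `x ⟶ y` is the dimension of `e_y R e_x / e_y R² e_x`, where
`R` is the (Jacobson) radical of `A`. -/
def IsOrdinaryQuiver (k : Type*) {A V : Type*} [Field k] [Ring A] [Algebra k A] [Quiver V]
    (e : V → A) : Prop :=
  ∀ x y : V, Finite (x ⟶ y) ∧
    Nat.card (x ⟶ y) = Module.finrank k
      (↥(peirceSpace k (e y) (Ring.jacobson A) (e x)) ⧸
        (peirceSpace k (e y) (Ring.jacobson A ^ 2) (e x)).submoduleOf
          (peirceSpace k (e y) (Ring.jacobson A) (e x)))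

/-- The isomorphism of algebras `φ : kQ/I ≅ A` is compatible with the vertices of the ordinary
quiver: it sends the class of the trivial path at each vertex `x` to an idempotent `f` such that
`A f ≅ A e_x`. -/
def RespectsVertices {k A V : Type*} [Field k] [Ring A] [Algebra k A] [Quiver V] [Fintype V]
    [DecidableEq V] (e : V → A) (I : AdmissibleIdeal k V)
    (φ : (PathAlgebra k V ⧸ I.ideal) ≃ₐ[k] A) : Prop :=
  ∀ x : V, ProjIso
    (φ (Ideal.Quotient.mk I.ideal (PathAlgebra.ofPath k (Quiver.Path.nil : Quiver.Path x x)))) (e x)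

end Algebras

/-! ### Exponentials of nilpotent endomorphisms and pairs of gradings -/

section ExpHomogeneous

open IsNilpotent

variable {k M : Type*} [Field k] [CharZero k] [AddCommGroup M] [Module k M] [Module ℚ M]

/-! Without double bypass, `Q` has no oriented cycle and at most one arrow between two vertices,
hence finitely many paths. For a family `c` of combinations of bypasses, let `deriv c` be the
derivation of `kQ` sending each arrow `α` to `c α`. An arrow occurring in a bypass has no bypass
itself, so `deriv c` kills every `c' α`; these derivations therefore commute, and they are nilpotent
because they lengthen paths. In characteristic zero their exponentials are the automorphisms `α ↦ α
+ c α`, and composing them amounts to adding the families (`transvection_arrow`, `exp_deriv_add`).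

The kernels of two presentations that respect the vertices correspond under an automorphism of `kQ`
fixing the vertices (`IsPresentation.exists_comap_eq`), which is a diagonal automorphism followed by
such a transvection. Homotopy relations are compared through gradings: an ideal is graded by its own
homotopy classes, and if `K` is graded by the classes of `L`, then homotopy for `K` implies homotopy
for `L` (`isHomogeneous_self`, `Homotopic.of_isHomogeneous`). Diagonal automorphisms preserve such
gradings.

The heart is `exists_common_homogeneous`. The parts of `c` that preserve one of the two families of
classes can be absorbed into the ideals without losing their gradings. What remains of `c` has no
component of degree zero for either grading, and `stable_of_exp_homogeneous` shows that its
derivation then stabilizes the ideal, so that the two ideals coincide. Thus any two presentations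
that respect the vertices have a common refinement.

Since there are finitely many pairs of parallel paths, a presentation with the fewest homotopic
pairs exists; by common refinement its homotopy relation is contained in all the others, which gives
(1). For (2), primitive idempotents and arrows are intrinsic to `A`, so any presentation respects
the vertices after an automorphism of `Q`; connectedness allows a change of base point. -/

theorem exp_eq_one_add_add {d : Module.End k M} (hd : IsNilpotent d) :
    ∃ G : Module.End k M, exp d = 1 + d + G * d * d ∧
      ∀ K : Submodule k M, (∀ x ∈ K, d x ∈ K) → ∀ x ∈ K, G x ∈ K := by
  obtain ⟨n, hn⟩ := hd
  -- The tail of the exponential series with `d ^ 2` factored out. Being a polynomial in `d`, it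
  -- preserves every `d`-stable subspace.
  refine ⟨∑ i ∈ Finset.range n, ((i + 2).factorial : ℚ)⁻¹ • d ^ i, ?_, ?_⟩
  · have h : d ^ (n + 2) = 0 := by rw [pow_add, hn, zero_mul]
    rw [exp_eq_sum h, Finset.sum_range_succ', Finset.sum_range_succ', Finset.sum_mul,
      Finset.sum_mul]
    have h1 : ∀ i, ((i + 2).factorial : ℚ)⁻¹ • d ^ (i + 2) =
        ((i + 2).factorial : ℚ)⁻¹ • d ^ i * d * d := fun i => by
      rw [pow_add, pow_two, smul_mul_assoc, smul_mul_assoc, mul_assoc]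
    simp only [add_assoc, one_add_one_eq_two, h1]
    simp
    abel
  · intro K hK x hx
    have hpow : ∀ i, (d ^ i) x ∈ K := by
      intro i
      induction i with
      | zero => simpa
      | succ i ih => rw [pow_succ', Module.End.mul_apply]; exact hK _ ih
    rw [LinearMap.sum_apply]
    refine K.sum_mem fun i _ => ?_
    rw [LinearMap.smul_apply, ← Rat.cast_smul_eq_qsmul k]
    exact K.smul_mem _ (hpow i)

theorem exp_mem_of_stable {d : Module.End k M} (hd : IsNilpotent d) {K : Submodule k M}
    (hK : ∀ x ∈ K, d x ∈ K) {x : M} (hx : x ∈ K) : exp d x ∈ K := by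
  obtain ⟨G, hG, hGK⟩ := exp_eq_one_add_add hd
  rw [hG]
  exact K.add_mem (K.add_mem hx (hK _ hx)) (hGK K hK _ (hK _ (hK _ hx)))

theorem exp_sub_self_mem {d : Module.End k M} (hd : IsNilpotent d) {K L : Submodule k M}
    (hKL : ∀ x ∈ L, d x ∈ K) (hK : ∀ x ∈ K, d x ∈ K) {x : M} (hx : x ∈ L) : exp d x - x ∈ K := by
  obtain ⟨G, hG, hGK⟩ := exp_eq_one_add_add hd
  have h : exp d x - x = d x + G (d (d x)) := by
    rw [hG]; simp [add_assoc]
  rw [h]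
  exact K.add_mem (hKL _ hx) (hGK K hK _ (hK _ (hKL _ hx)))

theorem map_exp_eq_of_stable {d : Module.End k M} (hd : IsNilpotent d) {K : Submodule k M}
    (hK : ∀ x ∈ K, d x ∈ K) : K.map (exp d) = K := by
  apply le_antisymm
  · rintro _ ⟨x, hx, rfl⟩
    exact exp_mem_of_stable hd hK hx
  · intro x hx
    refine ⟨exp (-d) x, exp_mem_of_stable hd.neg (fun y hy => K.neg_mem (hK y hy)) hx, ?_⟩
    rw [← Module.End.mul_apply, exp_mul_exp_neg_self hd, Module.End.one_apply]

/-- If a subspace is graded for one grading, its image under `exp d` is graded for a second,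
compatible grading, and the nilpotent map `d` is triangular and has no component of degree zero for
either grading, then the subspace is stable under `d`. -/
theorem stable_of_exp_homogeneous {ι ι' : Type*} [Fintype ι] [Fintype ι']
    {P : ι → Module.End k M} {P' : ι' → Module.End k M}
    (hP : ∑ i, P i = 1) (hP' : ∑ j, P' j = 1)
    (hPP : ∀ i, P i * P i = P i) (hPP' : ∀ j, P' j * P' j = P' j)
    (hcomm : ∀ i j, Commute (P i) (P' j))
    {F : ℕ → Submodule k M} (hF0 : F 0 = ⊥) (hFmono : Monotone F) {N : ℕ} (hFN : F N = ⊤)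
    (hPF : ∀ i n, ∀ x ∈ F n, P i x ∈ F n) (hPF' : ∀ j n, ∀ x ∈ F n, P' j x ∈ F n)
    {d : Module.End k M} (hd : IsNilpotent d) (hdF : ∀ n, ∀ x ∈ F (n + 1), d x ∈ F n)
    (hoff : ∀ i, P i * d * P i = 0) (hoff' : ∀ j, P' j * d * P' j = 0)
    {I : Submodule k M} (hI : ∀ i, ∀ x ∈ I, P i x ∈ I)
    (hJ : ∀ j, ∀ x ∈ I.map (exp d), P' j x ∈ I.map (exp d)) :
    ∀ x ∈ I, d x ∈ I := by
  have hdF' : ∀ n, ∀ x ∈ F n, d x ∈ F n := by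
    intro n x hx
    cases n with
    | zero =>
      rw [hF0, Submodule.mem_bot] at hx
      rw [hx, map_zero]; exact Submodule.zero_mem _
    | succ n => exact hFmono n.le_succ (hdF n x hx)
  have hUV : ∀ x, exp d (exp (-d) x) = x := fun x => by
    rw [← Module.End.mul_apply, exp_mul_exp_neg_self hd, Module.End.one_apply]
  have hVU : ∀ x, exp (-d) (exp d x) = x := fun x => by
    rw [← Module.End.mul_apply, exp_neg_mul_exp_self hd, Module.End.one_apply]
  suffices key : ∀ n, ∀ x ∈ I, x ∈ F n → d x ∈ I from
    fun x hx => key N x hx (hFN ▸ Submodule.mem_top)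
  intro n
  induction n with
  | zero =>
    intro x _ hx
    rw [hF0, Submodule.mem_bot] at hx
    rw [hx, map_zero]; exact I.zero_mem
  | succ n ih =>
    -- By induction `d` stabilizes `K`, hence so does `exp d`, and `K` is also the intersection of
    -- `I.map (exp d)` with `F n`. It is therefore graded for both gradings, and all errors below
    -- can be taken modulo `K`.
    set K : Submodule k M := I ⊓ F n with hKdef
    have hKd : ∀ x ∈ K, d x ∈ K := fun x hx => ⟨ih x hx.1 hx.2, hdF' n x hx.2⟩
    have hKd' : ∀ x ∈ K, (-d) x ∈ K := fun x hx => K.neg_mem (hKd x hx)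
    have hKJ : ∀ x, x ∈ I.map (exp d) → x ∈ F n → x ∈ K := by
      rintro _ ⟨y, hy, rfl⟩ hx
      have hyF : y ∈ F n := by
        rw [← hVU y]
        exact exp_mem_of_stable hd.neg (fun z hz => (F n).neg_mem (hdF' n z hz)) hx
      exact exp_mem_of_stable hd hKd ⟨hy, hyF⟩
    have hKJ' : ∀ x ∈ K, x ∈ I.map (exp d) := fun x hx =>
      ⟨exp (-d) x, (exp_mem_of_stable hd.neg hKd' hx).1, hUV x⟩
    have hKP : ∀ i, ∀ x ∈ K, P i x ∈ K := fun i x hx => ⟨hI i x hx.1, hPF i n x hx.2⟩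
    have hKP' : ∀ j, ∀ x ∈ K, P' j x ∈ K := fun j x hx =>
      hKJ _ (hJ j x (hKJ' x hx)) (hPF' j n x hx.2)
    -- For varying `j`, the elements `b = exp (-d) (P' j (exp d r))` lie in `I` and add up to `r`.
    -- Each has a homogeneous image `exp d b` and agrees with the bihomogeneous element `P' j r`
    -- modulo `F n`.
    have step : ∀ i j, ∀ r ∈ I, r ∈ F (n + 1) → P i r = r →
        d (exp (-d) (P' j (exp d r))) ∈ I := by
      intro i j r hr hrF hir
      have hc : ∀ x, P i (P' j x) = P' j (P i x) := fun x =>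
        LinearMap.congr_fun (hcomm i j).eq x
      set a := P' j (exp d r) with ha
      set b := exp (-d) a with hb
      have haJ : a ∈ I.map (exp d) := hJ j _ ⟨r, hr, rfl⟩
      have hbI : b ∈ I := by
        obtain ⟨y, hy, hya⟩ := haJ
        rw [hb, ← hya, hVU]; exact hy
      have har : a - P' j r ∈ F n := by
        rw [ha, ← map_sub]
        exact hPF' j n _ (exp_sub_self_mem hd (hdF n) (hdF' n) hrF)
      have haF : a ∈ F (n + 1) := hPF' j _ _ (exp_mem_of_stable hd (hdF' _) hrF)
      have hba : b - a ∈ F n :=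
        exp_sub_self_mem hd.neg (fun z hz => (F n).neg_mem (hdF n z hz))
          (fun z hz => (F n).neg_mem (hdF' n z hz)) haF
      have hbr : b - P' j r ∈ F n := by
        have := (F n).add_mem hba har
        rwa [sub_add_sub_cancel] at this
      have hbP : b - P i b ∈ K := by
        refine ⟨I.sub_mem hbI (hI i b hbI), ?_⟩
        have h1 := (F n).sub_mem hbr (hPF i n _ hbr)
        rw [map_sub, hc, hir, sub_sub_sub_cancel_right] at h1
        exact h1
      set c := P i b with hcdef
      have hcc : P i c = c := LinearMap.congr_fun (hPP i) b
      -- Here `s` is bihomogeneous of degree `(i, j)`, while the error `x` has degree `i`, has no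
      -- component of degree `j`, and lies in `F n`.
      set s := P' j c with hs
      set x := c - P' j c with hx
      have hsc : s + x = c := by rw [hs, hx]; abel
      have his : P i s = s := by rw [hs, hc, hcc]
      have hjs : P' j s = s := LinearMap.congr_fun (hPP' j) c
      have hix : P i x = x := by rw [hx, map_sub, hc, hcc]
      have hjx : P' j x = 0 := by rw [hx, map_sub, ← hs, hjs, hs, sub_self]
      have hids : P i (d s) = 0 := by
        have := LinearMap.congr_fun (hoff i) s
        simpa [his] using this
      have hjds : P' j (d s) = 0 := by
        have := LinearMap.congr_fun (hoff' j) s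
        simpa [hjs] using this
      have hxF : x ∈ F n := by
        have h1 := (F n).sub_mem hbr (hPF' j n _ hbr)
        have h2 : P' j (P' j r) = P' j r := LinearMap.congr_fun (hPP' j) r
        rw [map_sub, h2] at h1
        have h3 : b - P' j b ∈ F n := by convert h1 using 1; abel
        have h4 := hPF i n _ h3
        rw [map_sub, hc] at h4
        exact h4
      obtain ⟨G, hG, hGst⟩ := exp_eq_one_add_add hd
      -- Besides `s`, `x` and `d s`, the expansion of `exp d c` only contains terms with at least
      -- one `d` applied to `x` or to `d s`.
      set y := d x + G (d (d c)) with hy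
      have hUc : exp d c = s + x + d s + y := by
        have h1 : d c = d s + d x := by rw [← map_add, hsc]
        have h2 : exp d c = c + d c + G (d (d c)) := by rw [hG]; rfl
        rw [h2, hy, hsc, add_assoc c, add_assoc c, h1]
        abel
      have hUcK : exp d c - P' j (exp d c) ∈ K := by
        have h1 : exp d b = a := hUV a
        have h2 : P' j a = a := LinearMap.congr_fun (hPP' j) _
        have h3 : exp d (b - c) ∈ K := exp_mem_of_stable hd hKd hbP
        have h4 := K.sub_mem (hKP' j _ h3) h3
        rw [map_sub (exp d), h1, map_sub, h2] at h4
        convert h4 using 1; abel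
      -- Since `exp d c` has degree `j` modulo `K`, the projection `1 - P' j` sends it into `K`;
      -- this projection kills `s` and fixes `x` and `d s`. Next, `1 - P i` kills `x` and fixes `d
      -- s`, which separates the two.
      have e1 : x + d s + (y - P' j y) ∈ K := by
        rw [hUc] at hUcK
        simp only [map_add, hjs, hjx, hjds] at hUcK
        convert hUcK using 1; abel
      have e2 : d s + ((y - P' j y) - P i (y - P' j y)) ∈ K := by
        have h1 := K.sub_mem e1 (hKP i _ e1)
        simp only [map_add, hix, hids] at h1
        convert h1 using 1; abel
      -- If `x` and `d s` lie at some level of the filtration modulo `K`, then `y` lies one level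
      -- deeper; `e2` then pushes `d s` one level deeper, and `e1` does the same for `x`. At level
      -- `0` only `K` remains.
      have desc : ∀ m ≤ n, x ∈ F (n - m) ⊔ K ∧ d s ∈ F (n - m) ⊔ K := by
        intro m
        induction m with
        | zero =>
          intro _
          have h1 : c ∈ F (n + 1) := by
            rw [← hsc]
            refine hPF i _ _ ?_ |> fun h => hsc ▸ h
            exact exp_mem_of_stable hd.neg (fun z hz => (F _).neg_mem (hdF' _ z hz)) haF
          exact ⟨Submodule.mem_sup_left hxF,
            Submodule.mem_sup_left (hdF n _ (hPF' j _ _ h1))⟩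
        | succ m ihm =>
          intro hm
          obtain ⟨hx1, hs1⟩ := ihm (by omega)
          have hnm : n - m = n - (m + 1) + 1 := by omega
          rw [hnm] at hx1 hs1
          set L := F (n - (m + 1)) ⊔ K with hL
          have dL : ∀ z ∈ F (n - (m + 1) + 1) ⊔ K, d z ∈ L := by
            intro z hz
            obtain ⟨z1, h1, z2, h2, rfl⟩ := Submodule.mem_sup.1 hz
            rw [map_add]
            exact L.add_mem (Submodule.mem_sup_left (hdF _ _ h1))
              (Submodule.mem_sup_right (hKd _ h2))
          have stab : ∀ T : Module.End k M, (∀ z ∈ F (n - (m + 1)), T z ∈ F (n - (m + 1))) →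
              (∀ z ∈ K, T z ∈ K) → ∀ z ∈ L, T z ∈ L := by
            intro T hT1 hT2 z hz
            obtain ⟨z1, h1, z2, h2, rfl⟩ := Submodule.mem_sup.1 hz
            rw [map_add]
            exact L.add_mem (Submodule.mem_sup_left (hT1 _ h1))
              (Submodule.mem_sup_right (hT2 _ h2))
          have dL' : ∀ z ∈ L, d z ∈ L := stab d (hdF' _) hKd
          have hyL : y ∈ L := by
            refine L.add_mem (dL x hx1) (hGst L dL' _ ?_)
            rw [← hsc, map_add, map_add]
            exact L.add_mem (dL _ hs1) (dL' _ (dL _ hx1))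
          have hyL1 : y - P' j y ∈ L := L.sub_mem hyL (stab _ (hPF' j _) (hKP' j) _ hyL)
          have hyL2 := L.sub_mem hyL1 (stab _ (hPF i _) (hKP i) _ hyL1)
          have hds : d s ∈ L := by
            have := L.sub_mem (Submodule.mem_sup_right e2) hyL2
            rwa [add_sub_cancel_right] at this
          refine ⟨?_, hds⟩
          have := L.sub_mem (L.sub_mem (Submodule.mem_sup_right e1) hyL1) hds
          rwa [add_sub_cancel_right, add_sub_cancel_right] at this
      obtain ⟨hxK, hsK⟩ := desc n le_rfl
      rw [Nat.sub_self, hF0, bot_sup_eq] at hxK hsK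
      have hdc : d c ∈ K := by
        rw [← hsc, map_add]
        exact K.add_mem hsK (hKd x hxK)
      have := K.add_mem (hKd _ hbP) hdc
      rw [map_sub, sub_add_cancel] at this
      exact this.1
    have step2 : ∀ i, ∀ r ∈ I, r ∈ F (n + 1) → P i r = r → d r ∈ I := by
      intro i r hr hrF hir
      have h1 : d r = ∑ j, d (exp (-d) (P' j (exp d r))) := by
        rw [← map_sum, ← map_sum, ← LinearMap.sum_apply, hP', Module.End.one_apply, hVU]
      rw [h1]
      exact I.sum_mem fun j _ => step i j r hr hrF hir
    intro r hr hrF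
    have h1 : d r = ∑ i, d (P i r) := by
      rw [← map_sum, ← LinearMap.sum_apply, hP, Module.End.one_apply]
    rw [h1]
    exact I.sum_mem fun i _ => step2 i _ (hI i r hr) (hPF i _ r hrF) (LinearMap.congr_fun (hPP i) r)

end ExpHomogeneous

/-! ### Basic facts on path algebras -/

namespace PathAlgebra

section Basic

variable {k V : Type*} [Field k] [Quiver V] [DecidableEq V]

@[simp]
theorem incl_apply_same {x y : V} (r : Quiver.Path x y →₀ k) : incl r x y = r := by
  simp [incl]

theorem incl_apply_of_ne {x y a b : V} (r : Quiver.Path x y →₀ k) (h : ¬ (a = x ∧ b = y)) :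
    incl r a b = 0 := by
  by_cases ha : a = x
  · subst ha
    have hb : b ≠ y := fun hb => h ⟨rfl, hb⟩
    simp [incl, hb]
  · have : incl r a = 0 := by simp [incl, ha]
    rw [this]; rfl

/-- The inclusion of a component, as a linear map. -/
noncomputable def inclₗ (k : Type*) {V : Type*} [Field k] [Quiver V] [DecidableEq V] (x y : V) :
    (Quiver.Path x y →₀ k) →ₗ[k] PathAlgebra k V where
  toFun := incl
  map_add' r s := by
    ext1 a b
    by_cases h : a = x ∧ b = y
    · obtain ⟨rfl, rfl⟩ := h; simp
    · simp [incl_apply_of_ne _ h]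
  map_smul' c r := by
    ext1 a b
    by_cases h : a = x ∧ b = y
    · obtain ⟨rfl, rfl⟩ := h; simp
    · simp [incl_apply_of_ne _ h]

@[simp]
theorem inclₗ_apply {x y : V} (r : Quiver.Path x y →₀ k) : inclₗ k x y r = incl r := rfl

theorem incl_zero {x y : V} : incl (0 : Quiver.Path x y →₀ k) = 0 := (inclₗ k x y).map_zero

theorem incl_add {x y : V} (r s : Quiver.Path x y →₀ k) : incl (r + s) = incl r + incl s :=
  (inclₗ k x y).map_add r s

theorem incl_smul {x y : V} (c : k) (r : Quiver.Path x y →₀ k) : incl (c • r) = c • incl r :=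
  (inclₗ k x y).map_smul c r

theorem incl_single {x y : V} (p : Quiver.Path x y) (c : k) :
    incl (Finsupp.single p c) = c • ofPath k p := by
  rw [ofPath, ← incl_smul, Finsupp.smul_single, smul_eq_mul, mul_one]

theorem incl_eq_sum {x y : V} (r : Quiver.Path x y →₀ k) :
    incl r = ∑ p ∈ r.support, r p • ofPath k p := by
  conv_lhs => rw [← Finsupp.sum_single r, Finsupp.sum, ← inclₗ_apply, map_sum]
  simp [incl_single]

theorem ofPath_apply_same {x y : V} (p : Quiver.Path x y) :
    ofPath k p x y = Finsupp.single p 1 := incl_apply_same _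

variable [Fintype V]

theorem sum_incl (f : PathAlgebra k V) : ∑ x, ∑ y, incl (f x y) = f := by
  have happ : ∀ (s : Finset V) (g : V → PathAlgebra k V) (a b : V),
      (∑ x ∈ s, g x) a b = ∑ x ∈ s, g x a b := by
    intro s g a b
    induction s using Finset.induction_on with
    | empty => simp
    | insert x s hx ih => rw [Finset.sum_insert hx, Finset.sum_insert hx, add_apply, ih]
  ext1 a b
  rw [happ, Finset.sum_eq_single a]
  · rw [happ, Finset.sum_eq_single b]
    · simp
    · intro y _ hy
      exact incl_apply_of_ne _ fun h => hy h.2.symm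
    · simp
  · intro x _ hx
    rw [happ]
    exact Finset.sum_eq_zero fun y _ => incl_apply_of_ne _ fun h => hx h.1.symm
  · simp

theorem induction_linear {C : PathAlgebra k V → Prop} (f : PathAlgebra k V)
    (zero : C 0) (add : ∀ f g, C f → C g → C (f + g))
    (smul_ofPath : ∀ (c : k) {x y : V} (p : Quiver.Path x y), C (c • ofPath k p)) : C f := by
  have hincl : ∀ {x y : V} (r : Quiver.Path x y →₀ k), C (incl r) := by
    intro x y r
    induction r using Finsupp.induction_linear with
    | zero => rwa [incl_zero]
    | add r s hr hs => rw [incl_add]; exact add _ _ hr hs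
    | single p c => rw [incl_single]; exact smul_ofPath c p
  rw [← sum_incl f]
  refine Finset.sum_induction _ C add zero fun x _ => ?_
  exact Finset.sum_induction _ C add zero fun y _ => hincl _

theorem linearMap_ext {B : Type*} [AddCommMonoid B] [Module k B] {F G : PathAlgebra k V →ₗ[k] B}
    (h : ∀ {x y : V} (p : Quiver.Path x y), F (ofPath k p) = G (ofPath k p)) : F = G := by
  ext f
  induction f using induction_linear with
  | zero => simp
  | add f g hf hg => simp [hf, hg]
  | smul_ofPath c p => simp [h]

theorem incl_mul_incl {x y z : V} (r : Quiver.Path y z →₀ k) (s : Quiver.Path x y →₀ k) :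
    incl r * incl s = incl (concat k x y z s r) := by
  ext1 a b
  rw [mul_apply]
  by_cases h : a = x ∧ b = z
  · obtain ⟨rfl, rfl⟩ := h
    rw [Finset.sum_eq_single y]
    · simp
    · intro c _ hc
      rw [incl_apply_of_ne s fun h => hc h.2, map_zero, LinearMap.zero_apply]
    · simp
  · rw [incl_apply_of_ne _ h]
    refine Finset.sum_eq_zero fun c _ => ?_
    by_cases ha : a = x
    · rw [incl_apply_of_ne r fun hh => h ⟨ha, hh.2⟩, map_zero]
    · rw [incl_apply_of_ne s fun hh => ha hh.1, map_zero, LinearMap.zero_apply]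

theorem incl_mul_incl_of_ne {x y y' z : V} (hy : y ≠ y') (r : Quiver.Path y' z →₀ k)
    (s : Quiver.Path x y →₀ k) : incl r * incl s = 0 := by
  ext1 a b
  rw [mul_apply]
  refine Finset.sum_eq_zero fun c _ => ?_
  by_cases hc : c = y
  · rw [incl_apply_of_ne r fun hh => hy (hc.symm.trans hh.1), map_zero]
  · rw [incl_apply_of_ne s fun hh => hc hh.2, map_zero, LinearMap.zero_apply]

theorem ofPath_mul_ofPath {x y z : V} (q : Quiver.Path y z) (p : Quiver.Path x y) :
    ofPath k q * ofPath k p = ofPath k (p.comp q) := by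
  simp [ofPath, incl_mul_incl]

theorem ofPath_mul_ofPath_of_ne {x y y' z : V} (hy : y ≠ y') (q : Quiver.Path y' z)
    (p : Quiver.Path x y) : ofPath k q * ofPath k p = 0 :=
  incl_mul_incl_of_ne hy _ _

theorem ofPath_cons {x y z : V} (p : Quiver.Path x y) (α : y ⟶ z) :
    ofPath k (p.cons α) = ofPath k α.toPath * ofPath k p := by
  rw [ofPath_mul_ofPath]; rfl

/-- The idempotent of the path algebra given by the trivial path at a vertex. -/
noncomputable abbrev vertex (k : Type*) {V : Type*} [Field k] [Quiver V] [DecidableEq V] (x : V) :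
    PathAlgebra k V :=
  ofPath k (Quiver.Path.nil : Quiver.Path x x)

theorem sum_vertex : ∑ x, vertex k x = (1 : PathAlgebra k V) := by
  rw [← sum_incl (1 : PathAlgebra k V)]
  refine Finset.sum_congr rfl fun x _ => ?_
  rw [Finset.sum_eq_single x]
  · exact congrArg incl (Pi.single_eq_same (M := fun y => Quiver.Path x y →₀ k) _ _).symm
  · intro y _ hy
    have : (1 : PathAlgebra k V) x y = 0 :=
      Pi.single_eq_of_ne (M := fun y => Quiver.Path x y →₀ k) hy _
    rw [this, incl_zero]
  · simp

theorem completeOrthogonalIdempotents_vertex :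
    CompleteOrthogonalIdempotents (vertex k : V → PathAlgebra k V) := by
  rw [CompleteOrthogonalIdempotents.iff_ortho_complete]
  exact ⟨fun x y hxy => ofPath_mul_ofPath_of_ne hxy.symm _ _, sum_vertex⟩

theorem incl_mul_vertex {x y : V} (r : Quiver.Path x y →₀ k) : incl r * vertex k x = incl r := by
  rw [vertex, ofPath, incl_mul_incl, nil_concat]

theorem vertex_mul_incl {x y : V} (r : Quiver.Path x y →₀ k) : vertex k y * incl r = incl r := by
  rw [vertex, ofPath, incl_mul_incl, concat_nil]

theorem vertex_mul_mul_vertex (f : PathAlgebra k V) (x y : V) :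
    vertex k y * f * vertex k x = incl (f x y) := by
  induction f using induction_linear with
  | zero => simp [incl_zero]
  | add f g hf hg => rw [mul_add, add_mul, hf, hg, add_apply, incl_add]
  | @smul_ofPath c a b p =>
    rw [mul_smul_comm, smul_mul_assoc, smul_apply, incl_smul]
    congr 1
    by_cases ha : a = x
    · by_cases hb : b = y
      · subst ha hb
        rw [ofPath, vertex_mul_incl, incl_mul_vertex, incl_apply_same]
      · rw [ofPath_mul_ofPath_of_ne hb, zero_mul, ofPath,
          incl_apply_of_ne _ fun h => hb h.2.symm, incl_zero]
    · rw [mul_assoc, ofPath_mul_ofPath_of_ne (Ne.symm ha), mul_zero, ofPath,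
        incl_apply_of_ne _ fun h => ha h.1.symm, incl_zero]

theorem incl_apply_mem {I : Ideal (PathAlgebra k V)} [I.IsTwoSided] {f : PathAlgebra k V}
    (hf : f ∈ I) (x y : V) : incl (f x y) ∈ I := by
  rw [← vertex_mul_mul_vertex]
  exact I.mul_mem_right _ (I.mul_mem_left _ hf)

theorem mem_of_incl_apply_mem {I : Ideal (PathAlgebra k V)} {f : PathAlgebra k V}
    (hf : ∀ x y, incl (f x y) ∈ I) : f ∈ I := by
  rw [← sum_incl f]
  exact I.sum_mem fun x _ => I.sum_mem fun y _ => hf x y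

theorem algHom_ext {B : Type*} [Ring B] [Algebra k B] {F G : PathAlgebra k V →ₐ[k] B}
    (hv : ∀ x : V, F (vertex k x) = G (vertex k x))
    (ha : ∀ {x y : V} (α : x ⟶ y), F (ofPath k α.toPath) = G (ofPath k α.toPath)) : F = G := by
  have h : ∀ {x y : V} (p : Quiver.Path x y), F (ofPath k p) = G (ofPath k p) := by
    intro x y p
    induction p with
    | nil => exact hv x
    | cons p α ih => rw [ofPath_cons, map_mul, map_mul, ih, ha]
  exact AlgHom.toLinearMap_injective (linearMap_ext h)

end Basic

/-! ### The universal property -/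

section Lift

variable {k V : Type*} [Field k] [Quiver V] {B : Type*} [Ring B] [Algebra k B]

/-- The value on paths of the morphism with given values on vertices and arrows. -/
def evalPath (E : V → B) (a : ∀ {x y : V}, (x ⟶ y) → B) {x : V} : ∀ {y : V}, Quiver.Path x y → B
  | _, .nil => E x
  | _, .cons p α => a α * evalPath E a p

variable (k) {E : V → B} {a : ∀ {x y : V}, (x ⟶ y) → B}

theorem evalPath_comp (hE : ∀ x, E x * E x = E x)
    (ha : ∀ {x y : V} (α : x ⟶ y), E y * a α * E x = a α) {x y z : V} (p : Quiver.Path x y)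
    (q : Quiver.Path y z) :
    evalPath E a (p.comp q) = evalPath E a q * evalPath E a p := by
  have haE : ∀ {x y : V} (α : x ⟶ y), E y * a α = a α := fun {x y} α => by
    rw [← ha α, ← mul_assoc, ← mul_assoc, hE]
  induction q with
  | nil =>
    cases p with
    | nil => exact (hE x).symm
    | cons p α => simp only [Quiver.Path.comp_nil, evalPath, ← mul_assoc, haE]
  | cons q α ih => simp only [Quiver.Path.comp_cons, evalPath, ih, mul_assoc]

theorem mul_evalPath (hE : ∀ x, E x * E x = E x)
    (ha : ∀ {x y : V} (α : x ⟶ y), E y * a α * E x = a α) {x y : V} (p : Quiver.Path x y) :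
    E y * evalPath E a p = evalPath E a p :=
  (evalPath_comp hE ha p .nil).symm

theorem evalPath_mul (hE : ∀ x, E x * E x = E x)
    (ha : ∀ {x y : V} (α : x ⟶ y), E y * a α * E x = a α) {x y : V} (p : Quiver.Path x y) :
    evalPath E a p * E x = evalPath E a p := by
  rw [← Quiver.Path.nil_comp p, evalPath_comp hE ha .nil p, mul_assoc]
  exact congrArg _ (hE x)

variable [Fintype V] [DecidableEq V]

/-- The linear map underlying `lift`. -/
noncomputable def liftₗ (E : V → B) (a : ∀ {x y : V}, (x ⟶ y) → B) : PathAlgebra k V →ₗ[k] B :=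
  ∑ x, ∑ y, (Finsupp.linearCombination k (evalPath E a (x := x) (y := y))).comp
    ((LinearMap.proj (R := k) (φ := fun y => Quiver.Path x y →₀ k) y).comp
      (LinearMap.proj (R := k) (φ := fun x => ∀ y, Quiver.Path x y →₀ k) x))

theorem liftₗ_apply (f : PathAlgebra k V) :
    liftₗ k E a f = ∑ x, ∑ y, Finsupp.linearCombination k (evalPath E a) (f x y) := by
  simp only [liftₗ, LinearMap.sum_apply]; rfl

theorem liftₗ_ofPath {x y : V} (p : Quiver.Path x y) :
    liftₗ k E a (ofPath k p) = evalPath E a p := by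
  rw [liftₗ_apply, Finset.sum_eq_single x, Finset.sum_eq_single y]
  · simp [ofPath_apply_same]
  · intro z _ hz
    rw [ofPath, incl_apply_of_ne _ fun h => hz h.2, map_zero]
  · simp
  · intro z _ hz
    refine Finset.sum_eq_zero fun w _ => ?_
    rw [ofPath, incl_apply_of_ne _ fun h => hz h.1, map_zero]
  · simp

/-- The algebra morphism with given values on vertices and arrows. -/
noncomputable def lift (hE : CompleteOrthogonalIdempotents E)
    (ha : ∀ {x y : V} (α : x ⟶ y), E y * a α * E x = a α) : PathAlgebra k V →ₐ[k] B :=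
  AlgHom.ofLinearMap (liftₗ k E a)
    (by
      rw [← sum_vertex, map_sum, ← hE.complete]
      exact Finset.sum_congr rfl fun x _ => liftₗ_ofPath k _)
    (by
      intro f g
      have hE' : ∀ x, E x * E x = E x := fun x => hE.idem x
      induction f using induction_linear with
      | zero => simp
      | add f f' hf hf' => rw [add_mul, map_add, hf, hf', map_add, add_mul]
      | @smul_ofPath c y' z q =>
        induction g using induction_linear with
        | zero => simp
        | add g g' hg hg' => rw [mul_add, map_add, hg, hg', map_add, mul_add]
        | @smul_ofPath c' x y p =>
          rw [smul_mul_smul_comm, map_smul, map_smul, map_smul, smul_mul_smul_comm,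
            liftₗ_ofPath, liftₗ_ofPath]
          congr 1
          by_cases hy : y = y'
          · subst hy
            rw [ofPath_mul_ofPath, liftₗ_ofPath, evalPath_comp hE' ha]
          · rw [ofPath_mul_ofPath_of_ne hy, map_zero, ← evalPath_mul hE' ha q,
              ← mul_evalPath hE' ha p, mul_assoc, ← mul_assoc (E y'), hE.ortho (Ne.symm hy),
              zero_mul, mul_zero])

theorem lift_ofPath (hE : CompleteOrthogonalIdempotents E)
    (ha : ∀ {x y : V} (α : x ⟶ y), E y * a α * E x = a α) {x y : V} (p : Quiver.Path x y) :
    lift k hE ha (ofPath k p) = evalPath E a p :=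
  liftₗ_ofPath k p

theorem lift_vertex (hE : CompleteOrthogonalIdempotents E)
    (ha : ∀ {x y : V} (α : x ⟶ y), E y * a α * E x = a α) (x : V) :
    lift k hE ha (vertex k x) = E x :=
  liftₗ_ofPath k _

theorem lift_arrow (hE : CompleteOrthogonalIdempotents E)
    (ha : ∀ {x y : V} (α : x ⟶ y), E y * a α * E x = a α) {x y : V} (α : x ⟶ y) :
    lift k hE ha (ofPath k α.toPath) = a α := by
  rw [lift_ofPath]
  change a α * E x = a α
  rw [← ha α, mul_assoc, hE.idem x]

end Lift

/-! ### Powers of the arrow ideal -/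

section ArrowIdeal

variable {k V : Type*} [Field k] [Quiver V]

theorem exists_of_mem_support_concat {x y z : V} {r : Quiver.Path x y →₀ k}
    {s : Quiver.Path y z →₀ k} {p : Quiver.Path x z} (hp : p ∈ (concat k x y z r s).support) :
    ∃ q ∈ r.support, ∃ q' ∈ s.support, p = q.comp q' := by
  classical
  by_contra! h
  apply Finsupp.mem_support_iff.1 hp
  rw [concat, Finsupp.linearCombination_apply, Finsupp.sum, LinearMap.sum_apply,
    Finsupp.finsetSum_apply]
  refine Finset.sum_eq_zero fun q hq => ?_
  rw [LinearMap.smul_apply, Finsupp.smul_apply, Finsupp.lmapDomain_apply]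
  have : Finsupp.mapDomain (fun q' => q.comp q') s p = 0 := by
    by_contra hne
    have := Finsupp.mapDomain_support (Finsupp.mem_support_iff.2 hne)
    obtain ⟨q', hq', rfl⟩ := Finset.mem_image.1 this
    exact h q hq q' hq' rfl
  rw [this, smul_zero]

theorem concat_apply_eq_zero {x y z : V} {m n : ℕ} {r : Quiver.Path x y →₀ k}
    {s : Quiver.Path y z →₀ k} (hr : ∀ p, p.length < m → r p = 0)
    (hs : ∀ p, p.length < n → s p = 0) (p : Quiver.Path x z) (hp : p.length < m + n) :
    concat k x y z r s p = 0 := by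
  by_contra hne
  obtain ⟨q, hq, q', hq', rfl⟩ := exists_of_mem_support_concat (Finsupp.mem_support_iff.2 hne)
  rw [Quiver.Path.length_comp] at hp
  by_cases h : q.length < m
  · exact Finsupp.mem_support_iff.1 hq (hr q h)
  · exact Finsupp.mem_support_iff.1 hq' (hs q' (by omega))

variable [Fintype V] [DecidableEq V]

/-- The ideal spanned by the paths of length at least `n`. -/
def lengthIdeal (k V : Type*) [Field k] [Quiver V] [Fintype V] [DecidableEq V] (n : ℕ) :
    Ideal (PathAlgebra k V) where
  carrier := {f | ∀ (x y : V) (p : Quiver.Path x y), p.length < n → f x y p = 0}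
  zero_mem' := fun _ _ _ _ => rfl
  add_mem' := fun hf hg x y p hp => by
    rw [add_apply, Finsupp.add_apply, hf x y p hp, hg x y p hp, add_zero]
  smul_mem' := fun c f hf x y p hp => by
    rw [smul_eq_mul, mul_apply, Finsupp.finsetSum_apply]
    exact Finset.sum_eq_zero fun z _ => concat_apply_eq_zero (n := 0) (hf x z)
      (fun _ h => absurd h (Nat.not_lt_zero _)) p (by simpa using hp)

theorem mul_mem_lengthIdeal {m n : ℕ} {f g : PathAlgebra k V} (hf : f ∈ lengthIdeal k V m)
    (hg : g ∈ lengthIdeal k V n) : f * g ∈ lengthIdeal k V (n + m) := by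
  intro x y p hp
  rw [mul_apply, Finsupp.finsetSum_apply]
  exact Finset.sum_eq_zero fun z _ => concat_apply_eq_zero (hg x z) (hf z y) p hp

theorem ofPath_mem_lengthIdeal {n : ℕ} {x y : V} {p : Quiver.Path x y} :
    ofPath k p ∈ lengthIdeal k V n ↔ n ≤ p.length := by
  constructor
  · intro h
    by_contra hp
    have := h x y p (not_le.1 hp)
    rw [ofPath_apply_same, Finsupp.single_eq_same] at this
    exact one_ne_zero this
  · intro hp a b q hq
    by_cases h : a = x ∧ b = y
    · obtain ⟨rfl, rfl⟩ := h
      rw [ofPath_apply_same, Finsupp.single_apply_eq_zero]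
      rintro rfl
      omega
    · rw [ofPath, incl_apply_of_ne _ h]; rfl

theorem incl_mem_lengthIdeal {n : ℕ} {x y : V} {r : Quiver.Path x y →₀ k} :
    incl r ∈ lengthIdeal k V n ↔ ∀ p ∈ r.support, n ≤ p.length := by
  constructor
  · intro h p hp
    by_contra hlt
    have := h x y p (not_le.1 hlt)
    rw [incl_apply_same] at this
    exact Finsupp.mem_support_iff.1 hp this
  · intro h
    rw [incl_eq_sum]
    exact Ideal.sum_mem _ fun p hp =>
      Submodule.smul_of_tower_mem _ _ (ofPath_mem_lengthIdeal.2 (h p hp))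

instance (n : ℕ) : (lengthIdeal k V n).IsTwoSided :=
  ⟨fun b hf => by
    -- Every element lies in the length ideal of index `0`, so right multiplication is the case of a
    -- factor of length at least `0`.
    have := mul_mem_lengthIdeal hf (n := 0) (g := b) fun _ _ _ h => absurd h (Nat.not_lt_zero _)
    rwa [zero_add] at this⟩

theorem arrowIdeal_le_lengthIdeal : arrowIdeal k V ≤ lengthIdeal k V 1 := by
  have h : TwoSidedIdeal.span {f : PathAlgebra k V | ∃ (x y : V) (α : x ⟶ y),
      f = ofPath k α.toPath} ≤ (lengthIdeal k V 1).toTwoSided := by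
    rw [TwoSidedIdeal.span_le]
    rintro _ ⟨x, y, α, rfl⟩
    rw [SetLike.mem_coe, Ideal.mem_toTwoSided]
    exact ofPath_mem_lengthIdeal.2 le_rfl
  intro f hf
  exact Ideal.mem_toTwoSided.1 (h hf)

theorem arrow_mem_arrowIdeal {x y : V} (α : x ⟶ y) : ofPath k α.toPath ∈ arrowIdeal k V :=
  TwoSidedIdeal.mem_asIdeal.2 (TwoSidedIdeal.subset_span ⟨x, y, α, rfl⟩)

theorem mem_of_mem_support {W : Submodule k (PathAlgebra k V)} {f : PathAlgebra k V}
    (h : ∀ (x y : V), ∀ p ∈ (f x y).support, ofPath k p ∈ W) : f ∈ W := by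
  rw [← sum_incl f]
  refine W.sum_mem fun x _ => W.sum_mem fun y _ => ?_
  rw [incl_eq_sum]
  exact W.sum_mem fun p hp => W.smul_mem _ (h x y p hp)

instance : (arrowIdeal k V).IsTwoSided :=
  inferInstanceAs (TwoSidedIdeal.asIdeal _).IsTwoSided

/-- A path of length at least `n` factors into `n` arrows and a path. Admissibility thus becomes a
condition on coefficients. -/
theorem arrowIdeal_pow (n : ℕ) : arrowIdeal k V ^ n = lengthIdeal k V n := by
  apply le_antisymm
  · induction n with
    | zero =>
      intro f _ x y p hp
      exact absurd hp (Nat.not_lt_zero _)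
    | succ n ih =>
      rw [Ideal.IsTwoSided.pow_succ, Ideal.mul_le]
      intro f hf g hg
      exact mul_mem_lengthIdeal (arrowIdeal_le_lengthIdeal hf) (ih hg)
  · have key : ∀ (n : ℕ) {x y : V} (p : Quiver.Path x y), n ≤ p.length →
        ofPath k p ∈ arrowIdeal k V ^ n := by
      intro n
      induction n with
      | zero =>
        intro x y p _
        rw [Submodule.pow_zero, Ideal.one_eq_top]
        exact Submodule.mem_top
      | succ n ih =>
        intro x y p hp
        cases p with
        | nil => simp at hp
        | cons p α =>
          rw [ofPath_cons, Ideal.IsTwoSided.pow_succ]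
          exact Ideal.mul_mem_mul (arrow_mem_arrowIdeal α) (ih p (by simpa using hp))
    intro f hf
    refine mem_of_mem_support (W := (arrowIdeal k V ^ n).restrictScalars k) fun x y p hp =>
      key n p ?_
    by_contra hlt
    exact Finsupp.mem_support_iff.1 hp (hf x y p (not_le.1 hlt))

end ArrowIdeal

end PathAlgebra

/-! ### Quivers without double bypass -/

namespace NoDoubleBypass

variable {V : Type*} [Quiver V]

theorem eq_toPath_of_appears (h : NoDoubleBypass V) {x y : V} {α : x ⟶ y}
    {u : Quiver.Path x y} (hu : u ≠ α.toPath) {a b : V} {β : a ⟶ b} (hβ : ArrowAppears β u)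
    (v : Quiver.Path a b) : v = β.toPath := by
  by_contra hv
  exact h α u β v hu hv hβ

/-- If a cycle at `x` ends with the arrow `α`, then `α` followed by this cycle is a bypass of `α`
containing `α`, a double bypass on its own. -/
theorem eq_nil (h : NoDoubleBypass V) {x : V} (p : Quiver.Path x x) : p = .nil := by
  cases p with
  | nil => rfl
  | @cons y _ q α =>
    have hu : α.toPath.comp (q.cons α) ≠ α.toPath := fun he => by
      have := congrArg Quiver.Path.length he
      simp [Quiver.Path.length_comp] at this
    have := h.eq_toPath_of_appears hu (β := α) ⟨.nil, q.cons α, by simp⟩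
      (α.toPath.comp (q.cons α))
    exact absurd this hu

/-- Two distinct parallel arrows are bypasses of each other, and each appears in itself. -/
theorem subsingleton_hom (h : NoDoubleBypass V) (x y : V) : Subsingleton (x ⟶ y) := by
  refine ⟨fun α β => ?_⟩
  by_contra hne
  have hp : β.toPath ≠ α.toPath := fun he => by
    apply hne
    simpa [Quiver.Hom.toPath] using he.symm
  have := h.eq_toPath_of_appears hp (β := β) ⟨.nil, .nil, (Quiver.Path.nil_comp _).symm⟩ α.toPath
  exact hp this.symm

theorem ne_of_hom (h : NoDoubleBypass V) {x y : V} (α : x ⟶ y) : x ≠ y := by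
  rintro rfl
  have := h.eq_nil α.toPath
  simp [Quiver.Hom.toPath] at this

theorem two_le_length (h : NoDoubleBypass V) {x y : V} {α : x ⟶ y} {u : Quiver.Path x y}
    (hu : u ≠ α.toPath) : 2 ≤ u.length := by
  cases u with
  | nil => exact absurd rfl (h.ne_of_hom α)
  | cons u β =>
    cases u with
    | nil =>
      have := h.subsingleton_hom x y
      exact absurd (congrArg Quiver.Hom.toPath (Subsingleton.elim β α)) hu
    | cons u γ => simp

variable [Fintype V]

/-- In the absence of cycles, the set of vertices from which a given vertex can be reached grows
strictly along each arrow. -/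
theorem length_lt_card (h : NoDoubleBypass V) {x y : V} (p : Quiver.Path x y) :
    p.length < Fintype.card V := by
  classical
  let r : V → Finset V := fun y => Finset.univ.filter fun z => Nonempty (Quiver.Path z y)
  have hr : ∀ {y z : V} (_ : y ⟶ z), (r y).card < (r z).card := by
    intro y z α
    refine Finset.card_lt_card (Finset.ssubset_iff_of_subset ?_ |>.2 ⟨z, ?_, ?_⟩)
    · intro w hw
      obtain ⟨q⟩ := (Finset.mem_filter.1 hw).2
      exact Finset.mem_filter.2 ⟨Finset.mem_univ _, ⟨q.cons α⟩⟩
    · exact Finset.mem_filter.2 ⟨Finset.mem_univ _, ⟨.nil⟩⟩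
    · intro hz
      obtain ⟨q⟩ := (Finset.mem_filter.1 hz).2
      have := h.eq_nil (q.cons α)
      simp at this
  have hlen : p.length + 1 ≤ (r y).card := by
    induction p with
    | nil => exact Finset.card_pos.2 ⟨x, Finset.mem_filter.2 ⟨Finset.mem_univ _, ⟨.nil⟩⟩⟩
    | cons p α ih => have := hr α; simp only [Quiver.Path.length_cons]; omega
  exact hlen.trans (Finset.card_le_univ _)

/-- With at most one arrow between two vertices, a path is determined by its list of vertices, whose
length is bounded. -/
theorem finite_path (h : NoDoubleBypass V) (x y : V) : Finite (Quiver.Path x y) := by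
  have := h.subsingleton_hom
  have hlen : ∀ {x y : V} (p : Quiver.Path x y), p.toList.length = p.length := by
    intro x y p
    induction p with
    | nil => rfl
    | cons p α ih => simp [ih]
  have hfin := List.finite_length_le V (Fintype.card V)
  have := hfin.to_subtype
  refine Finite.of_injective
    (fun p : Quiver.Path x y => (⟨p.toList, ?_⟩ : {l : List V | l.length ≤ Fintype.card V})) ?_
  · exact (hlen p).trans_le (h.length_lt_card p).le
  · intro p q hpq
    exact Quiver.Path.toList_injective x y (congrArg Subtype.val hpq)

end NoDoubleBypass

/-! ### Derivations of the path algebra and their exponentials -/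

namespace PathAlgebra

section Derivation

variable {k V : Type*} [Field k] [Quiver V]

/-- Families of elements of the path algebra parallel to the arrows. -/
abbrev ArrowMap (k V : Type*) [Field k] [Quiver V] : Type _ :=
  ∀ x y : V, (x ⟶ y) → (Quiver.Path x y →₀ k)

/-- The value on a path of the derivation with values `c` on the arrows. -/
noncomputable def derivPath (c : ArrowMap k V) {x : V} :
    ∀ {y : V}, Quiver.Path x y → (Quiver.Path x y →₀ k)
  | _, .nil => 0
  | _, .cons p α => concat k _ _ _ (Finsupp.single p 1) (c _ _ α) +
      concat k _ _ _ (derivPath c p) (Finsupp.single α.toPath 1)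

theorem derivPath_add (c c' : ArrowMap k V) {x y : V} (p : Quiver.Path x y) :
    derivPath (c + c') p = derivPath c p + derivPath c' p := by
  induction p with
  | nil => simp [derivPath]
  | cons p α ih =>
    simp only [derivPath, Pi.add_apply, map_add, ih, LinearMap.add_apply]
    abel

theorem derivPath_toPath (c : ArrowMap k V) {x y : V} (α : x ⟶ y) :
    derivPath c α.toPath = c x y α := by
  simp [Quiver.Hom.toPath, derivPath, nil_concat]

/-- A path occurring in the derivative of `p` arises from `p` by replacing one arrow `α` with a path
occurring in `c α`. The two hypotheses treat the replacement of the last arrow and of an earlier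
one. -/
theorem mem_support_derivPath {c : ArrowMap k V}
    {ρ : ∀ {x y : V}, Quiver.Path x y → Quiver.Path x y → Prop}
    (h₁ : ∀ {x y z : V} (p : Quiver.Path x y) (α : y ⟶ z), ∀ u ∈ (c y z α).support,
      ρ (p.cons α) (p.comp u))
    (h₂ : ∀ {x y z : V} (p q : Quiver.Path x y) (α : y ⟶ z), ρ p q → ρ (p.cons α) (q.cons α))
    {x y : V} {p q : Quiver.Path x y} (hq : q ∈ (derivPath c p).support) : ρ p q := by
  classical
  induction p with
  | nil => simp [derivPath] at hq
  | cons p α ih =>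
    rcases Finset.mem_union.1 (Finsupp.support_add hq) with h | h
    · obtain ⟨p', hp', u, hu, rfl⟩ := exists_of_mem_support_concat h
      obtain rfl : p' = p := by
        by_contra hne
        exact Finsupp.mem_support_iff.1 hp' (Finsupp.single_eq_of_ne hne)
      exact h₁ p' α u hu
    · obtain ⟨p', hp', u, hu, rfl⟩ := exists_of_mem_support_concat h
      obtain rfl : u = α.toPath := by
        by_contra hne
        exact Finsupp.mem_support_iff.1 hu (Finsupp.single_eq_of_ne hne)
      exact h₂ p p' α (ih hp')

theorem derivPath_comp (c : ArrowMap k V) {x y z : V} (p : Quiver.Path x y)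
    (q : Quiver.Path y z) :
    derivPath c (p.comp q) = concat k _ _ _ (derivPath c p) (Finsupp.single q 1) +
      concat k _ _ _ (Finsupp.single p 1) (derivPath c q) := by
  induction q with
  | nil => simp [derivPath, concat_nil]
  | cons q α ih =>
    simp only [Quiver.Path.comp_cons, derivPath, ih, map_add, LinearMap.add_apply, concat_assoc]
    simp only [← concat_assoc, concat_single_single, mul_one]
    rw [← add_assoc, add_comm (concat k x _ _ _ (c _ _ α)), add_assoc]
    rfl

/-- The action of a derivation on the component `kQ(x, y)`. -/
noncomputable def derivBlock (c : ArrowMap k V) (x y : V) : Module.End k (Quiver.Path x y →₀ k) :=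
  Finsupp.linearCombination k (derivPath c)

@[simp]
theorem derivBlock_single (c : ArrowMap k V) {x y : V} (p : Quiver.Path x y) (t : k) :
    derivBlock c x y (Finsupp.single p t) = t • derivPath c p := by
  simp [derivBlock]

theorem derivBlock_concat (c : ArrowMap k V) {x y z : V} (r : Quiver.Path x y →₀ k)
    (s : Quiver.Path y z →₀ k) :
    derivBlock c x z (concat k x y z r s) =
      concat k x y z (derivBlock c x y r) s + concat k x y z r (derivBlock c y z s) := by
  induction r using Finsupp.induction_linear with
  | zero => simp
  | add r r' h h' => simp only [map_add, LinearMap.add_apply, h, h']; abel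
  | single p a =>
    induction s using Finsupp.induction_linear with
    | zero => simp
    | add s s' h h' => simp only [map_add, h, h']; abel
    | single q b =>
      have ha : Finsupp.single p a = a • Finsupp.single p (1 : k) := by simp
      have hb : Finsupp.single q b = b • Finsupp.single q (1 : k) := by simp
      rw [concat_single_single, derivBlock_single, derivBlock_single, derivBlock_single,
        derivPath_comp, ha, hb]
      simp only [map_smul, LinearMap.smul_apply, smul_smul, smul_add]
      rw [mul_comm b a]

/-- The derivation of the path algebra with values `c` on the arrows. -/
noncomputable def deriv (c : ArrowMap k V) : Module.End k (PathAlgebra k V) where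
  toFun f x y := derivBlock c x y (f x y)
  map_add' _ _ := funext fun x => funext fun y => (derivBlock c x y).map_add _ _
  map_smul' _ _ := funext fun x => funext fun y => (derivBlock c x y).map_smul _ _

theorem deriv_apply (c : ArrowMap k V) (f : PathAlgebra k V) (x y : V) :
    deriv c f x y = derivBlock c x y (f x y) := rfl

theorem derivBlock_add (c c' : ArrowMap k V) (x y : V) :
    derivBlock (c + c') x y = derivBlock c x y + derivBlock c' x y := by
  ext p : 1
  refine LinearMap.ext_ring ?_
  simp [derivPath_add]

theorem deriv_add (c c' : ArrowMap k V) : deriv (c + c') = deriv c + deriv c' := by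
  refine LinearMap.ext fun f => ?_
  ext1 x y
  simp [deriv_apply, derivBlock_add]

theorem deriv_zero : deriv (0 : ArrowMap k V) = 0 := by
  have := deriv_add (0 : ArrowMap k V) 0
  rwa [add_zero, left_eq_add] at this

theorem deriv_neg (c : ArrowMap k V) : deriv (-c) = -deriv c := by
  rw [eq_neg_iff_add_eq_zero, ← deriv_add, neg_add_cancel, deriv_zero]

theorem deriv_mul [Fintype V] (c : ArrowMap k V) (f g : PathAlgebra k V) :
    deriv c (f * g) = f * deriv c g + deriv c f * g := by
  ext1 x y
  simp only [deriv_apply, add_apply, mul_apply, map_sum, derivBlock_concat,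
    Finset.sum_add_distrib]

end Derivation

/-! ### Derivations without component along the arrows -/

section Bypass

variable {k V : Type*} [Field k] [Quiver V]

/-- The family `c` only involves paths that are different from the given arrow. -/
def IsBypassMap (c : ArrowMap k V) : Prop :=
  ∀ (x y : V) (α : x ⟶ y), c x y α α.toPath = 0

theorem IsBypassMap.ne_toPath {c : ArrowMap k V} (hc : IsBypassMap c) {x y : V} {α : x ⟶ y}
    {u : Quiver.Path x y} (hu : u ∈ (c x y α).support) : u ≠ α.toPath := by
  rintro rfl
  exact Finsupp.mem_support_iff.1 hu (hc x y α)

theorem derivPath_eq_zero {c : ArrowMap k V} {x y : V} {u : Quiver.Path x y}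
    (h : ∀ {a b : V} (β : a ⟶ b), ArrowAppears β u → c a b β = 0) : derivPath c u = 0 := by
  induction u with
  | nil => rfl
  | @cons y z p α ih =>
    rw [derivPath, h α ⟨p, .nil, rfl⟩, ih fun β ⟨q, q', hq⟩ => h β ⟨q, q'.cons α, by
      rw [hq]; simp⟩]
    simp

/-- The decisive use of the hypothesis on `Q`: a path in `c' α` is a bypass of `α`, so none of its
arrows has a bypass, and `c` vanishes on all of them. -/
theorem derivBlock_bypassMap (hdb : NoDoubleBypass V) {c c' : ArrowMap k V} (hc : IsBypassMap c)
    (hc' : IsBypassMap c') {x y : V} (α : x ⟶ y) : derivBlock c x y (c' x y α) = 0 := by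
  rw [derivBlock, Finsupp.linearCombination_apply, Finsupp.sum]
  refine Finset.sum_eq_zero fun u hu => ?_
  rw [derivPath_eq_zero, smul_zero]
  intro a b β hβ
  by_contra hne
  obtain ⟨v, hv⟩ := Finsupp.support_nonempty_iff.2 hne
  exact hc.ne_toPath hv (hdb.eq_toPath_of_appears (hc'.ne_toPath hu) hβ v)

/-- The commutator of two derivations is a derivation, and it kills the arrows because both
composites do. -/
theorem derivBlock_commute (hdb : NoDoubleBypass V) {c c' : ArrowMap k V} (hc : IsBypassMap c)
    (hc' : IsBypassMap c') (x y : V) : Commute (derivBlock c x y) (derivBlock c' x y) := by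
  have key : ∀ {x y : V} (p : Quiver.Path x y),
      derivBlock c x y (derivPath c' p) = derivBlock c' x y (derivPath c p) := by
    intro x y p
    induction p with
    | nil => simp [derivPath]
    | cons p α ih =>
      simp only [derivPath, map_add, derivBlock_concat, derivBlock_single, one_smul,
        derivBlock_bypassMap hdb hc hc', derivBlock_bypassMap hdb hc' hc, map_zero, ih,
        derivPath_toPath]
      abel
  refine LinearMap.ext fun r => ?_
  induction r using Finsupp.induction_linear with
  | zero => simp
  | add r s hr hs => simp only [map_add, hr, hs]
  | single p t =>
    simp only [Module.End.mul_apply, derivBlock_single, map_smul, key]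

theorem deriv_commute (hdb : NoDoubleBypass V) {c c' : ArrowMap k V} (hc : IsBypassMap c)
    (hc' : IsBypassMap c') : Commute (deriv c) (deriv c') := by
  refine LinearMap.ext fun f => ?_
  ext1 x y
  exact LinearMap.congr_fun (derivBlock_commute hdb hc hc' x y) (f x y)

/-- Replacing an arrow by a bypass, which has length at least two, lengthens the path. Nilpotency
follows, since path lengths are bounded. -/
theorem length_lt_of_mem_support_derivPath (hdb : NoDoubleBypass V) {c : ArrowMap k V}
    (hc : IsBypassMap c) {x y : V} {p q : Quiver.Path x y} (hq : q ∈ (derivPath c p).support) :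
    p.length < q.length := by
  refine mem_support_derivPath (ρ := fun p q => p.length < q.length) ?_ ?_ hq
  · intro x y z p α u hu
    have := hdb.two_le_length (hc.ne_toPath hu)
    simp only [Quiver.Path.length_cons, Quiver.Path.length_comp]
    omega
  · intro x y z p q α h
    simpa using h

/-- The elements of `kQ(x, y)` that only involve paths of length at least `n`. -/
def lengthFiltration (k : Type*) {V : Type*} [Field k] [Quiver V] (x y : V) (n : ℕ) :
    Submodule k (Quiver.Path x y →₀ k) :=
  Finsupp.supported k k {p | n ≤ p.length}

theorem derivBlock_mem_lengthFiltration (hdb : NoDoubleBypass V) {c : ArrowMap k V}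
    (hc : IsBypassMap c) {x y : V} {n : ℕ} {r : Quiver.Path x y →₀ k}
    (hr : r ∈ lengthFiltration k x y n) :
    derivBlock c x y r ∈ lengthFiltration k x y (n + 1) := by
  rw [derivBlock, Finsupp.linearCombination_apply, Finsupp.sum]
  refine Submodule.sum_mem _ fun p hp => Submodule.smul_mem _ _ fun q hq => ?_
  exact (hr hp).trans_lt (length_lt_of_mem_support_derivPath hdb hc hq)

variable [Fintype V]

theorem derivBlock_pow_card (hdb : NoDoubleBypass V) {c : ArrowMap k V}
    (hc : IsBypassMap c) (x y : V) : derivBlock c x y ^ Fintype.card V = 0 := by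
  refine LinearMap.ext fun r => ?_
  have : ∀ n, (derivBlock c x y ^ n) r ∈ lengthFiltration k x y n := by
    intro n
    induction n with
    | zero => exact fun p _ => Nat.zero_le _
    | succ n ih =>
      rw [pow_succ', Module.End.mul_apply]
      exact derivBlock_mem_lengthFiltration hdb hc ih
  rw [LinearMap.zero_apply, ← Finsupp.support_eq_empty, Finset.eq_empty_iff_forall_notMem]
  intro p hp
  exact absurd (this _ hp) (not_le.2 (hdb.length_lt_card p))

theorem isNilpotent_derivBlock (hdb : NoDoubleBypass V) {c : ArrowMap k V}
    (hc : IsBypassMap c) (x y : V) : IsNilpotent (derivBlock c x y) :=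
  ⟨_, derivBlock_pow_card hdb hc x y⟩

theorem isNilpotent_deriv (hdb : NoDoubleBypass V) {c : ArrowMap k V}
    (hc : IsBypassMap c) : IsNilpotent (deriv c) := by
  refine ⟨Fintype.card V, LinearMap.ext fun f => ?_⟩
  have : ∀ (n : ℕ) (x y : V), (deriv c ^ n) f x y = (derivBlock c x y ^ n) (f x y) := by
    intro n x y
    induction n with
    | zero => rfl
    | succ n ih => rw [pow_succ', pow_succ', Module.End.mul_apply, deriv_apply, ih]; rfl
  ext1 x y
  rw [this, derivBlock_pow_card hdb hc]; rfl

end Bypass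

/-! ### Unipotent automorphisms -/

section Transvection

open IsNilpotent

variable {k V : Type*} [Field k] [CharZero k] [Quiver V]

noncomputable instance : Module ℚ (PathAlgebra k V) :=
  inferInstanceAs (Module ℚ (∀ x y : V, Quiver.Path x y →₀ k))

variable [Fintype V]

theorem exp_deriv_apply (hdb : NoDoubleBypass V) {c : ArrowMap k V} (hc : IsBypassMap c)
    (f : PathAlgebra k V) (x y : V) :
    exp (deriv c) f x y = exp (derivBlock c x y) (f x y) := by
  let g : PathAlgebra k V →ₗ[k] (Quiver.Path x y →₀ k) :=
    (LinearMap.proj (R := k) (φ := fun y => Quiver.Path x y →₀ k) y).comp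
      (LinearMap.proj (R := k) (φ := fun x => ∀ y, Quiver.Path x y →₀ k) x)
  have := Module.End.commute_exp_left_of_commute (g := g) (isNilpotent_deriv hdb hc)
    (isNilpotent_derivBlock hdb hc x y) rfl
  exact (LinearMap.congr_fun this f).symm

theorem exp_deriv_add (hdb : NoDoubleBypass V) {c c' : ArrowMap k V} (hc : IsBypassMap c)
    (hc' : IsBypassMap c') : exp (deriv (c + c')) = exp (deriv c) * exp (deriv c') := by
  rw [deriv_add]
  exact exp_add_of_commute (deriv_commute hdb hc hc') (isNilpotent_deriv hdb hc)
    (isNilpotent_deriv hdb hc')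

variable [DecidableEq V]

theorem exp_deriv_incl (hdb : NoDoubleBypass V) {c : ArrowMap k V} (hc : IsBypassMap c)
    {x y : V} (r : Quiver.Path x y →₀ k) :
    exp (deriv c) (incl r) = incl (exp (derivBlock c x y) r) := by
  ext1 a b
  rw [exp_deriv_apply hdb hc]
  by_cases h : a = x ∧ b = y
  · obtain ⟨rfl, rfl⟩ := h; simp
  · simp [incl_apply_of_ne _ h]

/-- The automorphism `exp (deriv c)`, which sends each arrow `α` to `α + c α`. -/
noncomputable def transvection (hdb : NoDoubleBypass V) {c : ArrowMap k V} (hc : IsBypassMap c) :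
    PathAlgebra k V →ₐ[k] PathAlgebra k V :=
  AlgHom.ofLinearMap (exp (deriv c))
    (by
      rw [← sum_vertex, map_sum]
      refine Finset.sum_congr rfl fun x _ => ?_
      rw [vertex, ofPath, exp_deriv_incl hdb hc]
      congr 1
      obtain ⟨G, hG, -⟩ := exp_eq_one_add_add (isNilpotent_derivBlock hdb hc x x)
      rw [hG]
      simp [derivPath])
    (Module.End.exp_mul_of_derivation k _ _ (deriv_mul c) (isNilpotent_deriv hdb hc))

theorem transvection_apply (hdb : NoDoubleBypass V) {c : ArrowMap k V} (hc : IsBypassMap c)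
    (f : PathAlgebra k V) : transvection hdb hc f = exp (deriv c) f := rfl

theorem transvection_vertex (hdb : NoDoubleBypass V) {c : ArrowMap k V} (hc : IsBypassMap c)
    (x : V) : transvection hdb hc (vertex k x) = vertex k x := by
  rw [transvection_apply, vertex, ofPath, exp_deriv_incl hdb hc]
  congr 1
  obtain ⟨G, hG, -⟩ := exp_eq_one_add_add (isNilpotent_derivBlock hdb hc x x)
  rw [hG]
  simp [derivPath]

theorem transvection_arrow (hdb : NoDoubleBypass V) {c : ArrowMap k V} (hc : IsBypassMap c)
    {x y : V} (α : x ⟶ y) :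
    transvection hdb hc (ofPath k α.toPath) = ofPath k α.toPath + incl (c x y α) := by
  rw [transvection_apply, ofPath, exp_deriv_incl hdb hc, ← incl_add]
  congr 1
  obtain ⟨G, hG, -⟩ := exp_eq_one_add_add (isNilpotent_derivBlock hdb hc x y)
  rw [hG]
  -- The exponential series stops after the linear term on an arrow, because the derivation kills `c
  -- α`.
  simp [derivPath_toPath, derivBlock_bypassMap hdb hc hc]

end Transvection

end PathAlgebra

/-! ### Homotopy of walks: cancellation -/

namespace Homotopic

variable {k V : Type*} [Field k] [Quiver V] [Fintype V] [DecidableEq V]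
  {I : Ideal (PathAlgebra k V)}

/-- Walks are invertible up to homotopy. Cancellation lets the degree of a derivation be read off
its values on arrows. -/
theorem comp_left_iff {x y z : Symmetrify V} (w : Walk x y) {u v : Walk y z} :
    Homotopic I (w.comp u) (w.comp v) ↔ Homotopic I u v := by
  refine ⟨fun h => ?_, fun h => .comp (.refl w) h⟩
  have key : ∀ u : Walk y z, Homotopic I (w.reverse.comp (w.comp u)) u := fun u => by
    rw [← Quiver.Path.comp_assoc]
    simpa using Homotopic.comp (Homotopic.reverse_comp I w) (Homotopic.refl (I := I) u)
  exact (key u).symm.trans ((Homotopic.comp (.refl _) h).trans (key v))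

theorem comp_right_iff {x y z : Symmetrify V} {u v : Walk x y} (w : Walk y z) :
    Homotopic I (u.comp w) (v.comp w) ↔ Homotopic I u v := by
  refine ⟨fun h => ?_, fun h => .comp h (.refl w)⟩
  have key : ∀ u : Walk x y, Homotopic I ((u.comp w).comp w.reverse) u := fun u => by
    rw [Quiver.Path.comp_assoc]
    simpa using Homotopic.comp (Homotopic.refl (I := I) u) (Homotopic.comp_reverse I w)
  exact (key u).symm.trans ((Homotopic.comp h (.refl _)).trans (key v))

end Homotopic

/-! ### Ideals graded by the homotopy classes of another ideal. -/

section Homogeneous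

variable {k V : Type*} [Field k] [Quiver V] [Fintype V] [DecidableEq V]

/-- The homotopy relation on the paths from `x` to `y`. -/
def pathClass (L : Ideal (PathAlgebra k V)) (x y : V) : Setoid (Quiver.Path x y) where
  r p q := Homotopic L (pathToWalk p) (pathToWalk q)
  iseqv := ⟨fun _ => .refl _, .symm, .trans⟩

theorem pathClass_comp_left_iff {L : Ideal (PathAlgebra k V)} {x y z : V} (p : Quiver.Path x y)
    {q q' : Quiver.Path y z} :
    pathClass L x z (p.comp q) (p.comp q') ↔ pathClass L y z q q' := by
  change Homotopic L _ _ ↔ Homotopic L _ _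
  rw [pathToWalk, pathToWalk, Prefunctor.mapPath_comp, Prefunctor.mapPath_comp]
  exact Homotopic.comp_left_iff _

theorem pathClass_comp_right_iff {L : Ideal (PathAlgebra k V)} {x y z : V}
    {p p' : Quiver.Path x y} (q : Quiver.Path y z) :
    pathClass L x z (p.comp q) (p'.comp q) ↔ pathClass L x y p p' := by
  change Homotopic L _ _ ↔ Homotopic L _ _
  rw [pathToWalk, pathToWalk, Prefunctor.mapPath_comp, Prefunctor.mapPath_comp]
  exact Homotopic.comp_right_iff _

open scoped Classical in
/-- The ideal `I` is graded by the homotopy classes of `L`. -/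
def IsHomogeneous (L I : Ideal (PathAlgebra k V)) : Prop :=
  ∀ (x y : V) (r : Quiver.Path x y →₀ k), PathAlgebra.incl r ∈ I → ∀ p : Quiver.Path x y,
    PathAlgebra.incl (r.filter fun q => pathClass L x y p q) ∈ I

theorem sum_single_eq_filter {X k : Type*} [AddCommMonoid k] (r : X →₀ k) {E : Finset X}
    [DecidablePred fun q => q ∈ E] :
    ∑ p ∈ E, Finsupp.single p (r p) = r.filter fun q => q ∈ E := by
  classical
  ext q
  rw [Finsupp.finsetSum_apply, Finsupp.filter_apply]
  simp [Finsupp.single_apply]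

/-- Any relation is a sum of minimal relations, by induction on the size of the support, and each
minimal relation is supported in a single homotopy class. -/
theorem isHomogeneous_self (I : Ideal (PathAlgebra k V)) : IsHomogeneous I I := by
  classical
  intro x y
  suffices h : ∀ (n : ℕ) (r : Quiver.Path x y →₀ k), r.support.card = n →
      PathAlgebra.incl r ∈ I → ∀ p : Quiver.Path x y,
        PathAlgebra.incl (r.filter fun q => pathClass I x y p q) ∈ I from
    fun r hr p => h _ r rfl hr p
  intro n
  induction n using Nat.strong_induction_on with
  | _ n ih =>
    intro r hn hr p
    by_cases hr0 : r = 0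
    · have h0 : r.filter (fun q => pathClass I x y p q) = 0 := by
        ext q; simp [Finsupp.filter_apply, hr0]
      rw [h0, PathAlgebra.incl_zero]
      exact I.zero_mem
    by_cases hmin : IsMinimalRelation I r
    · by_cases hp : ∃ q ∈ r.support, pathClass I x y p q
      · obtain ⟨q, hq, hpq⟩ := hp
        rw [Finsupp.filter_eq_self_iff _ _ |>.2]
        · exact hr
        · intro q' hq'
          exact hpq.trans
            (Homotopic.relation r hmin hq (Finsupp.mem_support_iff.2 hq'))
      · push Not at hp
        rw [Finsupp.filter_eq_zero_iff _ _ |>.2]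
        · rw [PathAlgebra.incl_zero]; exact I.zero_mem
        · intro q hq
          by_contra hne
          exact hp q (Finsupp.mem_support_iff.2 hne) hq
    · have : ∃ E : Finset (Quiver.Path x y), E.Nonempty ∧ E ⊂ r.support ∧
          PathAlgebra.incl (∑ p ∈ E, Finsupp.single p (r p)) ∈ I := by
        by_contra! hE
        exact hmin ⟨hr0, hr, hE⟩
      obtain ⟨E, hE, hEr, hEI⟩ := this
      rw [sum_single_eq_filter] at hEI
      set r₁ := r.filter fun q => q ∈ E with hr₁
      set r₂ := r.filter fun q => q ∉ E with hr₂
      have hsum : r₁ + r₂ = r := Finsupp.filter_add_filter_not r _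
      have hr₂I : PathAlgebra.incl r₂ ∈ I := by
        rw [← hsum, PathAlgebra.incl_add] at hr
        exact (I.add_mem_iff_right hEI).1 hr
      have hc₁ : r₁.support.card < n := by
        rw [← hn]
        refine Finset.card_lt_card (lt_of_le_of_lt ?_ hEr)
        intro q hq
        rw [hr₁, Finsupp.support_filter] at hq
        exact (Finset.mem_filter.1 hq).2
      have hc₂ : r₂.support.card < n := by
        rw [← hn, hr₂, Finsupp.support_filter]
        refine Finset.card_lt_card (Finset.filter_ssubset.2 ?_)
        obtain ⟨q, hq⟩ := hE
        exact ⟨q, hEr.1 hq, not_not.2 hq⟩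
      have h₁ := ih _ hc₁ r₁ rfl hEI p
      have h₂ := ih _ hc₂ r₂ rfl hr₂I p
      rw [← hsum, Finsupp.filter_add, PathAlgebra.incl_add]
      exact I.add_mem h₁ h₂

/-- A minimal relation of `K` meeting two classes of `L` would have its component in one class as a
proper subsum in `K`. So it stays in one class, and homotopy for `K` refines homotopy for `L`. -/
theorem Homotopic.of_isHomogeneous {L K : Ideal (PathAlgebra k V)} (h : IsHomogeneous L K)
    {x y : Symmetrify V} {u v : Walk x y} (huv : Homotopic K u v) : Homotopic L u v := by
  classical
  induction huv with
  | refl u => exact .refl u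
  | symm _ ih => exact ih.symm
  | trans _ _ ih ih' => exact ih.trans ih'
  | comp _ _ ih ih' => exact .comp ih ih'
  | arrow_inv α => exact .arrow_inv α
  | inv_arrow α => exact .inv_arrow α
  | @relation x y r hr p q hp hq =>
    have hE := hr.2.2 (r.support.filter fun q => pathClass L x y p q)
      ⟨p, Finset.mem_filter.2 ⟨hp, Setoid.refl' _ p⟩⟩
    by_contra hne
    refine hE (Finset.filter_ssubset.2 ⟨q, hq, hne⟩) ?_
    rw [sum_single_eq_filter]
    convert h x y r hr.2.1 p using 2
    ext q'
    simp only [Finsupp.filter_apply, Finset.mem_filter, Finsupp.mem_support_iff]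
    by_cases h0 : r q' = 0 <;> simp [h0]

end Homogeneous

/-! ### The components of a derivation with respect to homotopy classes -/

namespace PathAlgebra

variable {k V : Type*} [Field k] [Quiver V]

open scoped Classical in
/-- The projection of `X →₀ k` on the span of a class of an equivalence relation. -/
noncomputable def classProj (k : Type*) [Field k] {X : Type*} (S : Setoid X) (i : Quotient S) :
    Module.End k (X →₀ k) where
  toFun r := r.filter fun q => Quotient.mk S q = i
  map_add' _ _ := Finsupp.filter_add
  map_smul' _ _ := Finsupp.filter_smul

section ClassProj

variable {X : Type*} {S S' : Setoid X}

open scoped Classical in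
theorem classProj_apply (i : Quotient S) (r : X →₀ k) (q : X) :
    classProj k S i r q = if Quotient.mk S q = i then r q else 0 := by
  rw [← Finsupp.filter_apply (fun q => Quotient.mk S q = i)]; rfl

theorem sum_classProj [Fintype (Quotient S)] : ∑ i, classProj k S i = 1 := by
  classical
  refine LinearMap.ext fun r => Finsupp.ext fun q => ?_
  rw [LinearMap.sum_apply, Finsupp.finsetSum_apply]
  simp [classProj_apply]

theorem classProj_mul_self (i : Quotient S) : classProj k S i * classProj k S i = classProj k S i := by
  classical
  refine LinearMap.ext fun r => Finsupp.ext fun q => ?_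
  simp only [Module.End.mul_apply, classProj_apply]
  split_ifs <;> rfl

theorem classProj_commute (i : Quotient S) (j : Quotient S') :
    Commute (classProj k S i) (classProj k S' j) := by
  classical
  refine LinearMap.ext fun r => Finsupp.ext fun q => ?_
  simp only [Module.End.mul_apply, classProj_apply]
  split_ifs <;> rfl

theorem support_classProj_subset (i : Quotient S) (r : X →₀ k) :
    (classProj k S i r).support ⊆ r.support := by
  classical
  intro q hq
  rw [Finsupp.mem_support_iff, classProj_apply] at hq
  rw [Finsupp.mem_support_iff]
  intro h0
  simp [h0] at hq

theorem classProj_single (p : X) (t : k) (i : Quotient S) [Decidable (Quotient.mk S p = i)] :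
    classProj k S i (Finsupp.single p t) =
      if Quotient.mk S p = i then Finsupp.single p t else 0 := by
  classical
  ext q
  rw [classProj_apply]
  by_cases hq : q = p
  · subst hq; split_ifs <;> rfl
  · split_ifs <;> simp [Finsupp.single_eq_of_ne hq]

end ClassProj

/-- The elements of `kQ(x, y)` that belong to the ideal `I`. -/
noncomputable def blockOf [DecidableEq V] [Fintype V] (I : Ideal (PathAlgebra k V)) (x y : V) :
    Submodule k (Quiver.Path x y →₀ k) :=
  (I.restrictScalars k).comap (inclₗ k x y)

theorem mem_blockOf [DecidableEq V] [Fintype V] {I : Ideal (PathAlgebra k V)} {x y : V}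
    {r : Quiver.Path x y →₀ k} : r ∈ blockOf I x y ↔ incl r ∈ I := Iff.rfl

open scoped Classical in
/-- The component of `c` given by the paths `u` with `ρ α u`. -/
noncomputable def ArrowMap.restrict (c : ArrowMap k V)
    (ρ : ∀ {x y : V}, (x ⟶ y) → Quiver.Path x y → Prop) : ArrowMap k V :=
  fun x y α => (c x y α).filter fun u => ρ α u

theorem IsBypassMap.restrict {c : ArrowMap k V} (hc : IsBypassMap c)
    (ρ : ∀ {x y : V}, (x ⟶ y) → Quiver.Path x y → Prop) : IsBypassMap (c.restrict ρ) := by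
  classical
  intro x y α
  simp only [ArrowMap.restrict]
  rw [Finsupp.filter_apply, hc, ite_self]

theorem ArrowMap.restrict_add_restrict_not (c : ArrowMap k V)
    (ρ : ∀ {x y : V}, (x ⟶ y) → Quiver.Path x y → Prop) :
    c.restrict ρ + c.restrict (fun α u => ¬ ρ α u) = c := by
  classical
  funext x y α
  ext u
  simp only [ArrowMap.restrict, Pi.add_apply, Finsupp.add_apply, Finsupp.filter_apply]
  by_cases h : ρ α u <;> simp [h]

theorem ArrowMap.mem_support_restrict {c : ArrowMap k V}
    {ρ : ∀ {x y : V}, (x ⟶ y) → Quiver.Path x y → Prop} {x y : V} {α : x ⟶ y}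
    {u : Quiver.Path x y} (hu : u ∈ (c.restrict ρ x y α).support) :
    ρ α u ∧ u ∈ (c x y α).support := by
  classical
  rw [ArrowMap.restrict, Finsupp.support_filter] at hu
  exact (Finset.mem_filter.1 hu).symm

theorem IsBypassMap.neg {c : ArrowMap k V} (hc : IsBypassMap c) : IsBypassMap (-c) := by
  intro x y α
  simp [hc x y α]

variable [Fintype V] [DecidableEq V]

/-- The derivation `deriv c` preserves the classes of `L`. -/
def PreservesClasses (L : Ideal (PathAlgebra k V)) (c : ArrowMap k V) : Prop :=
  ∀ {x y : V} (α : x ⟶ y), ∀ u ∈ (c x y α).support, pathClass L x y α.toPath u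

/-- The derivation `deriv c` has no component that preserves the classes of `L`. -/
def MovesClasses (L : Ideal (PathAlgebra k V)) (c : ArrowMap k V) : Prop :=
  ∀ {x y : V} (α : x ⟶ y), ∀ u ∈ (c x y α).support, ¬ pathClass L x y α.toPath u

theorem PreservesClasses.mem_support {L : Ideal (PathAlgebra k V)} {c : ArrowMap k V}
    (h : PreservesClasses L c) {x y : V} {p q : Quiver.Path x y}
    (hq : q ∈ (derivPath c p).support) : pathClass L x y p q := by
  refine mem_support_derivPath (ρ := fun {x y} p q => pathClass L x y p q) ?_ ?_ hq
  · intro x y z p α u hu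
    exact (pathClass_comp_left_iff p).2 (h α u hu)
  · intro x y z p q α hpq
    exact (pathClass_comp_right_iff α.toPath).2 hpq

/-- If replacing one arrow of a path did not change the class of the path, cancelling the unchanged
factors would show that the class of the arrow was not changed either. -/
theorem MovesClasses.mem_support {L : Ideal (PathAlgebra k V)} {c : ArrowMap k V}
    (h : MovesClasses L c) {x y : V} {p q : Quiver.Path x y}
    (hq : q ∈ (derivPath c p).support) : ¬ pathClass L x y p q := by
  refine mem_support_derivPath (ρ := fun {x y} p q => ¬ pathClass L x y p q) ?_ ?_ hq
  · intro x y z p α u hu hpu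
    exact h α u hu ((pathClass_comp_left_iff p).1 hpu)
  · intro x y z p q α hpq hpq'
    exact hpq ((pathClass_comp_right_iff α.toPath).1 hpq')

theorem PreservesClasses.commute {L : Ideal (PathAlgebra k V)} {c : ArrowMap k V}
    (h : PreservesClasses L c) (x y : V) (i : Quotient (pathClass L x y)) :
    Commute (derivBlock c x y) (classProj k (pathClass L x y) i) := by
  classical
  refine LinearMap.ext fun r => ?_
  induction r using Finsupp.induction_linear with
  | zero => simp
  | add r s hr hs => simp only [map_add, hr, hs]
  | single p t =>
    have hcl : ∀ q ∈ (derivPath c p).support,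
        Quotient.mk (pathClass L x y) q = Quotient.mk (pathClass L x y) p := fun q hq =>
      Quotient.sound (h.mem_support hq).symm
    rw [Module.End.mul_apply, Module.End.mul_apply, classProj_single, derivBlock_single, map_smul]
    split_ifs with hp
    · rw [derivBlock_single]
      congr 1
      ext q
      rw [classProj_apply]
      split_ifs with hq
      · rfl
      · by_contra hne
        exact hq ((hcl q (Finsupp.mem_support_iff.2 fun h0 => hne h0)).trans hp)
    · rw [map_zero]
      symm
      convert smul_zero t
      ext q
      rw [classProj_apply]
      split_ifs with hq
      · by_contra hne
        exact hp ((hcl q (Finsupp.mem_support_iff.2 hne)).symm.trans hq)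
      · rfl

theorem MovesClasses.proj_mul_mul_proj {L : Ideal (PathAlgebra k V)} {c : ArrowMap k V}
    (h : MovesClasses L c) (x y : V) (i : Quotient (pathClass L x y)) :
    classProj k (pathClass L x y) i * derivBlock c x y * classProj k (pathClass L x y) i = 0 := by
  classical
  refine LinearMap.ext fun r => ?_
  induction r using Finsupp.induction_linear with
  | zero => simp
  | add r s hr hs => simp only [map_add, hr, hs]
  | single p t =>
    rw [Module.End.mul_apply, Module.End.mul_apply, classProj_single]
    split_ifs with hp
    · rw [derivBlock_single, map_smul, LinearMap.zero_apply]
      convert smul_zero t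
      ext q
      rw [classProj_apply]
      split_ifs with hq
      · by_contra hne
        exact h.mem_support (Finsupp.mem_support_iff.2 hne) (Quotient.exact (hp.trans hq.symm))
      · rfl
    · simp

theorem _root_.IsHomogeneous.classProj_mem {L I : Ideal (PathAlgebra k V)} (h : IsHomogeneous L I)
    {x y : V} (i : Quotient (pathClass L x y)) {r : Quiver.Path x y →₀ k}
    (hr : r ∈ blockOf I x y) : classProj k (pathClass L x y) i r ∈ blockOf I x y := by
  classical
  induction i using Quotient.inductionOn with
  | _ p =>
    rw [mem_blockOf]
    convert h x y r hr p using 2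
    ext q
    rw [classProj_apply, Finsupp.filter_apply]
    have : Quotient.mk (pathClass L x y) q = Quotient.mk _ p ↔ pathClass L x y p q :=
      ⟨fun h => (Quotient.exact h).symm, fun h => Quotient.sound h.symm⟩
    simp only [this]

theorem isHomogeneous_of_classProj_mem {L I : Ideal (PathAlgebra k V)}
    (h : ∀ (x y : V) (i : Quotient (pathClass L x y)), ∀ r ∈ blockOf I x y,
      classProj k (pathClass L x y) i r ∈ blockOf I x y) : IsHomogeneous L I := by
  classical
  intro x y r hr p
  have := h x y (Quotient.mk _ p) r hr
  rw [mem_blockOf] at this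
  convert this using 2
  ext q
  rw [classProj_apply, Finsupp.filter_apply]
  have : Quotient.mk (pathClass L x y) q = Quotient.mk _ p ↔ pathClass L x y p q :=
    ⟨fun h => (Quotient.exact h).symm, fun h => Quotient.sound h.symm⟩
  simp only [this]

/-! ### Graded ideals in an orbit under unipotent automorphisms. -/

section Orbit

open IsNilpotent

variable [CharZero k] (hdb : NoDoubleBypass V)

/-- A derivation of degree zero commutes with the projections on classes, and so does its
exponential. -/
theorem IsHomogeneous.comap_transvection {L I : Ideal (PathAlgebra k V)} (hI : IsHomogeneous L I)
    {c : ArrowMap k V} (hc : IsBypassMap c) (hcL : PreservesClasses L c) :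
    IsHomogeneous L (I.comap (transvection hdb hc)) := by
  refine isHomogeneous_of_classProj_mem fun x y i r hr => ?_
  rw [mem_blockOf, Ideal.mem_comap, transvection_apply, exp_deriv_incl hdb hc] at hr ⊢
  have h := Module.End.commute_exp_left_of_commute (isNilpotent_derivBlock hdb hc x y)
    (isNilpotent_derivBlock hdb hc x y) (hcL.commute x y i)
  have h' := LinearMap.congr_fun h r
  rw [LinearMap.comp_apply, LinearMap.comp_apply] at h'
  rw [h']
  exact hI.classProj_mem i hr

theorem blockOf_eq_map {I J : Ideal (PathAlgebra k V)} {c : ArrowMap k V} (hc : IsBypassMap c)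
    (hIJ : I = J.comap (transvection hdb hc)) (x y : V) :
    blockOf J x y = (blockOf I x y).map (exp (derivBlock c x y)) := by
  have hd := isNilpotent_derivBlock hdb hc x y
  have hmem : ∀ r, r ∈ blockOf I x y ↔ exp (derivBlock c x y) r ∈ blockOf J x y := fun r => by
    rw [mem_blockOf, hIJ, Ideal.mem_comap, transvection_apply, exp_deriv_incl hdb hc, mem_blockOf]
  ext r
  constructor
  · intro hr
    have h1 : exp (derivBlock c x y) (exp (-derivBlock c x y) r) = r := by
      rw [← Module.End.mul_apply, exp_mul_exp_neg_self hd, Module.End.one_apply]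
    exact ⟨_, (hmem _).2 (h1.symm ▸ hr), h1⟩
  · rintro ⟨s, hs, rfl⟩
    exact (hmem s).1 hs

/-- On each component `kQ(x, y)`, `stable_of_exp_homogeneous` shows that the derivation stabilizes
the block of `I`; its exponential, which maps this block onto that of `J`, then fixes it. -/
theorem eq_of_movesClasses {L L' I J : Ideal (PathAlgebra k V)} [I.IsTwoSided] [J.IsTwoSided]
    (hI : IsHomogeneous L I) (hJ : IsHomogeneous L' J) {c : ArrowMap k V} (hc : IsBypassMap c)
    (hcL : MovesClasses L c) (hcL' : MovesClasses L' c)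
    (hIJ : I = J.comap (transvection hdb hc)) : I = J := by
  have key : ∀ x y, blockOf J x y = blockOf I x y := by
    intro x y
    have := hdb.finite_path x y
    have := Fintype.ofFinite (Quotient (pathClass L x y))
    have := Fintype.ofFinite (Quotient (pathClass L' x y))
    have hd := isNilpotent_derivBlock hdb hc x y
    have hmap := blockOf_eq_map hdb hc hIJ x y
    have hfil : ∀ {S : Setoid (Quiver.Path x y)} (i : Quotient S) (n : ℕ),
        ∀ r ∈ lengthFiltration k x y n, classProj k S i r ∈ lengthFiltration k x y n :=
      fun i n r hr p hp => hr (support_classProj_subset i r hp)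
    rw [hmap]
    refine map_exp_eq_of_stable hd ?_
    -- The filtration by length is decreasing, so it is indexed backwards; it starts at zero because
    -- no path has length `Fintype.card V` or more.
    refine stable_of_exp_homogeneous (N := Fintype.card V)
      (F := fun n => lengthFiltration k x y (Fintype.card V - n))
      sum_classProj sum_classProj classProj_mul_self classProj_mul_self classProj_commute
      ?_ ?_ ?_ (fun i n => hfil i _) (fun i n => hfil i _) hd ?_ (hcL.proj_mul_mul_proj x y)
      (hcL'.proj_mul_mul_proj x y) (fun i r hr => hI.classProj_mem i hr) ?_
    · rw [Nat.sub_zero, eq_bot_iff]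
      intro r hr
      rw [Submodule.mem_bot, ← Finsupp.support_eq_empty, Finset.eq_empty_iff_forall_notMem]
      intro p hp
      exact absurd (hr hp) (not_le.2 (hdb.length_lt_card p))
    · intro m n hmn r hr p hp
      exact (Nat.sub_le_sub_left hmn _).trans (hr hp)
    · rw [Nat.sub_self, eq_top_iff]
      exact fun r _ p _ => Nat.zero_le _
    · intro n r hr p hp
      have : Fintype.card V - (n + 1) + 1 ≤ p.length :=
        derivBlock_mem_lengthFiltration hdb hc hr hp
      change Fintype.card V - n ≤ p.length
      omega
    · intro j r hr
      rw [← hmap] at hr ⊢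
      exact hJ.classProj_mem j hr
  ext f
  exact ⟨fun hf => mem_of_incl_apply_mem fun x y => mem_blockOf.1 (by
      rw [key]; exact incl_apply_mem hf x y),
    fun hf => mem_of_incl_apply_mem fun x y => mem_blockOf.1 (by
      rw [← key]; exact incl_apply_mem hf x y)⟩

/-- Two ideals in the same orbit under unipotent automorphisms have a common refinement in that
orbit. -/
theorem exists_common_homogeneous {L L' I J : Ideal (PathAlgebra k V)} [I.IsTwoSided]
    [J.IsTwoSided] (hI : IsHomogeneous L I) (hJ : IsHomogeneous L' J) {c : ArrowMap k V}
    (hc : IsBypassMap c) (hIJ : I = J.comap (transvection hdb hc)) :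
    ∃ (c' : ArrowMap k V) (hc' : IsBypassMap c'),
      IsHomogeneous L (J.comap (transvection hdb hc')) ∧
      IsHomogeneous L' (J.comap (transvection hdb hc')) := by
  -- Here `c = c₀ + c₂ + c₃`, where `c₀` preserves the classes of `L`, `c₂` preserves those of `L'`,
  -- and `c₃` moves both. Undoing `c₀` on `I` and applying `c₂` to `J` keeps the gradings.
  set c₀ := c.restrict fun {x y} α u => pathClass L x y α.toPath u with hc₀
  set c₁ := c.restrict fun {x y} α u => ¬ pathClass L x y α.toPath u with hc₁
  set c₂ := c₁.restrict fun {x y} α u => pathClass L' x y α.toPath u with hc₂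
  set c₃ := c₁.restrict fun {x y} α u => ¬ pathClass L' x y α.toPath u with hc₃
  have h₀ : IsBypassMap c₀ := hc.restrict _
  have h₁ : IsBypassMap c₁ := hc.restrict _
  have h₂ : IsBypassMap c₂ := h₁.restrict _
  have h₃ : IsBypassMap c₃ := h₁.restrict _
  have e₀ : c₀ + c₁ = c := ArrowMap.restrict_add_restrict_not c _
  have e₁ : c₂ + c₃ = c₁ := ArrowMap.restrict_add_restrict_not c₁ _
  have hI₁ : IsHomogeneous L (I.comap (transvection hdb h₀.neg)) := by
    refine IsHomogeneous.comap_transvection hdb hI _ fun α u hu => ?_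
    rw [Pi.neg_apply, Pi.neg_apply, Pi.neg_apply, Finsupp.support_neg] at hu
    exact (ArrowMap.mem_support_restrict hu).1
  have hJ₁ : IsHomogeneous L' (J.comap (transvection hdb h₂)) :=
    IsHomogeneous.comap_transvection hdb hJ _ fun α u hu => (ArrowMap.mem_support_restrict hu).1
  have hmul : ∀ {a b d : ArrowMap k V} (ha : IsBypassMap a) (hb : IsBypassMap b)
      (hd : IsBypassMap d) (_ : a + b = d) (f : PathAlgebra k V),
      transvection hdb ha (transvection hdb hb f) = transvection hdb hd f := by
    rintro a b d ha hb hd rfl f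
    rw [transvection_apply, transvection_apply, transvection_apply, exp_deriv_add hdb ha hb]
    rfl
  -- The two modified ideals now differ only by the transvection of `c₃`, hence coincide.
  have heq : I.comap (transvection hdb h₀.neg) = J.comap (transvection hdb h₂) := by
    refine eq_of_movesClasses hdb hI₁ hJ₁ h₃ (fun α u hu => ?_) (fun α u hu => ?_) ?_
    · exact (ArrowMap.mem_support_restrict (ArrowMap.mem_support_restrict hu).2).1
    · exact (ArrowMap.mem_support_restrict hu).1
    · ext f
      rw [Ideal.mem_comap, Ideal.mem_comap, Ideal.mem_comap, hIJ, Ideal.mem_comap,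
        hmul h₂ h₃ h₁ e₁, hmul hc h₀.neg h₁ (by rw [← e₀]; abel)]
  exact ⟨c₂, h₂, heq ▸ hI₁, hJ₁⟩

end Orbit

end PathAlgebra

/-! ### Corners of finite-dimensional algebras at primitive idempotents -/

/-- The idempotents `e` and `f` are equivalent: there are mutually inverse elements of `e A f` and
`f A e`. -/
def CornerIso {A : Type*} [Ring A] (e f : A) : Prop :=
  ∃ a b : A, e * a * f = a ∧ f * b * e = b ∧ a * b = e ∧ b * a = f

section RingCorners

variable {A : Type*} [Ring A]

theorem mul_eq_self_of_sandwich {e f a : A} (he : IsIdempotentElem e) (h : e * a * f = a) :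
    e * a = a := by
  rw [← h, ← mul_assoc, ← mul_assoc, he.eq]

theorem self_mul_of_sandwich {e f a : A} (hf : IsIdempotentElem f) (h : e * a * f = a) :
    a * f = a := by
  rw [← h, mul_assoc, hf.eq]

theorem CornerIso.symm {e f : A} (h : CornerIso e f) : CornerIso f e := by
  obtain ⟨a, b, ha, hb, hab, hba⟩ := h
  exact ⟨b, a, hb, ha, hba, hab⟩

theorem CornerIso.trans {e f g : A} (he : IsIdempotentElem e) (hf : IsIdempotentElem f)
    (hg : IsIdempotentElem g) (h : CornerIso e f) (h' : CornerIso f g) : CornerIso e g := by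
  obtain ⟨a, b, ha, hb, hab, hba⟩ := h
  obtain ⟨c, d, hc, hd, hcd, hdc⟩ := h'
  refine ⟨a * c, d * b, ?_, ?_, ?_, ?_⟩
  · rw [← mul_assoc, mul_eq_self_of_sandwich he ha, mul_assoc, self_mul_of_sandwich hg hc]
  · rw [← mul_assoc, mul_eq_self_of_sandwich hg hd, mul_assoc, self_mul_of_sandwich he hb]
  · rw [mul_assoc, ← mul_assoc c, hcd, mul_eq_self_of_sandwich hf hb, hab]
  · rw [mul_assoc, ← mul_assoc b, hba, mul_eq_self_of_sandwich hf hc, hdc]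

/-- A module morphism `A e → A f` is right multiplication by the image of `e`, an element of `e A
f`. -/
theorem projIso_iff_cornerIso {e f : A} (he : IsIdempotentElem e) (hf : IsIdempotentElem f) :
    ProjIso e f ↔ CornerIso e f := by
  constructor
  · rintro ⟨φ⟩
    let e' : (Ideal.span {e} : Ideal A) := ⟨e, Ideal.mem_span_singleton_self e⟩
    let f' : (Ideal.span {f} : Ideal A) := ⟨f, Ideal.mem_span_singleton_self f⟩
    have hmem : ∀ {g : A} (_ : IsIdempotentElem g) (x : (Ideal.span {g} : Ideal A)),
        (x : A) * g = x := by
      intro g hg x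
      obtain ⟨c, hc⟩ := Ideal.mem_span_singleton'.1 x.2
      rw [← hc, mul_assoc, hg.eq]
    have hsmul : ∀ {g : A} (hg : IsIdempotentElem g) (x : (Ideal.span {g} : Ideal A)),
        x = (x : A) • (⟨g, Ideal.mem_span_singleton_self g⟩ : (Ideal.span {g} : Ideal A)) :=
      fun hg x => Subtype.ext (hmem hg x).symm
    set a : A := ((φ e' : (Ideal.span {f} : Ideal A)) : A) with ha
    set b : A := ((φ.symm f' : (Ideal.span {e} : Ideal A)) : A) with hb
    have hea : e * a = a := by
      have : e • e' = e' := Subtype.ext he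
      have h2 := congrArg (fun x => (φ x : A)) this
      simpa using h2
    have hfb : f * b = b := by
      have : f • f' = f' := Subtype.ext hf
      have h2 := congrArg (fun x => (φ.symm x : A)) this
      simpa using h2
    have haf : a * f = a := hmem hf _
    have hbe : b * e = b := hmem he _
    refine ⟨a, b, by rw [hea, haf], by rw [hfb, hbe], ?_, ?_⟩
    · have h1 : φ e' = a • f' := hsmul hf (φ e')
      have h2 := congrArg (fun x => (φ.symm x : A)) h1
      simp only [LinearEquiv.symm_apply_apply, map_smul] at h2
      exact h2.symm
    · have h1 : φ.symm f' = b • e' := hsmul he (φ.symm f')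
      have h2 := congrArg (fun x => (φ x : A)) h1
      simp only [LinearEquiv.apply_symm_apply, map_smul] at h2
      exact h2.symm
  · rintro ⟨a, b, ha, hb, hab, hba⟩
    have haf := self_mul_of_sandwich hf ha
    have hbe := self_mul_of_sandwich he hb
    let F : (Ideal.span {e} : Ideal A) →ₗ[A] (Ideal.span {f} : Ideal A) :=
      ((LinearMap.toSpanSingleton A A a).comp (Submodule.subtype _)).codRestrict _
        (fun x => Ideal.mem_span_singleton'.2 ⟨x * a, by
          simp [mul_assoc, haf]⟩)
    let G : (Ideal.span {f} : Ideal A) →ₗ[A] (Ideal.span {e} : Ideal A) :=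
      ((LinearMap.toSpanSingleton A A b).comp (Submodule.subtype _)).codRestrict _
        (fun x => Ideal.mem_span_singleton'.2 ⟨x * b, by
          simp [mul_assoc, hbe]⟩)
    refine ⟨LinearEquiv.ofLinearMap F G ?_ ?_⟩
    · refine LinearMap.ext fun x => Subtype.ext ?_
      obtain ⟨c, hc⟩ := Ideal.mem_span_singleton'.1 x.2
      change (x : A) * b * a = x
      rw [mul_assoc, hba, ← hc, mul_assoc, hf.eq]
    · refine LinearMap.ext fun x => Subtype.ext ?_
      obtain ⟨c, hc⟩ := Ideal.mem_span_singleton'.1 x.2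
      change (x : A) * a * b = x
      rw [mul_assoc, hab, ← hc, mul_assoc, he.eq]

/-- Nilpotency of `e * y * b` passes to `y * b`, so the left ideal generated by `b` is nil. -/
theorem mem_jacobson_of_isNilpotent_corner {e b : A} (hb : b * e = b)
    (h : ∀ c, IsNilpotent (e * c * b)) : b ∈ Ring.jacobson A := by
  rw [← Ideal.jacobson_bot, Ideal.mem_jacobson_iff]
  intro y
  have hpow : ∀ m : ℕ, (y * b) ^ (m + 1) = y * b * (e * y * b) ^ m := by
    intro m
    induction m with
    | zero => simp
    | succ m ih =>
      have hbyb : b * (y * b) = b * (e * y * b) := by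
        rw [mul_assoc e, ← mul_assoc b e, hb]
      rw [pow_succ', ih, pow_succ' (e * y * b), ← mul_assoc, mul_assoc y b (y * b), hbyb]
      simp only [mul_assoc]
  have hnil : IsNilpotent (y * b) := by
    obtain ⟨m, hm⟩ := h y
    exact ⟨m + 1, by rw [hpow, hm, mul_zero]⟩
  obtain ⟨u, hu⟩ := hnil.isUnit_one_add
  refine ⟨↑u⁻¹, ?_⟩
  have h1 : (↑u⁻¹ : A) * (1 + y * b) = 1 := by rw [← hu]; exact u.inv_mul
  rw [Submodule.mem_bot, mul_assoc, sub_eq_zero, add_comm]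
  rw [mul_add, mul_one] at h1
  exact h1

theorem IsIdempotentElem.eq_zero_of_mem_jacobson {e : A} (he : IsIdempotentElem e)
    (h : e ∈ Ring.jacobson A) : e = 0 := by
  rw [← Ideal.jacobson_bot, Ideal.mem_jacobson_iff] at h
  -- This gives `z (1 - e) = 1`; multiplying on the right by `e` yields `e = 0`.
  obtain ⟨z, hz⟩ := h (-1)
  rw [Submodule.mem_bot, sub_eq_zero] at hz
  have : (z * -1 * e + z) * e = e := by rw [hz, one_mul]
  rw [← this, add_mul, mul_assoc, he.eq]
  simp

theorem CornerIso.sub_mem_jacobson {e f : A} (hcomm : ∀ a b : A, a * b - b * a ∈ Ring.jacobson A)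
    (h : CornerIso e f) : e - f ∈ Ring.jacobson A := by
  obtain ⟨a, b, -, -, hab, hba⟩ := h
  rw [← hab, ← hba]
  exact hcomm a b

theorem not_cornerIso_of_orthogonal {e f : A}
    (hcomm : ∀ a b : A, a * b - b * a ∈ Ring.jacobson A) (he : IsIdempotentElem e) (he0 : e ≠ 0)
    (hef : e * f = 0) : ¬ CornerIso e f := fun h => by
  have h1 := (Ring.jacobson A).mul_mem_left e (h.sub_mem_jacobson hcomm)
  rw [mul_sub, he.eq, hef, sub_zero] at h1
  exact he0 (he.eq_zero_of_mem_jacobson h1)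

/-- The elements realizing the equivalences add up to mutually inverse units, since all cross
products vanish by orthogonality. -/
theorem exists_conj_of_cornerIso {ι : Type*} [Fintype ι] {f f' : ι → A}
    (hf : CompleteOrthogonalIdempotents f) (hf' : CompleteOrthogonalIdempotents f')
    (h : ∀ i, CornerIso (f i) (f' i)) :
    ∃ u : Aˣ, ∀ i, (u : A) * f i * (↑u⁻¹ : A) = f' i := by
  classical
  choose a b ha hb hab hba using h
  have hfa : ∀ i, f i * a i = a i := fun i => mul_eq_self_of_sandwich (hf.idem i) (ha i)
  have haf : ∀ i, a i * f' i = a i := fun i => self_mul_of_sandwich (hf'.idem i) (ha i)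
  have hfb : ∀ i, f' i * b i = b i := fun i => mul_eq_self_of_sandwich (hf'.idem i) (hb i)
  have hbf : ∀ i, b i * f i = b i := fun i => self_mul_of_sandwich (hf.idem i) (hb i)
  have hab0 : ∀ i j, i ≠ j → a i * b j = 0 := fun i j hij => by
    rw [← haf i, ← hfb j, mul_assoc, ← mul_assoc (f' i), hf'.ortho hij, zero_mul, mul_zero]
  have hba0 : ∀ i j, i ≠ j → b i * a j = 0 := fun i j hij => by
    rw [← hbf i, ← hfa j, mul_assoc, ← mul_assoc (f i), hf.ortho hij, zero_mul, mul_zero]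
  have h1 : (∑ i, b i) * (∑ i, a i) = 1 := by
    rw [Finset.sum_mul_sum, ← hf'.complete]
    refine Finset.sum_congr rfl fun i _ => ?_
    rw [Finset.sum_eq_single i (fun j _ hj => hba0 i j hj.symm) (by simp), hba]
  have h2 : (∑ i, a i) * (∑ i, b i) = 1 := by
    rw [Finset.sum_mul_sum, ← hf.complete]
    refine Finset.sum_congr rfl fun i _ => ?_
    rw [Finset.sum_eq_single i (fun j _ hj => hab0 i j hj.symm) (by simp), hab]
  refine ⟨⟨∑ i, b i, ∑ i, a i, h1, h2⟩, fun i => ?_⟩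
  change (∑ j, b j) * f i * (∑ j, a j) = f' i
  have h3 : (∑ j, b j) * f i = b i := by
    rw [Finset.sum_mul, Finset.sum_eq_single i _ (by simp), hbf]
    intro j _ hj
    rw [← hbf j, mul_assoc, hf.ortho hj, mul_zero]
  rw [h3, Finset.mul_sum, Finset.sum_eq_single i (fun j _ hj => hba0 i j hj.symm) (by simp), hba]

end RingCorners

/-! ### Primitive idempotents and the radical of a finite-dimensional algebra. -/

section FiniteDimensional

variable {k A : Type*} [Field k] [Ring A] [Algebra k A] [Module.Finite k A]

/-- In a corner at a primitive idempotent, every element is nilpotent or invertible. -/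
theorem IsPrimitiveIdempotent.isNilpotent_or_invertible (k : Type*) [Field k] [Algebra k A]
    [Module.Finite k A] {e : A} (he : IsPrimitiveIdempotent e) {a : A} (ha : e * a * e = a) :
    IsNilpotent a ∨ ∃ b, e * b * e = b ∧ b * a = e ∧ a * b = e := by
  open Polynomial in
  obtain ⟨hid, he0, hprim⟩ := he
  have hea := mul_eq_self_of_sandwich hid ha
  have hae := self_mul_of_sandwich hid ha
  have hp0 : minpoly k a ≠ 0 := minpoly.ne_zero (Algebra.IsIntegral.isIntegral a)
  obtain ⟨q, hq, hXq⟩ := Polynomial.exists_eq_pow_rootMultiplicity_mul_and_not_dvd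
    (minpoly k a) hp0 0
  set n := (minpoly k a).rootMultiplicity 0
  rw [Polynomial.C_0, sub_zero] at hq hXq
  -- Fitting decomposition of `a`. The exponent `n + 1` instead of `n` makes the idempotent `f`
  -- below a multiple of `a` even when `n = 0`. By primitivity `e * f` is `0` or `e`: in the first
  -- case `a` is nilpotent, in the second it is invertible in the corner.
  have hcop : IsCoprime ((X : k[X]) ^ (n + 1)) q :=
    IsCoprime.pow_left ((Polynomial.irreducible_X.coprime_iff_not_dvd).2 hXq)
  obtain ⟨u, v, huv⟩ := hcop
  have hcomm : ∀ r : k[X], e * aeval a r = aeval a r * e := by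
    intro r
    induction r using Polynomial.induction_on' with
    | add r s hr hs => rw [map_add, mul_add, add_mul, hr, hs]
    | monomial m t =>
      have : Commute e (a ^ m) := Commute.pow_right (show e * a = a * e by rw [hea, hae]) m
      rw [aeval_monomial]
      exact ((Algebra.commute_algebraMap_right t e).mul_right this).eq
  have hzero : aeval a (X ^ (n + 1) * q) = 0 := by
    rw [pow_succ', mul_assoc, ← hq, map_mul, minpoly.aeval, mul_zero]
  set f := aeval a (u * X ^ (n + 1)) with hf
  have hff : f * f = f := by
    rw [hf, ← map_mul, ← sub_eq_zero, ← map_sub]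
    have : u * X ^ (n + 1) * (u * X ^ (n + 1)) - u * X ^ (n + 1) =
        -(u * v) * (X ^ (n + 1) * q) := by
      have h1 : u * X ^ (n + 1) = 1 - v * q := eq_sub_of_add_eq huv
      calc u * X ^ (n + 1) * (u * X ^ (n + 1)) - u * X ^ (n + 1)
          = u * X ^ (n + 1) * (u * X ^ (n + 1) - 1) := by ring
        _ = u * X ^ (n + 1) * (-(v * q)) := by rw [h1]; ring
        _ = _ := by ring
    rw [this, map_mul, hzero, mul_zero]
  have hef : e * f = f * e := hcomm _
  have hid' : IsIdempotentElem (e * f) := by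
    change e * f * (e * f) = e * f
    rw [mul_assoc, ← mul_assoc f e f, ← hef, mul_assoc e f f, hff, ← mul_assoc, hid.eq]
  have hee : e * (e * f) = e * f := by rw [← mul_assoc, hid.eq]
  have hee' : e * f * e = e * f := by rw [mul_assoc, ← hef, hee]
  rcases hprim (e * f) (e - e * f) hid' (by
      change (e - e * f) * (e - e * f) = e - e * f
      rw [mul_sub, sub_mul, sub_mul, hid.eq, hee, hee', hid'.eq]; abel)
      (by rw [mul_sub, hee', hid'.eq, sub_self]) (by rw [sub_mul, hee, hid'.eq, sub_self])
      (by abel) with h | h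
  · left
    refine ⟨n + 2, ?_⟩
    have h1 : e * a ^ (n + 1) = 0 := by
      have h2 : aeval a (X ^ (n + 1) : k[X]) = aeval a (X ^ (n + 1) : k[X]) * f := by
        rw [hf, ← map_mul, ← sub_eq_zero, ← map_sub]
        have : (X : k[X]) ^ (n + 1) - X ^ (n + 1) * (u * X ^ (n + 1)) =
            v * (X ^ (n + 1) * q) := by
          have h1 : u * X ^ (n + 1) = 1 - v * q := eq_sub_of_add_eq huv
          rw [h1]; ring
        rw [this, map_mul, hzero, mul_zero]
      rw [map_pow, aeval_X] at h2
      have h3 : e * a ^ (n + 1) = a ^ (n + 1) * e := by simpa using hcomm ((X : k[X]) ^ (n + 1))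
      rw [h3, h2, mul_assoc, ← hef, h, mul_zero]
    rw [pow_succ', ← hae, mul_assoc, hae, h1, mul_zero]
  · right
    have h1 : e * f = e := (sub_eq_zero.1 h).symm
    have h2 : f = aeval a (u * X ^ n) * a := by
      rw [hf, pow_succ, ← mul_assoc, map_mul, aeval_X]
    have h3 : f = a * aeval a (u * X ^ n) := by
      rw [hf, pow_succ', mul_left_comm, map_mul, aeval_X]
    refine ⟨e * aeval a (u * X ^ n), ?_, ?_, ?_⟩
    · rw [← mul_assoc, hid.eq, mul_assoc, ← hcomm, ← mul_assoc, hid.eq]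
    · rw [mul_assoc, ← h2, h1]
    · calc a * (e * aeval a (u * X ^ n)) = e * (a * aeval a (u * X ^ n)) := by
            rw [← mul_assoc, hae, ← mul_assoc, hea]
        _ = e := by rw [← h3, h1]

/-- An element of `f A e` outside the radical is an equivalence between the primitive idempotents
`e` and `f`. -/
theorem IsPrimitiveIdempotent.cornerIso_of_notMem_jacobson (k : Type*) [Field k] [Algebra k A]
    [Module.Finite k A] {e f : A} (he : IsPrimitiveIdempotent e) (hf : IsPrimitiveIdempotent f)
    {b : A} (hb : f * b * e = b) (hbR : b ∉ Ring.jacobson A) :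
    ∃ x, e * x * f = x ∧ x * b = e ∧ b * x = f := by
  have hfb := mul_eq_self_of_sandwich hf.1 hb
  have hbe := self_mul_of_sandwich he.1 hb
  -- Some `e * c * b` is then invertible in the corner at `e`, which provides a left inverse `x` of
  -- `b`.
  have : ∃ c, ¬ IsNilpotent (e * c * b) := by
    by_contra! h
    exact hbR (mem_jacobson_of_isNilpotent_corner hbe h)
  obtain ⟨c, hc⟩ := this
  rcases he.isNilpotent_or_invertible k (a := e * c * b)
    (by rw [mul_assoc, mul_assoc, mul_assoc, hbe, ← mul_assoc, he.1.eq, mul_assoc]) with h | ⟨w, hw, hwc, -⟩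
  · exact absurd h hc
  have hew := mul_eq_self_of_sandwich he.1 hw
  have hwe := self_mul_of_sandwich he.1 hw
  have hxb : w * c * f * b = e := by
    rw [mul_assoc, hfb, ← hwc, ← mul_assoc, ← mul_assoc, hwe]
  set x := w * c * f with hx
  have hex : e * x = x := by rw [hx, ← mul_assoc, ← mul_assoc, hew]
  have hxf : x * f = x := by rw [hx, mul_assoc, hf.1.eq]
  refine ⟨x, by rw [hex, hxf], hxb, ?_⟩
  -- The product `b * x` is a nonzero idempotent in the corner at `f`, so primitivity of `f` makes
  -- it equal to `f`.
  have hid : IsIdempotentElem (b * x) := by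
    change b * x * (b * x) = b * x
    rw [mul_assoc, ← mul_assoc x, hxb, hex]
  have h1 : f * (b * x) = b * x := by rw [← mul_assoc, hfb]
  have h2 : b * x * f = b * x := by rw [mul_assoc, hxf]
  rcases hf.2.2 (b * x) (f - b * x) hid (by
      change (f - b * x) * (f - b * x) = f - b * x
      rw [mul_sub, sub_mul, sub_mul, hf.1.eq, h1, h2, hid.eq]; abel)
      (by rw [mul_sub, h2, hid.eq, sub_self]) (by rw [sub_mul, h1, hid.eq, sub_self])
      (by abel) with h | h
  · exfalso
    apply he.2.1
    have : x * (b * x) * b = e := by rw [← mul_assoc, hxb, hex, hxb]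
    rw [← this, h]; simp
  · exact (sub_eq_zero.1 h).symm

variable [IsAlgClosed k]

/-- Modulo the radical, the corner at a primitive idempotent is reduced to scalars. -/
theorem IsPrimitiveIdempotent.exists_sub_smul_mem_jacobson {e : A} (he : IsPrimitiveIdempotent e)
    {a : A} (ha : e * a * e = a) : ∃ t : k, a - t • e ∈ Ring.jacobson A := by
  have hid := he.1
  have hea := mul_eq_self_of_sandwich hid ha
  have hae := self_mul_of_sandwich hid ha
  -- Left multiplication by `a` on `e A` has an eigenvalue `t`. Then `a - t • e` kills a nonzero
  -- vector on which `e` acts as the identity, so it has no left inverse in the corner and lies in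
  -- the radical.
  let W : Submodule k A := LinearMap.range (LinearMap.mulLeft k e)
  have hW : ∀ w ∈ W, e * w = w := by
    rintro _ ⟨w, rfl⟩
    simp [← mul_assoc, hid.eq]
  have hLW : ∀ w ∈ W, LinearMap.mulLeft k a w ∈ W := by
    intro w _
    exact ⟨a * w, by simp [← mul_assoc, hea]⟩
  have : Nontrivial W := by
    refine ⟨⟨⟨e, ⟨e, by simp [hid.eq]⟩⟩, 0, fun h => he.2.1 (congrArg Subtype.val h)⟩⟩
  obtain ⟨t, ht⟩ := Module.End.exists_eigenvalue ((LinearMap.mulLeft k a).restrict hLW)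
  obtain ⟨w, hw⟩ := ht.exists_hasEigenvector
  have hwt : a * (w : A) = t • (w : A) := congrArg Subtype.val hw.apply_eq_smul
  have hw0 : (w : A) ≠ 0 := fun h => hw.2 (Subtype.ext h)
  refine ⟨t, ?_⟩
  by_contra hR
  have hb : e * (a - t • e) * e = a - t • e := by
    simp only [mul_sub, sub_mul, ha, mul_smul_comm, smul_mul_assoc, hid.eq]
  obtain ⟨x, -, hx, -⟩ := he.cornerIso_of_notMem_jacobson k he hb hR
  apply hw0
  rw [← hW w w.2, ← hx, mul_assoc, sub_mul, hwt, smul_mul_assoc, hW w w.2, sub_self, mul_zero]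

theorem exists_sub_sum_smul_mem_jacobson {ι : Type*} [Fintype ι] {e : ι → A}
    (he : IsPrimitiveDecomposition e)
    (hoff : ∀ i j, i ≠ j → ∀ a, e i * a * e j ∈ Ring.jacobson A) (a : A) :
    ∃ t : ι → k, a - ∑ i, t i • e i ∈ Ring.jacobson A := by
  classical
  have h : ∀ i, ∃ t : k, e i * a * e i - t • e i ∈ Ring.jacobson A := fun i =>
    (he.2 i).exists_sub_smul_mem_jacobson (by
      rw [← mul_assoc, ← mul_assoc, (he.1.idem i).eq, mul_assoc, (he.1.idem i).eq])
  choose t ht using h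
  refine ⟨t, ?_⟩
  have ha : a = ∑ i, ∑ j, e i * a * e j := by
    simp_rw [← Finset.mul_sum, he.1.complete, mul_one, ← Finset.sum_mul, he.1.complete, one_mul]
  have h2 : a - ∑ i, t i • e i = ∑ i, (∑ j, e i * a * e j - t i • e i) := by
    rw [Finset.sum_sub_distrib, ← ha]
  rw [h2]
  refine Ideal.sum_mem _ fun i _ => ?_
  rw [← Finset.add_sum_erase _ _ (Finset.mem_univ i), add_sub_right_comm]
  refine Ideal.add_mem _ (ht i) (Ideal.sum_mem _ fun j hj => ?_)
  exact hoff i j (Finset.ne_of_mem_erase hj).symm a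

/-- A basic algebra is commutative modulo its radical. -/
theorem IsBasicAlgebra.commutator_mem_jacobson (k : Type*) [Field k] [Algebra k A]
    [Module.Finite k A] [IsAlgClosed k] (h : IsBasicAlgebra A) (a b : A) :
    a * b - b * a ∈ Ring.jacobson A := by
  obtain ⟨n, e, he, hne⟩ := h
  have hoff : ∀ i j, i ≠ j → ∀ a, e i * a * e j ∈ Ring.jacobson A := by
    intro i j hij a
    by_contra hR
    obtain ⟨x, hx, hxb, hbx⟩ := (he.2 j).cornerIso_of_notMem_jacobson k (he.2 i)
      (b := e i * a * e j)
      (by rw [← mul_assoc, ← mul_assoc, (he.1.idem i).eq, mul_assoc, (he.1.idem j).eq]) hR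
    refine hne i j hij ((projIso_iff_cornerIso (he.1.idem i) (he.1.idem j)).2
      ⟨e i * a * e j, x, ?_, hx, hbx, hxb⟩)
    rw [← mul_assoc, ← mul_assoc, (he.1.idem i).eq, mul_assoc, (he.1.idem j).eq]
  obtain ⟨s, hs⟩ := exists_sub_sum_smul_mem_jacobson (k := k) he hoff a
  obtain ⟨t, ht⟩ := exists_sub_sum_smul_mem_jacobson (k := k) he hoff b
  rw [← Ideal.Quotient.eq] at hs ht ⊢
  rw [map_mul, map_mul, hs, ht, ← map_mul, ← map_mul]
  congr 1
  have hc : ∀ s t : Fin n → k, (∑ i, s i • e i) * (∑ i, t i • e i) = ∑ i, (s i * t i) • e i := by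
    intro s t
    rw [Finset.sum_mul_sum]
    refine Finset.sum_congr rfl fun i _ => ?_
    rw [Finset.sum_eq_single i _ (by simp)]
    · rw [smul_mul_smul_comm, (he.1.idem i).eq]
    · intro j _ hj
      rw [smul_mul_smul_comm, he.1.ortho hj.symm, smul_zero]
  rw [hc, hc]
  exact Finset.sum_congr rfl fun i _ => by rw [mul_comm]

/-- It is the commutator of `e i` and `a * e j`. Basicness thereby applies to any orthogonal
decomposition of the unit, not only to the one that witnesses it. -/
theorem offDiagonal_mem_jacobson {ι : Type*} [Fintype ι] {e : ι → A}
    (hcomm : ∀ a b : A, a * b - b * a ∈ Ring.jacobson A) (he : CompleteOrthogonalIdempotents e)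
    {i j : ι} (hij : i ≠ j) (a : A) : e i * a * e j ∈ Ring.jacobson A := by
  have := hcomm (e i) (a * e j)
  rwa [mul_assoc a, he.ortho hij.symm, mul_zero, sub_zero, ← mul_assoc] at this

/-- Otherwise every `f i * e` would lie in the radical, and so would their sum `e`, a nonzero
idempotent. -/
theorem IsPrimitiveIdempotent.exists_cornerIso (k : Type*) [Field k] [Algebra k A]
    [Module.Finite k A] {ι : Type*} [Fintype ι] {e : A} (he : IsPrimitiveIdempotent e)
    {f : ι → A} (hf : IsPrimitiveDecomposition f) : ∃ i, CornerIso e (f i) := by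
  by_contra! h
  apply he.2.1
  apply he.1.eq_zero_of_mem_jacobson
  have : e = ∑ i, f i * e := by rw [← Finset.sum_mul, hf.1.complete, one_mul]
  rw [this]
  refine Ideal.sum_mem _ fun i _ => ?_
  by_contra hR
  have hb : f i * (f i * e) * e = f i * e := by
    rw [← mul_assoc, (hf.1.idem i).eq, mul_assoc, he.1.eq]
  obtain ⟨x, hx, hxb, hbx⟩ := he.cornerIso_of_notMem_jacobson k (hf.2 i) hb hR
  exact h i ⟨x, f i * e, hx, hb, hxb, hbx⟩

end FiniteDimensional

/-! ### Presentations by quiver and relations -/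

section Presentations

open PathAlgebra

variable {k A V : Type*} [Field k] [Ring A] [Algebra k A] [Quiver V] [Fintype V] [DecidableEq V]

/-- The morphism `F : kQ → A` is onto, has kernel `I`, and sends the vertices to idempotents
equivalent to the `e x`. -/
structure IsPresentation (e : V → A) (F : PathAlgebra k V →ₐ[k] A) (I : Ideal (PathAlgebra k V)) :
    Prop where
  surjective : Function.Surjective F
  map_eq_zero_iff : ∀ f, F f = 0 ↔ f ∈ I
  cornerIso : ∀ x, CornerIso (F (vertex k x)) (e x)

theorem CompleteOrthogonalIdempotents.map_vertex (F : PathAlgebra k V →ₐ[k] A) :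
    CompleteOrthogonalIdempotents fun x => F (vertex k x) :=
  completeOrthogonalIdempotents_vertex.map F.toRingHom

theorem RespectsVertices.isPresentation {e : V → A} (he : ∀ x, IsIdempotentElem (e x))
    {I : AdmissibleIdeal k V} {φ : (PathAlgebra k V ⧸ I.ideal) ≃ₐ[k] A}
    (h : RespectsVertices e I φ) :
    IsPresentation e (φ.toAlgHom.comp (Ideal.Quotient.mkₐ k I.ideal)) I.ideal where
  surjective := φ.surjective.comp Ideal.Quotient.mk_surjective
  map_eq_zero_iff f := by
    change φ (Ideal.Quotient.mk I.ideal f) = 0 ↔ f ∈ I.ideal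
    rw [EmbeddingLike.map_eq_zero_iff, Ideal.Quotient.eq_zero_iff_mem]
  cornerIso x := (projIso_iff_cornerIso
    ((CompleteOrthogonalIdempotents.map_vertex
      (φ.toAlgHom.comp (Ideal.Quotient.mkₐ k I.ideal))).idem x) (he x)).1 (h x)

theorem IsPresentation.exists_respectsVertices {e : V → A} (he : ∀ x, IsIdempotentElem (e x))
    {I : AdmissibleIdeal k V} {F : PathAlgebra k V →ₐ[k] A} (h : IsPresentation e F I.ideal) :
    ∃ φ : (PathAlgebra k V ⧸ I.ideal) ≃ₐ[k] A,
      RespectsVertices e I φ ∧ ∀ f, φ (Ideal.Quotient.mk I.ideal f) = F f := by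
  let G : (PathAlgebra k V ⧸ I.ideal) →ₐ[k] A :=
    Ideal.Quotient.liftₐ I.ideal F fun f hf => (h.map_eq_zero_iff f).2 hf
  have hG : ∀ f, G (Ideal.Quotient.mk I.ideal f) = F f := fun f => rfl
  have hbij : Function.Bijective G := by
    constructor
    · rw [injective_iff_map_eq_zero]
      intro a
      obtain ⟨f, rfl⟩ := Ideal.Quotient.mk_surjective a
      intro ha
      rw [hG, h.map_eq_zero_iff] at ha
      exact Ideal.Quotient.eq_zero_iff_mem.2 ha
    · intro a
      obtain ⟨f, hf⟩ := h.surjective a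
      exact ⟨Ideal.Quotient.mk I.ideal f, hf⟩
  refine ⟨AlgEquiv.ofBijective G hbij, fun x => ?_, fun f => rfl⟩
  exact (projIso_iff_cornerIso ((CompleteOrthogonalIdempotents.map_vertex F).idem x) (he x)).2
    (h.cornerIso x)

theorem map_mem_pow_of_mem_lengthIdeal {R : Ideal A} [R.IsTwoSided] {F : PathAlgebra k V →ₐ[k] A}
    (hF : ∀ {x y : V} (α : x ⟶ y), F (ofPath k α.toPath) ∈ R) {n : ℕ} {f : PathAlgebra k V}
    (hf : f ∈ lengthIdeal k V n) : F f ∈ R ^ n := by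
  have key : ∀ (n : ℕ) {x y : V} (p : Quiver.Path x y), n ≤ p.length → F (ofPath k p) ∈ R ^ n := by
    intro n
    induction n with
    | zero =>
      intro x y p _
      rw [Submodule.pow_zero, Ideal.one_eq_top]
      exact Submodule.mem_top
    | succ n ih =>
      intro x y p hp
      cases p with
      | nil => simp at hp
      | cons p α =>
        rw [ofPath_cons, map_mul, Ideal.IsTwoSided.pow_succ]
        exact Ideal.mul_mem_mul (hF α) (ih p (by simpa using hp))
  refine mem_of_mem_support (W := ((R ^ n).restrictScalars k).comap F.toLinearMap)
    fun x y p hp => key n p ?_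
  by_contra hlt
  exact Finsupp.mem_support_iff.1 hp (hf x y p (not_le.1 hlt))

theorem map_mem_lengthIdeal {H : PathAlgebra k V →ₐ[k] PathAlgebra k V}
    (hH : ∀ {x y : V} (α : x ⟶ y), H (ofPath k α.toPath) ∈ lengthIdeal k V 1) {n : ℕ}
    {f : PathAlgebra k V} (hf : f ∈ lengthIdeal k V n) : H f ∈ lengthIdeal k V n := by
  have hpow : ∀ n, lengthIdeal k V 1 ^ n = lengthIdeal k V n := fun n => by
    have h1 := arrowIdeal_pow (k := k) (V := V) 1
    rw [Submodule.pow_one] at h1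
    rw [← h1, arrowIdeal_pow]
  rw [← hpow n]
  exact map_mem_pow_of_mem_lengthIdeal hH hf

theorem incl_eq_smul_toPath_add (hdb : NoDoubleBypass V) {x y : V} (α : x ⟶ y)
    (r : Quiver.Path x y →₀ k) :
    ∃ s : Quiver.Path x y →₀ k, incl s ∈ lengthIdeal k V 2 ∧
      incl r = r α.toPath • ofPath k α.toPath + incl s := by
  classical
  refine ⟨r.erase α.toPath, ?_, ?_⟩
  · rw [incl_mem_lengthIdeal]
    intro p hp
    rw [Finsupp.support_erase, Finset.mem_erase] at hp
    exact hdb.two_le_length hp.1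
  · rw [← incl_single, ← incl_add, Finsupp.single_add_erase]

/-! ### Existence of presentations -/

section Existence

theorem mem_peirceSpace {f e : A} {X : Ideal A} {a : A} :
    a ∈ peirceSpace k f X e ↔ ∃ r ∈ X, f * r * e = a := by
  simp [peirceSpace, Submodule.mem_map]

/-- Products of approximations modulo the square of the radical approximate products one power
deeper. -/
theorem exists_sub_mem_jacobson_pow {S : Subalgebra k A}
    (h₁ : ∀ r ∈ Ring.jacobson A, ∃ s ∈ S, r - s ∈ Ring.jacobson A ^ 2) (n : ℕ) :
    ∀ r ∈ Ring.jacobson A ^ (n + 1), ∃ s ∈ S, r - s ∈ Ring.jacobson A ^ (n + 2) := by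
  induction n with
  | zero =>
    intro r hr
    rw [Submodule.pow_one] at hr
    exact h₁ r hr
  | succ n ih =>
    intro r hr
    rw [Ideal.IsTwoSided.pow_succ] at hr
    induction hr using Submodule.mul_induction_on' with
    | mem_mul_mem a ha b hb =>
      obtain ⟨s, hs, has⟩ := h₁ a ha
      obtain ⟨t, ht, hbt⟩ := ih b hb
      refine ⟨s * t, S.mul_mem hs ht, ?_⟩
      have hsR : s ∈ Ring.jacobson A := by
        have h2 : a - s ∈ Ring.jacobson A := Ideal.pow_le_self two_ne_zero has
        rw [show s = a - (a - s) by abel]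
        exact Ideal.sub_mem _ ha h2
      rw [show a * b - s * t = (a - s) * b + s * (b - t) by noncomm_ring]
      refine Ideal.add_mem _ ?_ ?_
      · rw [show n + 1 + 2 = 2 + (n + 1) by omega, Ideal.IsTwoSided.pow_add]
        exact Ideal.mul_mem_mul has hb
      · rw [show n + 1 + 2 = (n + 2) + 1 by omega, Ideal.IsTwoSided.pow_succ]
        exact Ideal.mul_mem_mul hsR hbt
    | add a _ b _ ha hb =>
      obtain ⟨s, hs, has⟩ := ha
      obtain ⟨t, ht, hbt⟩ := hb
      refine ⟨s + t, S.add_mem hs ht, ?_⟩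
      rw [add_sub_add_comm]
      exact Ideal.add_mem _ has hbt

theorem exists_jacobson_pow_eq_bot (k A : Type*) [Field k] [Ring A] [Algebra k A]
    [Module.Finite k A] : ∃ n, Ring.jacobson A ^ n = ⊥ := by
  have : IsArtinianRing A := IsArtinianRing.of_finite k A
  exact IsSemiprimaryRing.isNilpotent

variable [Module.Finite k A]

/-- Successive approximation along the powers of the radical, which is nilpotent. -/
theorem Subalgebra.eq_top_of_jacobson {S : Subalgebra k A}
    (h₀ : ∀ a : A, ∃ s ∈ S, a - s ∈ Ring.jacobson A)
    (h₁ : ∀ r ∈ Ring.jacobson A, ∃ s ∈ S, r - s ∈ Ring.jacobson A ^ 2) : S = ⊤ := by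
  have key : ∀ (n : ℕ) (a : A), ∃ s ∈ S, a - s ∈ Ring.jacobson A ^ (n + 1) := by
    intro n a
    induction n with
    | zero => rw [zero_add, Submodule.pow_one]; exact h₀ a
    | succ n ih =>
      obtain ⟨s, hs, has⟩ := ih
      obtain ⟨t, ht, hst⟩ := exists_sub_mem_jacobson_pow h₁ n _ has
      exact ⟨s + t, S.add_mem hs ht, by rwa [← sub_sub]⟩
  obtain ⟨n, hn⟩ := exists_jacobson_pow_eq_bot k A
  rw [eq_top_iff]
  intro a _
  obtain ⟨s, hs, has⟩ := key n a
  have : a - s ∈ (⊥ : Ideal A) := hn ▸ Ideal.pow_le_pow_right n.le_succ has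
  rw [Submodule.mem_bot, sub_eq_zero] at this
  rwa [this]

/-- With at most one arrow, the quotient has dimension at most one, and the arrow is sent to a lift
of a generator. -/
theorem exists_arrow_elements {k A V : Type*} [Field k] [Ring A] [Algebra k A]
    [Module.Finite k A] [Quiver V] (hdb : NoDoubleBypass V) {e : V → A} (hQ : IsOrdinaryQuiver k e) (x y : V) :
    ∃ a : (x ⟶ y) → A,
      (∀ α, a α ∈ peirceSpace k (e y) (Ring.jacobson A) (e x) ∧
        a α ∉ peirceSpace k (e y) (Ring.jacobson A ^ 2) (e x)) ∧
      ∀ r ∈ peirceSpace k (e y) (Ring.jacobson A) (e x),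
        r ∈ Submodule.span k (Set.range a) ⊔ peirceSpace k (e y) (Ring.jacobson A ^ 2) (e x) := by
  have hsub := hdb.subsingleton_hom x y
  obtain ⟨hfin, hcard⟩ := hQ x y
  set W := peirceSpace k (e y) (Ring.jacobson A) (e x)
  set W₂ := peirceSpace k (e y) (Ring.jacobson A ^ 2) (e x)
  rcases isEmpty_or_nonempty (x ⟶ y) with hempty | ⟨⟨α₀⟩⟩
  · rw [Nat.card_of_isEmpty] at hcard
    have hss : Subsingleton (↥W ⧸ W₂.submoduleOf W) := Module.finrank_zero_iff.1 hcard.symm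
    refine ⟨fun _ => 0, fun α => isEmptyElim α, fun r hr => ?_⟩
    have h0 : (Submodule.Quotient.mk ⟨r, hr⟩ : ↥W ⧸ W₂.submoduleOf W) = 0 := Subsingleton.elim _ _
    rw [Submodule.Quotient.mk_eq_zero] at h0
    exact Submodule.mem_sup_right h0
  · have : Nonempty (x ⟶ y) := ⟨α₀⟩
    rw [Nat.card_unique] at hcard
    obtain ⟨v, hv0, hv⟩ := finrank_eq_one_iff'.1 hcard.symm
    obtain ⟨⟨a, ha⟩, rfl⟩ := Submodule.Quotient.mk_surjective _ v
    refine ⟨fun _ => a, fun _ => ⟨ha, fun ha₂ => hv0 ?_⟩, fun r hr => ?_⟩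
    · rw [Submodule.Quotient.mk_eq_zero]
      exact ha₂
    · obtain ⟨t, ht⟩ := hv (Submodule.Quotient.mk ⟨r, hr⟩)
      rw [← Submodule.Quotient.mk_smul, Submodule.Quotient.eq] at ht
      have ht' : t • a - r ∈ W₂ := ht
      rw [show r = t • a + -(t • a - r) by abel]
      exact Submodule.add_mem _
        (Submodule.mem_sup_left (Submodule.smul_mem _ _ (Submodule.subset_span ⟨α₀, rfl⟩)))
        (Submodule.mem_sup_right (Submodule.neg_mem _ ht'))

variable [IsAlgClosed k]

/-- Gabriel's theorem for this class of quivers: generators modulo the square of the radical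
generate `A`, and the independence of the images of the arrows there forces the kernel into
`(kQ⁺)²`. -/
theorem exists_presentation {e : V → A} (hcomm : ∀ a b : A, a * b - b * a ∈ Ring.jacobson A)
    (he : IsPrimitiveDecomposition e) (hQ : IsOrdinaryQuiver k e) (hdb : NoDoubleBypass V) :
    ∃ (I : AdmissibleIdeal k V) (F : PathAlgebra k V →ₐ[k] A), IsPresentation e F I.ideal := by
  choose a ha haR using fun x y => exists_arrow_elements hdb hQ x y
  have hid : ∀ x, e x * e x = e x := fun x => he.1.idem x
  have hsand : ∀ {x y : V} {X : Ideal A} {r : A}, r ∈ peirceSpace k (e y) X (e x) →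
      e y * r * e x = r := by
    intro x y X r hr
    obtain ⟨s, -, rfl⟩ := mem_peirceSpace.1 hr
    rw [← mul_assoc, ← mul_assoc, hid, mul_assoc, hid]
  have hmem : ∀ {x y : V} {X : Ideal A} [X.IsTwoSided] {r : A},
      r ∈ peirceSpace k (e y) X (e x) → r ∈ X := by
    intro x y X _ r hr
    obtain ⟨s, hs, rfl⟩ := mem_peirceSpace.1 hr
    exact X.mul_mem_right _ (X.mul_mem_left _ hs)
  let F : PathAlgebra k V →ₐ[k] A :=
    lift k he.1 (a := fun {x y} α => a x y α) fun {x y} α => hsand (ha x y α).1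
  have hFv : ∀ x, F (vertex k x) = e x := lift_vertex k he.1 _
  have hFa : ∀ {x y : V} (α : x ⟶ y), F (ofPath k α.toPath) = a x y α := fun {x y} α =>
    lift_arrow k he.1 _ α
  have hFR : ∀ {n : ℕ} {f : PathAlgebra k V}, f ∈ lengthIdeal k V n →
      F f ∈ Ring.jacobson A ^ n := fun hf =>
    map_mem_pow_of_mem_lengthIdeal (fun {x y} α => by rw [hFa]; exact hmem (ha x y α).1) hf
  have hsurj : Function.Surjective F := by
    rw [← AlgHom.range_eq_top]
    refine Subalgebra.eq_top_of_jacobson (fun b => ?_) (fun r hr => ?_)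
    · obtain ⟨t, ht⟩ := exists_sub_sum_smul_mem_jacobson (k := k) he
        (fun i j hij => offDiagonal_mem_jacobson hcomm he.1 hij) b
      refine ⟨_, ?_, ht⟩
      exact sum_mem fun x _ => Subalgebra.smul_mem _ ((AlgHom.mem_range F).2 ⟨vertex k x, hFv x⟩) _
    · have hblock : ∀ x y, ∃ s ∈ F.range, e y * r * e x - s ∈ Ring.jacobson A ^ 2 := by
        intro x y
        have := haR x y (e y * r * e x) (mem_peirceSpace.2 ⟨r, hr, rfl⟩)
        obtain ⟨s, hs, s', hs', hss⟩ := Submodule.mem_sup.1 this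
        refine ⟨s, ?_, ?_⟩
        · have hle : Submodule.span k (Set.range (a x y)) ≤ Subalgebra.toSubmodule F.range := by
            rw [Submodule.span_le]
            rintro _ ⟨α, rfl⟩
            exact ⟨ofPath k α.toPath, hFa α⟩
          exact hle hs
        · rw [← hss, add_sub_cancel_left]
          exact hmem hs'
      choose s hs hsR using hblock
      refine ⟨∑ y, ∑ x, s x y, sum_mem fun y _ => sum_mem fun x _ => hs x y, ?_⟩
      have hr' : r = ∑ y, ∑ x, e y * r * e x := by
        simp_rw [← Finset.mul_sum, he.1.complete, mul_one, ← Finset.sum_mul, he.1.complete,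
          one_mul]
      conv in r - _ => rw [hr']
      rw [← Finset.sum_sub_distrib]
      refine Ideal.sum_mem _ fun y _ => ?_
      rw [← Finset.sum_sub_distrib]
      exact Ideal.sum_mem _ fun x _ => hsR x y
  -- The coefficient of a trivial path vanishes because `e x ≠ 0`. A nonzero coefficient on an arrow
  -- would express its image through longer paths, hence place it in the square of the radical.
  have hker : ∀ f, F f = 0 → f ∈ lengthIdeal k V 2 := by
    intro f hf x y p hp
    have hfxy : F (incl (f x y)) = 0 := by
      rw [← vertex_mul_mul_vertex, map_mul, map_mul, hf, mul_zero, zero_mul]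
    cases p with
    | nil =>
      have h1 : f x x = Finsupp.single .nil (f x x .nil) := by
        ext q
        rw [hdb.eq_nil q, Finsupp.single_eq_same]
      rw [h1, incl_single, map_smul, hFv] at hfxy
      exact (smul_eq_zero.1 hfxy).resolve_right (he.2 x).2.1
    | cons p α =>
      cases p with
      | cons p β => simp at hp
      | nil =>
        change f x y α.toPath = 0
        obtain ⟨s, hs, hfs⟩ := incl_eq_smul_toPath_add hdb α (f x y)
        rw [hfs, map_add, map_smul, hFa] at hfxy
        by_contra hne
        apply (ha x y α).2
        have h1 : a x y α = (f x y α.toPath)⁻¹ • -F (incl s) := by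
          rw [← eq_neg_of_add_eq_zero_left hfxy, smul_smul, inv_mul_cancel₀ hne, one_smul]
        rw [h1]
        refine Submodule.smul_mem _ _ (Submodule.neg_mem _ ?_)
        refine mem_peirceSpace.2 ⟨F (incl s), hFR hs, ?_⟩
        rw [← hFv, ← hFv, ← map_mul, ← map_mul, vertex_mul_incl, incl_mul_vertex]
  obtain ⟨n, hn⟩ := exists_jacobson_pow_eq_bot k A
  let I : AdmissibleIdeal k V :=
    { ideal := RingHom.ker F
      isTwoSided := inferInstance
      exists_pow_le := by
        refine ⟨n + 2, by omega, ?_⟩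
        rw [arrowIdeal_pow]
        intro f hf
        have h1 := Ideal.pow_le_pow_right (show n ≤ n + 2 by omega) (hFR hf)
        rw [hn, Submodule.mem_bot] at h1
        exact h1
      le_sq := by
        rw [arrowIdeal_pow]
        exact fun f hf => hker f hf }
  exact ⟨I, F, hsurj, fun f => Iff.rfl, fun x => ⟨e x, e x, by
    rw [hFv, hid, hid], by rw [hFv, hid, hid], by rw [hFv, hid], hid x⟩⟩

end Existence

end Presentations

/-! ### Comparison of two presentations -/

section Comparison

open PathAlgebra

variable {k A V : Type*} [Field k] [Ring A] [Algebra k A] [Quiver V] [Fintype V] [DecidableEq V]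

/-- Two presentations that respect the vertices differ by an automorphism of the path algebra that
fixes the vertices. -/
theorem IsPresentation.exists_comap_eq {e : V → A} (he : ∀ x, IsIdempotentElem (e x))
    {F F' : PathAlgebra k V →ₐ[k] A} {I I' : Ideal (PathAlgebra k V)}
    (h : IsPresentation e F I) (h' : IsPresentation e F' I') (hI' : I' ≤ lengthIdeal k V 2)
    (hdb : NoDoubleBypass V) :
    ∃ (a : ArrowMap k V) (H : PathAlgebra k V →ₐ[k] PathAlgebra k V),
      (∀ x, H (vertex k x) = vertex k x) ∧
      (∀ {x y : V} (α : x ⟶ y), H (ofPath k α.toPath) = incl (a x y α)) ∧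
      (∀ {x y : V} (α : x ⟶ y), a x y α α.toPath ≠ 0) ∧ I = I'.comap H := by
  have hv := CompleteOrthogonalIdempotents.map_vertex F
  have hv' := CompleteOrthogonalIdempotents.map_vertex F'
  obtain ⟨u, hu⟩ := exists_conj_of_cornerIso hv hv' fun x =>
    (h.cornerIso x).trans (hv.idem x) (he x) (hv'.idem x) (h'.cornerIso x).symm
  -- Conjugation keeps the kernel of `F` and makes the images of the vertices agree with those under
  -- `F'`.
  let F₁ : PathAlgebra k V →ₐ[k] A := AlgHom.ofLinearMap
    ((LinearMap.mulLeftRight k ((u : A), (↑u⁻¹ : A))).comp F.toLinearMap)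
    (by simp)
    (fun f g => by simp [mul_assoc])
  have hF₁ : ∀ f, F₁ f = u * F f * (↑u⁻¹ : A) := fun f => by
    change LinearMap.mulLeftRight k ((u : A), (↑u⁻¹ : A)) (F f) = _
    rw [LinearMap.mulLeftRight_apply]
  have hF₁v : ∀ x, F₁ (vertex k x) = F' (vertex k x) := fun x => by rw [hF₁]; exact hu x
  have hF₁0 : ∀ f, F₁ f = 0 ↔ f ∈ I := fun f => by
    rw [← h.map_eq_zero_iff, hF₁]
    simp
  have hF₁s : Function.Surjective F₁ := fun b => by
    obtain ⟨f, hf⟩ := h.surjective ((↑u⁻¹ : A) * b * u)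
    refine ⟨f, ?_⟩
    rw [hF₁, hf]
    simp [mul_assoc]
  have hlift : ∀ {G G' : PathAlgebra k V →ₐ[k] A} (_ : Function.Surjective G)
      (_ : ∀ x, G' (vertex k x) = G (vertex k x)) {x y : V} (α : x ⟶ y),
      ∃ r : Quiver.Path x y →₀ k, G (incl r) = G' (ofPath k α.toPath) := by
    intro G G' hG hGG x y α
    obtain ⟨g, hg⟩ := hG (G' (ofPath k α.toPath))
    refine ⟨g x y, ?_⟩
    rw [← vertex_mul_mul_vertex, map_mul, map_mul, hg, ← hGG, ← hGG, ← map_mul, ← map_mul,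
      ofPath, vertex_mul_incl, incl_mul_vertex]
  choose a ha using fun x y (α : x ⟶ y) => hlift h'.surjective hF₁v α
  let H : PathAlgebra k V →ₐ[k] PathAlgebra k V :=
    lift k completeOrthogonalIdempotents_vertex (a := fun {x y} α => incl (a x y α))
      fun {x y} α => by rw [vertex_mul_incl, incl_mul_vertex]
  have hHv : ∀ x, H (vertex k x) = vertex k x :=
    lift_vertex k completeOrthogonalIdempotents_vertex _
  have hHa : ∀ {x y : V} (α : x ⟶ y), H (ofPath k α.toPath) = incl (a x y α) := fun {x y} α =>
    lift_arrow k completeOrthogonalIdempotents_vertex _ α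
  have hFH : F'.comp H = F₁ := by
    refine algHom_ext (fun x => ?_) (fun {x y} α => ?_)
    · rw [AlgHom.comp_apply, hHv, hF₁v]
    · rw [AlgHom.comp_apply, hHa, ha]
  have hH1 : ∀ {x y : V} (α : x ⟶ y), H (ofPath k α.toPath) ∈ lengthIdeal k V 1 := by
    intro x y α
    rw [hHa, incl_mem_lengthIdeal]
    intro p _
    cases p with
    | nil => exact absurd rfl (hdb.ne_of_hom α)
    | cons p β => simp
  refine ⟨a, H, hHv, hHa, ?_, ?_⟩
  -- Lifting `F' α` through `F₁` gives `r` such that `H (incl r)` equals `α` up to paths of length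
  -- at least two. Comparing coefficients at `α`, that of `r` times that of `a α` is `1`.
  · intro x y α
    obtain ⟨r, hr⟩ := hlift hF₁s (fun x => (hF₁v x).symm) α
    have h1 : H (incl r) - ofPath k α.toPath ∈ lengthIdeal k V 2 := by
      apply hI'
      rw [← h'.map_eq_zero_iff, map_sub, ← AlgHom.comp_apply, hFH, hr, sub_self]
    obtain ⟨s, hs, hrs⟩ := incl_eq_smul_toPath_add hdb α r
    have h2 := h1 x y α.toPath (by simp [Quiver.Hom.toPath])
    have h3 : H (incl s) x y α.toPath = 0 :=
      map_mem_lengthIdeal hH1 hs x y α.toPath (by simp [Quiver.Hom.toPath])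
    rw [hrs, map_add, map_smul, hHa, sub_eq_add_neg, PathAlgebra.add_apply,
      PathAlgebra.add_apply, PathAlgebra.smul_apply, incl_apply_same, Finsupp.add_apply,
      Finsupp.add_apply, h3, Finsupp.smul_apply] at h2
    have h4 : (-ofPath k α.toPath : PathAlgebra k V) x y α.toPath = -1 := by
      change -(ofPath k α.toPath x y α.toPath) = -1
      rw [ofPath_apply_same, Finsupp.single_eq_same]
    rw [h4] at h2
    intro h0
    rw [h0] at h2
    simp at h2
  · ext f
    rw [Ideal.mem_comap, ← h'.map_eq_zero_iff, ← hF₁0, ← hFH]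
    rfl

theorem evalPath_smul_toPath (t : ∀ {x y : V}, (x ⟶ y) → k)
    (ht : ∀ {x y : V} (α : x ⟶ y), t α ≠ 0) {x y : V} (p : Quiver.Path x y) :
    ∃ s : k, s ≠ 0 ∧ evalPath (vertex k) (fun {x y} (α : x ⟶ y) => t α • ofPath k α.toPath) p =
      s • ofPath k p := by
  induction p with
  | nil => exact ⟨1, one_ne_zero, (one_smul k _).symm⟩
  | cons p α ih =>
    obtain ⟨s, hs, hp⟩ := ih
    refine ⟨t α * s, mul_ne_zero (ht α) hs, ?_⟩
    rw [evalPath, hp, smul_mul_smul_comm, ofPath_cons]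

/-- A diagonal automorphism does not change the homogeneity of ideals. -/
theorem isHomogeneous_of_comap_diagonal {L I : Ideal (PathAlgebra k V)}
    {H : PathAlgebra k V →ₐ[k] PathAlgebra k V}
    (hH : ∀ {x y : V} (p : Quiver.Path x y), ∃ s : k, s ≠ 0 ∧ H (ofPath k p) = s • ofPath k p)
    (h : IsHomogeneous L (I.comap H)) : IsHomogeneous L I := by
  classical
  intro x y r hr p
  choose s hs0 hs using fun p : Quiver.Path x y => hH p
  -- The inverse of `H` on this component; it rescales coefficients, so it commutes with filtering.
  let D : (Quiver.Path x y →₀ k) → (Quiver.Path x y →₀ k) := fun r =>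
    Finsupp.onFinset r.support (fun p => (s p)⁻¹ * r p) fun p hp => by
      rw [Finsupp.mem_support_iff]
      exact right_ne_zero_of_mul hp
  have hD : ∀ r, H (incl (D r)) = incl r := by
    intro r
    have hsupp : (D r).support = r.support := by
      ext p
      simp [D, Finsupp.onFinset_apply, hs0]
    rw [incl_eq_sum, incl_eq_sum r, map_sum, hsupp]
    refine Finset.sum_congr rfl fun p _ => ?_
    rw [map_smul, hs, smul_smul]
    congr 1
    change (s p)⁻¹ * r p * s p = r p
    rw [mul_comm, mul_inv_cancel_left₀ (hs0 p)]
  have h1 := h x y (D r) (by rw [Ideal.mem_comap, hD]; exact hr) p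
  have h2 : (D r).filter (fun q => pathClass L x y p q) =
      D (r.filter fun q => pathClass L x y p q) := by
    ext q
    change _ = (s q)⁻¹ * (r.filter fun q => pathClass L x y p q) q
    rw [Finsupp.filter_apply, Finsupp.filter_apply, mul_ite, mul_zero]
    rfl
  rw [h2, Ideal.mem_comap, hD] at h1
  exact h1

/-- A homotopy relation is generated by its pairs of parallel paths, which here form a finite set.
-/
theorem Homotopic.of_forall_path {I K : Ideal (PathAlgebra k V)}
    (h : ∀ {x y : V} (p q : Quiver.Path x y), pathClass I x y p q → pathClass K x y p q)
    {x y : Symmetrify V} {u v : Walk x y} (huv : Homotopic I u v) : Homotopic K u v := by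
  induction huv with
  | refl u => exact .refl u
  | symm _ ih => exact ih.symm
  | trans _ _ ih ih' => exact ih.trans ih'
  | comp _ _ ih ih' => exact .comp ih ih'
  | arrow_inv α => exact .arrow_inv α
  | inv_arrow α => exact .inv_arrow α
  | relation r hr hp hq => exact h _ _ (Homotopic.relation r hr hp hq)

variable [CharZero k]

theorem transvection_comp_neg (hdb : NoDoubleBypass V) {c : ArrowMap k V} (hc : IsBypassMap c)
    (f : PathAlgebra k V) : transvection hdb hc (transvection hdb hc.neg f) = f := by
  rw [transvection_apply, transvection_apply, PathAlgebra.deriv_neg, ← Module.End.mul_apply,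
    IsNilpotent.exp_mul_exp_neg_self (isNilpotent_deriv hdb hc), Module.End.one_apply]

theorem transvection_neg_comp (hdb : NoDoubleBypass V) {c : ArrowMap k V} (hc : IsBypassMap c)
    (f : PathAlgebra k V) : transvection hdb hc.neg (transvection hdb hc f) = f := by
  rw [transvection_apply, transvection_apply, PathAlgebra.deriv_neg, ← Module.End.mul_apply,
    IsNilpotent.exp_neg_mul_exp_self (isNilpotent_deriv hdb hc), Module.End.one_apply]

theorem transvection_mem_lengthIdeal (hdb : NoDoubleBypass V) {c : ArrowMap k V}
    (hc : IsBypassMap c) {n : ℕ} {f : PathAlgebra k V} (hf : f ∈ lengthIdeal k V n) :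
    transvection hdb hc f ∈ lengthIdeal k V n := by
  refine map_mem_lengthIdeal (fun {x y} α => ?_) hf
  rw [transvection_arrow, ofPath, ← incl_add, incl_mem_lengthIdeal]
  intro p _
  cases p with
  | nil => exact absurd rfl (hdb.ne_of_hom α)
  | cons p β => simp

/-- The image of an admissible ideal under a unipotent automorphism. -/
noncomputable def AdmissibleIdeal.comapTransvection (I : AdmissibleIdeal k V)
    (hdb : NoDoubleBypass V) {c : ArrowMap k V} (hc : IsBypassMap c) : AdmissibleIdeal k V where
  ideal := I.ideal.comap (transvection hdb hc)
  isTwoSided := inferInstance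
  exists_pow_le := by
    obtain ⟨n, hn, h⟩ := I.exists_pow_le
    refine ⟨n, hn, ?_⟩
    rw [arrowIdeal_pow] at h ⊢
    exact fun f hf => h (transvection_mem_lengthIdeal hdb hc hf)
  le_sq := by
    have h := I.le_sq
    rw [arrowIdeal_pow] at h ⊢
    intro f hf
    rw [← transvection_neg_comp hdb hc f]
    exact transvection_mem_lengthIdeal hdb _ (h hf)

theorem IsPresentation.comapTransvection {e : V → A} {F : PathAlgebra k V →ₐ[k] A}
    {I : AdmissibleIdeal k V} (h : IsPresentation e F I.ideal) (hdb : NoDoubleBypass V)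
    {c : ArrowMap k V} (hc : IsBypassMap c) :
    IsPresentation e (F.comp (transvection hdb hc)) (I.comapTransvection hdb hc).ideal where
  surjective a := by
    obtain ⟨f, hf⟩ := h.surjective a
    exact ⟨transvection hdb hc.neg f, by rw [AlgHom.comp_apply, transvection_comp_neg, hf]⟩
  map_eq_zero_iff f := h.map_eq_zero_iff _
  cornerIso x := by
    rw [AlgHom.comp_apply, transvection_vertex]
    exact h.cornerIso x

/-- Two presentations that respect the vertices have a common refinement. -/
theorem IsPresentation.exists_refinement {e : V → A} (he : ∀ x, IsIdempotentElem (e x))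
    {F F' : PathAlgebra k V →ₐ[k] A} {I I' : AdmissibleIdeal k V}
    (h : IsPresentation e F I.ideal) (h' : IsPresentation e F' I'.ideal)
    (hdb : NoDoubleBypass V) :
    ∃ (K : AdmissibleIdeal k V) (G : PathAlgebra k V →ₐ[k] A), IsPresentation e G K.ideal ∧
      IsHomogeneous I.ideal K.ideal ∧ IsHomogeneous I'.ideal K.ideal := by
  have hI' := I'.le_sq
  rw [arrowIdeal_pow] at hI'
  obtain ⟨a, H, hHv, hHa, ha0, hII'⟩ := h.exists_comap_eq he h' hI' hdb
  let t : ∀ {x y : V}, (x ⟶ y) → k := fun {x y} α => a x y α α.toPath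
  -- The map `H` sends `α` to `t α • (α + c α)`: it is the diagonal map `D` followed by the
  -- transvection of `c`.
  let c : ArrowMap k V := fun x y α => (t α)⁻¹ • a x y α - Finsupp.single α.toPath 1
  have hc : IsBypassMap c := by
    intro x y α
    have : t α ≠ 0 := ha0 α
    simp [c, t] at this ⊢
    rw [inv_mul_cancel₀ this, sub_self]
  let D : PathAlgebra k V →ₐ[k] PathAlgebra k V :=
    lift k completeOrthogonalIdempotents_vertex (a := fun {x y} α => t α • ofPath k α.toPath)
      fun {x y} α => by
        rw [mul_smul_comm, smul_mul_assoc, ofPath, vertex_mul_incl, incl_mul_vertex]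
  have hDp : ∀ {x y : V} (p : Quiver.Path x y), ∃ s : k, s ≠ 0 ∧
      D (ofPath k p) = s • ofPath k p := by
    intro x y p
    obtain ⟨s, hs, hp⟩ := evalPath_smul_toPath t (fun α => ha0 α) p
    exact ⟨s, hs, (lift_ofPath k completeOrthogonalIdempotents_vertex _ p).trans hp⟩
  have hH : (transvection hdb hc).comp D = H := by
    refine algHom_ext (fun x => ?_) (fun {x y} α => ?_)
    · rw [AlgHom.comp_apply, hHv]
      exact (congrArg _ (lift_vertex k completeOrthogonalIdempotents_vertex _ x)).trans
        (transvection_vertex hdb hc x)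
    · rw [AlgHom.comp_apply, hHa]
      refine (congrArg _ (lift_arrow k completeOrthogonalIdempotents_vertex _ α)).trans ?_
      rw [map_smul, transvection_arrow, ofPath, ← incl_add, ← incl_smul]
      congr 1
      simp only [c]
      rw [add_sub_cancel, smul_smul, mul_inv_cancel₀ (ha0 α), one_smul]
  have hhom : IsHomogeneous I.ideal (I'.ideal.comap (transvection hdb hc)) := by
    refine isHomogeneous_of_comap_diagonal hDp ?_
    have : (I'.ideal.comap (transvection hdb hc)).comap D = I.ideal := by
      rw [hII', ← hH]; rfl
    rw [this]
    exact isHomogeneous_self _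
  obtain ⟨c', hc', h1, h2⟩ := exists_common_homogeneous hdb hhom (isHomogeneous_self I'.ideal)
    hc rfl
  exact ⟨I'.comapTransvection hdb hc', _, h'.comapTransvection hdb hc', h1, h2⟩

/-- There is a presentation whose homotopy relation is contained in that of every other
presentation that respects the vertices. -/
theorem exists_finest_presentation {e : V → A} (he : ∀ x, IsIdempotentElem (e x))
    (hdb : NoDoubleBypass V)
    (hex : ∃ (I : AdmissibleIdeal k V) (F : PathAlgebra k V →ₐ[k] A),
      IsPresentation e F I.ideal) :
    ∃ (I₀ : AdmissibleIdeal k V) (F₀ : PathAlgebra k V →ₐ[k] A), IsPresentation e F₀ I₀.ideal ∧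
      ∀ (I : AdmissibleIdeal k V) (F : PathAlgebra k V →ₐ[k] A), IsPresentation e F I.ideal →
        ∀ {x y : Symmetrify V} {u v : Walk x y}, Homotopic I₀.ideal u v →
          Homotopic I.ideal u v := by
  let pairs : Ideal (PathAlgebra k V) → Set (Σ x y : V, Quiver.Path x y × Quiver.Path x y) :=
    fun I => {s | pathClass I s.1 s.2.1 s.2.2.1 s.2.2.2}
  have hfin : Finite (Σ x y : V, Quiver.Path x y × Quiver.Path x y) := by
    have := hdb.finite_path
    infer_instance
  let S : Set (AdmissibleIdeal k V) := {I | ∃ F : PathAlgebra k V →ₐ[k] A,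
    IsPresentation e F I.ideal}
  have hS : S.Nonempty := hex
  -- Minimize the number of homotopic pairs of parallel paths. A common refinement of `I₀` with
  -- another presentation cannot have fewer pairs, so it has the same ones as `I₀`.
  obtain ⟨I₀, ⟨F₀, h₀⟩, hmin⟩ :=
    (measure fun I : AdmissibleIdeal k V => (pairs I.ideal).ncard).wf.has_min S hS
  refine ⟨I₀, F₀, h₀, fun I F h => ?_⟩
  obtain ⟨K, G, hK, h1, h2⟩ := h₀.exists_refinement he h hdb
  have hsub : pairs K.ideal ⊆ pairs I₀.ideal := fun s hs => Homotopic.of_isHomogeneous h1 hs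
  have heq : pairs K.ideal = pairs I₀.ideal :=
    Set.eq_of_subset_of_ncard_le hsub (not_lt.1 (hmin K ⟨G, hK⟩)) (Set.toFinite _)
  intro x y u v huv
  refine Homotopic.of_isHomogeneous h2 (Homotopic.of_forall_path (fun {x y} p q hpq => ?_) huv)
  have : (⟨x, y, p, q⟩ : Σ x y : V, Quiver.Path x y × Quiver.Path x y) ∈ pairs I₀.ideal := hpq
  rw [← heq] at this
  exact this

end Comparison

/-! ### The quiver and the vertices of an arbitrary presentation -/

section Radical

open PathAlgebra

variable {k A V : Type*} [Field k] [Ring A] [Algebra k A] [Quiver V] [Fintype V] [DecidableEq V]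
  {I : AdmissibleIdeal k V} {F : PathAlgebra k V →ₐ[k] A}

theorem AdmissibleIdeal.le_lengthIdeal (I : AdmissibleIdeal k V) :
    I.ideal ≤ lengthIdeal k V 2 := by
  rw [← arrowIdeal_pow]
  exact I.le_sq

theorem map_vertex_ne_zero (hF0 : ∀ f, F f = 0 ↔ f ∈ I.ideal) (x : V) : F (vertex k x) ≠ 0 := by
  intro h
  have := ofPath_mem_lengthIdeal.1 (I.le_lengthIdeal ((hF0 _).1 h))
  simp at this

theorem eq_smul_vertex_of_loop (hdb : NoDoubleBypass V) {x : V} (r : Quiver.Path x x →₀ k) :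
    incl r = r .nil • vertex k x := by
  rw [vertex, ← incl_single]
  congr 1
  ext q
  rw [hdb.eq_nil q, Finsupp.single_eq_same]

/-- As there are no cycles, the corner at a vertex consists of scalars. -/
theorem isPrimitiveDecomposition_map_vertex (hdb : NoDoubleBypass V)
    (hF : Function.Surjective F) (hF0 : ∀ f, F f = 0 ↔ f ∈ I.ideal) :
    IsPrimitiveDecomposition fun x => F (vertex k x) := by
  have hv := CompleteOrthogonalIdempotents.map_vertex F
  refine ⟨hv, fun x => ⟨hv.idem x, map_vertex_ne_zero hF0 x, ?_⟩⟩
  intro g h hg hh hgh hhg hsum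
  change F (vertex k x) = g + h at hsum
  obtain ⟨f, rfl⟩ := hF g
  have h1 : F (vertex k x) * F f * F (vertex k x) = F f := by
    have hg' : F f * F f = F f := hg
    rw [hsum, add_mul, hhg, add_zero, hg', mul_add, hg', hgh, add_zero]
  rw [← map_mul, ← map_mul, vertex_mul_mul_vertex, eq_smul_vertex_of_loop hdb, map_smul] at h1
  set t := f x x .nil
  have h2 : (t * t) • F (vertex k x) = t • F (vertex k x) := by
    have hid : F (vertex k x) * F (vertex k x) = F (vertex k x) := hv.idem x
    have hg' : F f * F f = F f := hg
    rw [← h1, smul_mul_smul_comm, hid] at hg'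
    exact hg'
  have h3 : t * t = t := by
    rw [← sub_eq_zero, ← sub_smul] at h2
    exact sub_eq_zero.1 ((smul_eq_zero.1 h2).resolve_right (map_vertex_ne_zero hF0 x))
  rcases eq_or_ne t 0 with h0 | h0
  · left
    rw [← h1, h0, zero_smul]
  · right
    have ht : t = 1 := mul_left_cancel₀ h0 (by rw [h3, mul_one])
    rw [ht, one_smul] at h1
    rw [h1] at hsum
    exact left_eq_add.1 hsum

/-- A nonzero coefficient on a trivial path would put a nonzero idempotent in the radical;
conversely, combinations of paths of positive length generate a nil left ideal, by admissibility. -/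
theorem map_mem_jacobson_iff (hdb : NoDoubleBypass V) (hF : Function.Surjective F)
    (hF0 : ∀ f, F f = 0 ↔ f ∈ I.ideal) {f : PathAlgebra k V} :
    F f ∈ Ring.jacobson A ↔ f ∈ lengthIdeal k V 1 := by
  constructor
  · intro h x y p hp
    cases p with
    | cons p α => simp at hp
    | nil =>
      have h1 : F (incl (f x x)) ∈ Ring.jacobson A := by
        rw [← vertex_mul_mul_vertex, map_mul, map_mul]
        exact Ideal.mul_mem_right _ _ (Ideal.mul_mem_left _ _ h)
      rw [eq_smul_vertex_of_loop hdb, map_smul] at h1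
      by_contra h0
      have h2 : F (vertex k x) ∈ Ring.jacobson A := by
        have := Submodule.smul_of_tower_mem (Ring.jacobson A) (f x x .nil)⁻¹ h1
        rwa [smul_smul, inv_mul_cancel₀ h0, one_smul] at this
      exact map_vertex_ne_zero hF0 x
        (((CompleteOrthogonalIdempotents.map_vertex F).idem x).eq_zero_of_mem_jacobson h2)
  · intro hf
    refine mem_jacobson_of_isNilpotent_corner (e := 1) (mul_one _) fun c => ?_
    obtain ⟨g, rfl⟩ := hF c
    obtain ⟨n, -, hn⟩ := I.exists_pow_le
    refine ⟨n, ?_⟩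
    rw [one_mul, ← map_mul, ← map_pow, hF0]
    apply hn
    rw [arrowIdeal_pow]
    have hgf : g * f ∈ lengthIdeal k V 1 := Ideal.mul_mem_left _ _ hf
    have hpow : ∀ m, (g * f) ^ m ∈ lengthIdeal k V m := by
      intro m
      induction m with
      | zero => exact fun _ _ _ h => absurd h (Nat.not_lt_zero _)
      | succ m ih =>
        rw [pow_succ, add_comm]
        exact mul_mem_lengthIdeal ih hgf
    exact hpow n

theorem map_mem_jacobson_sq_iff (hdb : NoDoubleBypass V) (hF : Function.Surjective F)
    (hF0 : ∀ f, F f = 0 ↔ f ∈ I.ideal) {f : PathAlgebra k V} :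
    F f ∈ Ring.jacobson A ^ 2 ↔ f ∈ lengthIdeal k V 2 := by
  constructor
  · intro h
    have key : ∀ b ∈ Ring.jacobson A ^ 2, ∃ g ∈ lengthIdeal k V 2, F g = b := by
      intro b hb
      rw [show (2 : ℕ) = 1 + 1 from rfl, Ideal.IsTwoSided.pow_succ, Submodule.pow_one] at hb
      induction hb using Submodule.mul_induction_on' with
      | mem_mul_mem a ha b hb =>
        obtain ⟨g, rfl⟩ := hF a
        obtain ⟨h, rfl⟩ := hF b
        exact ⟨g * h, mul_mem_lengthIdeal ((map_mem_jacobson_iff hdb hF hF0).1 ha)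
          ((map_mem_jacobson_iff hdb hF hF0).1 hb), map_mul _ _ _⟩
      | add a _ b _ ha hb =>
        obtain ⟨g, hg, rfl⟩ := ha
        obtain ⟨h, hh, rfl⟩ := hb
        exact ⟨g + h, Ideal.add_mem _ hg hh, map_add _ _ _⟩
    obtain ⟨g, hg, hgf⟩ := key _ h
    have h1 : f - g ∈ lengthIdeal k V 2 := by
      apply I.le_lengthIdeal
      rw [← hF0, map_sub, hgf, sub_self]
    rw [show f = f - g + g by abel]
    exact Ideal.add_mem _ h1 hg
  · exact map_mem_pow_of_mem_lengthIdeal fun α =>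
      (map_mem_jacobson_iff hdb hF hF0).2 (ofPath_mem_lengthIdeal.2 le_rfl)

/-- The arrows of the quiver can be read off any presentation. -/
theorem nonempty_hom_iff (hdb : NoDoubleBypass V) (hF : Function.Surjective F)
    (hF0 : ∀ f, F f = 0 ↔ f ∈ I.ideal) (x y : V) :
    Nonempty (x ⟶ y) ↔ ∃ r ∈ Ring.jacobson A,
      F (vertex k y) * r * F (vertex k x) ∉ Ring.jacobson A ^ 2 := by
  constructor
  · rintro ⟨α⟩
    refine ⟨F (ofPath k α.toPath),
      (map_mem_jacobson_iff hdb hF hF0).2 (ofPath_mem_lengthIdeal.2 le_rfl), ?_⟩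
    rw [← map_mul, ← map_mul, ofPath, vertex_mul_incl, incl_mul_vertex,
      map_mem_jacobson_sq_iff hdb hF hF0]
    intro h
    have := ofPath_mem_lengthIdeal.1 h
    simp [Quiver.Hom.toPath] at this
  · rintro ⟨r, hr, h⟩
    by_contra hne
    obtain ⟨g, rfl⟩ := hF r
    apply h
    rw [← map_mul, ← map_mul, vertex_mul_mul_vertex, map_mem_jacobson_sq_iff hdb hF hF0,
      incl_mem_lengthIdeal]
    intro p hp
    have h1 := (map_mem_jacobson_iff hdb hF hF0).1 hr x y p
    cases p with
    | nil => exact absurd (h1 (by simp)) (Finsupp.mem_support_iff.1 hp)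
    | cons p α =>
      cases p with
      | nil => exact absurd ⟨α⟩ hne
      | cons p β => simp

/-- The presence of an arrow only depends on the equivalence classes of the idempotents at its ends:
multiplying by the equivalences is reversible and respects the powers of the radical. -/
theorem CornerIso.exists_notMem_jacobson_sq {e e' f f' : A} (he : CornerIso e e')
    (hf : CornerIso f f')
    (hid : IsIdempotentElem e') (hid' : IsIdempotentElem f')
    (h : ∃ r ∈ Ring.jacobson A, f * r * e ∉ Ring.jacobson A ^ 2) :
    ∃ r ∈ Ring.jacobson A, f' * r * e' ∉ Ring.jacobson A ^ 2 := by
  obtain ⟨a, b, ha, -, hab, -⟩ := he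
  obtain ⟨c, d, -, hd, hcd, -⟩ := hf
  obtain ⟨r, hr, hrR⟩ := h
  refine ⟨d * r * a, Ideal.mul_mem_right _ _ (Ideal.mul_mem_left _ _ hr), fun h => hrR ?_⟩
  have h1 : f' * (d * r * a) * e' = d * r * a := by
    rw [← mul_assoc, ← mul_assoc, mul_eq_self_of_sandwich hid' hd, mul_assoc,
      self_mul_of_sandwich hid ha]
  rw [h1] at h
  have h2 : f * r * e = c * (d * r * a) * b := by
    rw [← hab, ← hcd]; simp only [mul_assoc]
  rw [h2]
  exact Ideal.mul_mem_right _ _ (Ideal.mul_mem_left _ _ h)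

/-- The sum of the vertices reachable by walks from `x₀` is central in `kQ`. Its image in `A` is a
central idempotent, nonzero because of `x₀`, and different from `1` if `y₀` is not reachable. -/
theorem IsConnectedAlgebra.nonempty_walk (hA : IsConnectedAlgebra A)
    (hF : Function.Surjective F) (hF0 : ∀ f, F f = 0 ↔ f ∈ I.ideal) (x₀ y₀ : V) :
    Nonempty (Walk (Symmetrify.of.obj x₀) (Symmetrify.of.obj y₀)) := by
  classical
  by_contra hne
  let C : Finset V := Finset.univ.filter fun x =>
    Nonempty (Walk (Symmetrify.of.obj x₀) (Symmetrify.of.obj x))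
  have hv := completeOrthogonalIdempotents_vertex (k := k) (V := V)
  let c : PathAlgebra k V := ∑ x ∈ C, vertex k x
  have hleft : ∀ {x y : V} (p : Quiver.Path x y),
      c * ofPath k p = if y ∈ C then ofPath k p else 0 := by
    intro x y p
    have h0 : ∀ z, z ≠ y → vertex k z * ofPath k p = 0 := fun z hz =>
      ofPath_mul_ofPath_of_ne hz.symm _ _
    rw [Finset.sum_mul]
    split_ifs with hy
    · rw [Finset.sum_eq_single_of_mem y hy fun z _ hz => h0 z hz, ofPath, vertex_mul_incl]
    · exact Finset.sum_eq_zero fun z hz => h0 z fun h => hy (h ▸ hz)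
  have hright : ∀ {x y : V} (p : Quiver.Path x y),
      ofPath k p * c = if x ∈ C then ofPath k p else 0 := by
    intro x y p
    have h0 : ∀ z, z ≠ x → ofPath k p * vertex k z = 0 := fun z hz =>
      ofPath_mul_ofPath_of_ne hz _ _
    rw [Finset.mul_sum]
    split_ifs with hx
    · rw [Finset.sum_eq_single_of_mem x hx fun z _ hz => h0 z hz, ofPath, incl_mul_vertex]
    · exact Finset.sum_eq_zero fun z hz => h0 z fun h => hx (h ▸ hz)
  have hcent : ∀ f, c * f = f * c := by
    intro f
    induction f using induction_linear with
    | zero => simp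
    | add f g hf hg => rw [mul_add, add_mul, hf, hg]
    | @smul_ofPath t x y p =>
      have hxy : y ∈ C ↔ x ∈ C := by
        simp only [C, Finset.mem_filter, Finset.mem_univ, true_and]
        exact ⟨fun ⟨w⟩ => ⟨w.comp (pathToWalk p).reverse⟩, fun ⟨w⟩ => ⟨w.comp (pathToWalk p)⟩⟩
      rw [mul_smul_comm, smul_mul_assoc, hleft, hright]
      simp only [hxy]
  have hx₀ : x₀ ∈ C := Finset.mem_filter.2 ⟨Finset.mem_univ _, ⟨.nil⟩⟩
  have hy₀ : y₀ ∉ C := fun h => hne (Finset.mem_filter.1 h).2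
  have hidem : IsIdempotentElem (F c) := by
    change F c * F c = F c
    rw [← map_mul]
    congr 1
    exact hv.toOrthogonalIdempotents.isIdempotentElem_sum
  rcases hA.2 (F c) hidem (fun a => by
    obtain ⟨f, rfl⟩ := hF a
    rw [← map_mul, ← map_mul, hcent]) with h | h
  · apply map_vertex_ne_zero hF0 x₀
    have h1 : vertex k x₀ = c * vertex k x₀ := by rw [hleft, if_pos hx₀]
    rw [h1, map_mul, h, zero_mul]
  · apply map_vertex_ne_zero hF0 y₀
    have h1 : c * vertex k y₀ = 0 := by rw [hleft, if_neg hy₀]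
    rw [← one_mul (F _), ← h, ← map_mul, h1, map_zero]

end Radical

/-! ### Morphisms between fundamental groups -/

section FundamentalGroups

variable {k V : Type*} [Field k] [Quiver V] [Fintype V] [DecidableEq V]

theorem BoundQuiverPi1.exists_surjective_hom {I J : Ideal (PathAlgebra k V)} {x y : V}
    (Φ : ClosedWalk x → ClosedWalk y)
    (hcomp : ∀ u v, Homotopic J (Φ (u.comp v)) ((Φ u).comp (Φ v)))
    (hΦ : ∀ u v, Homotopic I u v → Homotopic J (Φ u) (Φ v))
    (hs : ∀ w, ∃ u, Homotopic J (Φ u) w) :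
    ∃ F : BoundQuiverPi1 I x →* BoundQuiverPi1 J y,
      (∀ w, F (BoundQuiverPi1.mk I w) = BoundQuiverPi1.mk J (Φ w)) ∧ Function.Surjective F := by
  let φ : BoundQuiverPi1 I x → BoundQuiverPi1 J y :=
    Quotient.map (sa := homotopySetoid I x) (sb := homotopySetoid J y) Φ hΦ
  refine ⟨MonoidHom.mk' φ ?_, fun w => rfl, ?_⟩
  · intro a b
    induction a using Quotient.inductionOn with | _ u => ?_
    induction b using Quotient.inductionOn with | _ v => ?_
    exact Quotient.sound (s := homotopySetoid J y) (hcomp v u)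
  · intro b
    induction b using Quotient.inductionOn with | _ w => ?_
    obtain ⟨u, hu⟩ := hs w
    exact ⟨BoundQuiverPi1.mk I u, Quotient.sound (s := homotopySetoid J y) hu⟩

theorem BoundQuiverPi1.exists_surjective_hom_of_walk (I : Ideal (PathAlgebra k V)) {x y : V}
    (w : Walk (Symmetrify.of.obj x) (Symmetrify.of.obj y)) :
    ∃ F : BoundQuiverPi1 I x →* BoundQuiverPi1 I y, Function.Surjective F := by
  have hcomp : ∀ u v : ClosedWalk x, Homotopic I (w.reverse.comp ((u.comp v).comp w))
      ((w.reverse.comp (u.comp w)).comp (w.reverse.comp (v.comp w))) := by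
    intro u v
    have h : Homotopic I ((u.comp (w.comp w.reverse)).comp v) ((u.comp .nil).comp v) :=
      .comp (.comp (.refl u) (Homotopic.comp_reverse I w)) (.refl v)
    have h' := Homotopic.comp (Homotopic.refl (I := I) w.reverse)
      (Homotopic.comp h (Homotopic.refl (I := I) w))
    simpa only [Quiver.Path.comp_assoc, Quiver.Path.comp_nil] using h'.symm
  have hsurj : ∀ v : ClosedWalk y, ∃ u : ClosedWalk x,
      Homotopic I (w.reverse.comp (u.comp w)) v := by
    refine fun v => ⟨w.comp (v.comp w.reverse), ?_⟩
    have h := Homotopic.comp (Homotopic.comp (Homotopic.reverse_comp I w)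
      (Homotopic.refl (I := I) v)) (Homotopic.reverse_comp I w)
    simpa only [Quiver.Path.comp_assoc, Quiver.Path.comp_nil, Quiver.Path.nil_comp] using h
  obtain ⟨F, -, hF⟩ := BoundQuiverPi1.exists_surjective_hom (I := I) (J := I)
    (fun u => w.reverse.comp (u.comp w)) hcomp
    (fun u v h => .comp (.refl _) (.comp h (.refl _))) hsurj
  exact ⟨F, hF⟩

end FundamentalGroups

/-! ### Transport along automorphisms of the quiver -/

section Transport

/-- The casts free the endpoints of `q`, so that induction on `q` is possible. -/
theorem Prefunctor.exists_mapPath_cast_eq {U W : Type*} [Quiver U] [Quiver W] (G : U ⥤q W)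
    (hG : Function.Bijective G.obj)
    (hmap : ∀ x y : U, Function.Surjective (G.map : (x ⟶ y) → (G.obj x ⟶ G.obj y)))
    {a b : W} (q : Quiver.Path a b) (x y : U) (hx : G.obj x = a) (hy : G.obj y = b) :
    ∃ p : Quiver.Path x y, (G.mapPath p).cast hx hy = q := by
  subst hx
  induction q generalizing y with
  | nil =>
    obtain rfl := hG.1 hy
    exact ⟨.nil, rfl⟩
  | @cons b c q α ih =>
    subst hy
    obtain ⟨z, rfl⟩ := hG.2 b
    obtain ⟨p, hp⟩ := ih z rfl
    obtain ⟨β, rfl⟩ := hmap z y α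
    exact ⟨p.cons β, congrArg (fun r => r.cons (G.map β)) hp⟩

theorem Prefunctor.mapPath_surjective {U W : Type*} [Quiver U] [Quiver W] (G : U ⥤q W)
    (hG : Function.Bijective G.obj)
    (hmap : ∀ x y : U, Function.Surjective (G.map : (x ⟶ y) → (G.obj x ⟶ G.obj y))) (x y : U) :
    Function.Surjective (G.mapPath : Quiver.Path x y → Quiver.Path (G.obj x) (G.obj y)) :=
  fun q => G.exists_mapPath_cast_eq hG hmap q x y rfl rfl

theorem Prefunctor.toList_mapPath {U W : Type*} [Quiver U] [Quiver W] (G : U ⥤q W) {x y : U}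
    (p : Quiver.Path x y) : (G.mapPath p).toList = p.toList.map G.obj := by
  induction p with
  | nil => rfl
  | cons p α ih => simp [ih]

theorem Prefunctor.mapPath_injective {U W : Type*} [Quiver U] [Quiver W] (G : U ⥤q W)
    (hG : Function.Injective G.obj) [∀ x y : U, Subsingleton (x ⟶ y)] (x y : U) :
    Function.Injective (G.mapPath : Quiver.Path x y → Quiver.Path (G.obj x) (G.obj y)) := by
  intro p q h
  apply Quiver.Path.toList_injective x y
  apply List.map_injective_iff.2 hG
  rw [← G.toList_mapPath, ← G.toList_mapPath, h]

theorem Prefunctor.length_mapPath {U W : Type*} [Quiver U] [Quiver W] (G : U ⥤q W) {x y : U}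
    (p : Quiver.Path x y) : (G.mapPath p).length = p.length := by
  induction p with
  | nil => rfl
  | cons p α ih => simp [ih]

open PathAlgebra

variable {k V : Type*} [Field k] [Quiver V] [Fintype V] [DecidableEq V]
  {G : V ⥤q V} (hG : Function.Bijective G.obj)

/-- The endomorphism of the path algebra induced by an endomorphism of the quiver that is bijective
on vertices. -/
noncomputable def PathAlgebra.mapQuiver (k : Type*) [Field k] (hG : Function.Bijective G.obj) :
    PathAlgebra k V →ₐ[k] PathAlgebra k V :=
  lift k (E := fun x => vertex k (G.obj x)) (a := fun {x y} α => ofPath k (G.map α).toPath)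
    ((CompleteOrthogonalIdempotents.equiv (Equiv.ofBijective G.obj hG)).2
      completeOrthogonalIdempotents_vertex)
    fun {x y} α => by rw [ofPath, vertex_mul_incl, incl_mul_vertex]

theorem PathAlgebra.mapQuiver_ofPath {x y : V} (p : Quiver.Path x y) :
    mapQuiver k hG (ofPath k p) = ofPath k (G.mapPath p) := by
  have h : mapQuiver k hG (ofPath k p) =
      evalPath (fun x => vertex k (G.obj x)) (fun {x y} α => ofPath k (G.map α).toPath) p :=
    lift_ofPath k _ (fun {x y} α => by rw [ofPath, vertex_mul_incl, incl_mul_vertex]) p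
  rw [h]
  clear h
  induction p with
  | nil => rfl
  | cons p α ih => rw [evalPath, ih, Prefunctor.mapPath_cons, ofPath_cons]

theorem PathAlgebra.mapQuiver_incl {x y : V} (r : Quiver.Path x y →₀ k) :
    mapQuiver k hG (incl r) = incl (r.mapDomain G.mapPath) := by
  induction r using Finsupp.induction_linear with
  | zero => simp [incl_zero]
  | add r s hr hs => rw [incl_add, map_add, hr, hs, Finsupp.mapDomain_add, incl_add]
  | single p t => rw [incl_single, map_smul, mapQuiver_ofPath, Finsupp.mapDomain_single, incl_single]

theorem PathAlgebra.mapQuiver_surjective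
    (hmap : ∀ x y : V, Function.Surjective (G.map : (x ⟶ y) → (G.obj x ⟶ G.obj y))) :
    Function.Surjective (mapQuiver k hG) := by
  intro f
  refine mem_of_mem_support (W := LinearMap.range (mapQuiver k hG).toLinearMap) fun x y p _ => ?_
  obtain ⟨a, rfl⟩ := hG.2 x
  obtain ⟨b, rfl⟩ := hG.2 y
  obtain ⟨q, rfl⟩ := G.mapPath_surjective hG hmap a b p
  exact ⟨ofPath k q, mapQuiver_ofPath hG q⟩

theorem pathToWalk_mapPath {V : Type*} [Quiver V] {G : V ⥤q V} {x y : V}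
    (p : Quiver.Path x y) :
    pathToWalk (G.mapPath p) = G.symmetrify.mapPath (pathToWalk p) := by
  induction p with
  | nil => rfl
  | cons p α ih =>
    change (pathToWalk (G.mapPath p)).cons _ = (G.symmetrify.mapPath (pathToWalk p)).cons _
    rw [ih]
    rfl

/-- The action on paths is injective, so every subsum of the image comes from a subsum of `r`. -/
theorem IsMinimalRelation.mapQuiver [∀ x y : V, Subsingleton (x ⟶ y)]
    {I : Ideal (PathAlgebra k V)} {x y : V} {r : Quiver.Path x y →₀ k}
    (hr : IsMinimalRelation (I.comap (PathAlgebra.mapQuiver k hG)) r) :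
    IsMinimalRelation I (r.mapDomain G.mapPath) := by
  classical
  have hinj := G.mapPath_injective hG.1 x y
  refine ⟨fun h => hr.1 ?_, ?_, ?_⟩
  · exact Finsupp.mapDomain_injective hinj (h.trans Finsupp.mapDomain_zero.symm)
  · rw [← mapQuiver_incl hG]
    exact hr.2.1
  · intro E hE hEr hmem
    rw [Finsupp.mapDomain_support_of_injective hinj] at hEr
    obtain ⟨E', hE', rfl⟩ := Finset.subset_image_iff.1 hEr.1
    refine hr.2.2 E' (Finset.image_nonempty.1 hE) ⟨by exact_mod_cast hE', fun h => hEr.2 ?_⟩ ?_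
    · exact Finset.image_subset_image h
    · rw [Ideal.mem_comap, mapQuiver_incl]
      convert hmem using 2
      rw [Finset.sum_image fun a _ b _ h => hinj h, Finsupp.mapDomain_finsetSum]
      refine Finset.sum_congr rfl fun p _ => ?_
      rw [Finsupp.mapDomain_single, Finsupp.mapDomain_apply hinj]

theorem Homotopic.mapQuiver [∀ x y : V, Subsingleton (x ⟶ y)] {I : Ideal (PathAlgebra k V)}
    {x y : Symmetrify V} {u v : Walk x y}
    (h : Homotopic (I.comap (PathAlgebra.mapQuiver k hG)) u v) :
    Homotopic I (G.symmetrify.mapPath u) (G.symmetrify.mapPath v) := by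
  classical
  induction h with
  | refl u => exact .refl _
  | symm _ ih => exact ih.symm
  | trans _ _ ih ih' => exact ih.trans ih'
  | comp _ _ ih ih' =>
    rw [Prefunctor.mapPath_comp, Prefunctor.mapPath_comp]
    exact .comp ih ih'
  | arrow_inv α => exact .arrow_inv (G.map α)
  | inv_arrow α => exact .inv_arrow (G.map α)
  | @relation x y r hr p q hp hq =>
    rw [← pathToWalk_mapPath, ← pathToWalk_mapPath]
    have hinj := G.mapPath_injective hG.1 x y
    refine .relation _ (hr.mapQuiver hG) ?_ ?_ <;>
      rw [Finsupp.mapDomain_support_of_injective hinj]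
    · exact Finset.mem_image_of_mem _ hp
    · exact Finset.mem_image_of_mem _ hq

theorem BoundQuiverPi1.exists_surjective_hom_mapQuiver [∀ x y : V, Subsingleton (x ⟶ y)]
    (hmap : ∀ x y : V, Function.Surjective (G.map : (x ⟶ y) → (G.obj x ⟶ G.obj y)))
    (I : Ideal (PathAlgebra k V)) (x : V) :
    ∃ F : BoundQuiverPi1 (I.comap (PathAlgebra.mapQuiver k hG)) x →*
      BoundQuiverPi1 I (G.obj x), Function.Surjective F := by
  have hsurj : ∀ w : ClosedWalk (G.obj x), ∃ u : ClosedWalk x,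
      Homotopic I (G.symmetrify.mapPath u) w := by
    intro w
    obtain ⟨u, hu⟩ := G.symmetrify.mapPath_surjective hG (fun a b α => by
      rcases α with α | α
      · obtain ⟨β, rfl⟩ := hmap a b α
        exact ⟨Sum.inl β, rfl⟩
      · obtain ⟨β, rfl⟩ := hmap b a α
        exact ⟨Sum.inr β, rfl⟩) x x w
    exact ⟨u, hu ▸ .refl _⟩
  obtain ⟨F, -, hF⟩ := BoundQuiverPi1.exists_surjective_hom
    (I := I.comap (PathAlgebra.mapQuiver k hG)) (J := I) (x := x) (y := G.obj x)
    (fun u => G.symmetrify.mapPath u)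
    (fun u v => (Prefunctor.mapPath_comp G.symmetrify u v) ▸ .refl _)
    (fun u v h => h.mapQuiver hG) hsurj
  exact ⟨F, hF⟩

/-- The inverse image of an admissible ideal under an automorphism of the quiver. -/
noncomputable def AdmissibleIdeal.comapQuiver [∀ x y : V, Subsingleton (x ⟶ y)]
    (hG : Function.Bijective G.obj) (I : AdmissibleIdeal k V) : AdmissibleIdeal k V where
  ideal := I.ideal.comap (PathAlgebra.mapQuiver k hG)
  isTwoSided := inferInstance
  exists_pow_le := by
    obtain ⟨n, hn, h⟩ := I.exists_pow_le
    refine ⟨n, hn, ?_⟩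
    rw [arrowIdeal_pow] at h ⊢
    refine fun f hf => h (map_mem_lengthIdeal (fun {x y} α => ?_) hf)
    rw [mapQuiver_ofPath, ofPath_mem_lengthIdeal, Prefunctor.length_mapPath]
    exact le_rfl
  le_sq := by
    classical
    rw [arrowIdeal_pow]
    intro f hf x y p hp
    have h1 : incl (f x y) ∈ I.ideal.comap (PathAlgebra.mapQuiver k hG) := incl_apply_mem hf x y
    rw [Ideal.mem_comap, mapQuiver_incl] at h1
    have h2 := incl_mem_lengthIdeal.1 (I.le_lengthIdeal h1)
    rw [Finsupp.mapDomain_support_of_injective (G.mapPath_injective hG.1 x y)] at h2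
    by_contra hne
    have h3 := h2 _ (Finset.mem_image_of_mem _ (Finsupp.mem_support_iff.2 hne))
    rw [Prefunctor.length_mapPath] at h3
    omega

end Transport

/-! ### Main theorem -/

section Main

open PathAlgebra

variable {k A V : Type*} [Field k] [Ring A] [Algebra k A] [Module.Finite k A] [Quiver V]
  [Fintype V] [DecidableEq V]

/-- Up to an automorphism of the quiver, every presentation respects the vertices. -/
theorem exists_prefunctor_of_presentation {e : V → A}
    (hcomm : ∀ a b : A, a * b - b * a ∈ Ring.jacobson A) (he : IsPrimitiveDecomposition e)
    (hdb : NoDoubleBypass V) {I₀ I : AdmissibleIdeal k V} {F₀ F : PathAlgebra k V →ₐ[k] A}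
    (h₀ : IsPresentation e F₀ I₀.ideal) (hF : Function.Surjective F)
    (hF0 : ∀ f, F f = 0 ↔ f ∈ I.ideal) :
    ∃ G : V ⥤q V, Function.Bijective G.obj ∧
      (∀ x y : V, Function.Surjective (G.map : (x ⟶ y) → (G.obj x ⟶ G.obj y))) ∧
      ∀ x, CornerIso (F (vertex k (G.obj x))) (e x) := by
  have hprim := isPrimitiveDecomposition_map_vertex hdb hF hF0
  have hid : ∀ x, IsIdempotentElem (e x) := he.1.idem
  have hid' := hprim.1.idem
  -- Matching equivalent idempotents permutes the vertices: `τ` is injective because distinct `e x`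
  -- are orthogonal, hence inequivalent in a basic algebra.
  choose τ hτ using fun x => (he.2 x).exists_cornerIso k hprim
  have hinj : Function.Injective τ := by
    intro x y hxy
    by_contra hne
    have h1 : CornerIso (e x) (e y) :=
      (hτ x).trans (hid x) (hid' _) (hid y) (hxy ▸ (hτ y).symm)
    exact not_cornerIso_of_orthogonal hcomm (hid x) (he.2 x).2.1 (he.1.ortho hne) h1
  have hiso : ∀ x, CornerIso (F₀ (vertex k x)) (F (vertex k (τ x))) := fun x =>
    (h₀.cornerIso x).trans ((CompleteOrthogonalIdempotents.map_vertex F₀).idem x) (hid x)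
      (hid' _) (hτ x)
  have harrow : ∀ x y, Nonempty (x ⟶ y) ↔ Nonempty (τ x ⟶ τ y) := by
    intro x y
    rw [nonempty_hom_iff hdb h₀.surjective h₀.map_eq_zero_iff, nonempty_hom_iff hdb hF hF0]
    exact ⟨(hiso x).exists_notMem_jacobson_sq (hiso y) (hid' _) (hid' _),
      (hiso x).symm.exists_notMem_jacobson_sq (hiso y).symm
        ((CompleteOrthogonalIdempotents.map_vertex F₀).idem x)
        ((CompleteOrthogonalIdempotents.map_vertex F₀).idem y)⟩
  refine ⟨⟨τ, fun {x y} α => Classical.choice ((harrow x y).1 ⟨α⟩)⟩,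
    Finite.injective_iff_bijective.1 hinj, fun x y β => ?_, fun x => (hτ x).symm⟩
  obtain ⟨α⟩ := (harrow x y).2 ⟨β⟩
  have := hdb.subsingleton_hom
  exact ⟨α, Subsingleton.elim _ _⟩

end Main

theorem theoremA {k A V : Type*} [Field k] [IsAlgClosed k] [CharZero k]
    [Ring A] [Algebra k A] [Module.Finite k A]
    (hbasic : IsBasicAlgebra A) (hconn : IsConnectedAlgebra A)
    [Fintype V] [DecidableEq V] [Quiver V]
    (e : V → A) (he : IsPrimitiveDecomposition e) (hQ : IsOrdinaryQuiver k e)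
    (hdb : NoDoubleBypass V) :
    ∃ (I₀ : AdmissibleIdeal k V) (φ₀ : (PathAlgebra k V ⧸ I₀.ideal) ≃ₐ[k] A),
      RespectsVertices e I₀ φ₀ ∧
      -- for every presentation with the same vertices, the identity map on walks induces a
      -- surjective morphism
      (∀ (I : AdmissibleIdeal k V) (φ : (PathAlgebra k V ⧸ I.ideal) ≃ₐ[k] A),
        RespectsVertices e I φ →
        ∀ x₀ : V, ∃ F : BoundQuiverPi1 I₀.ideal x₀ →* BoundQuiverPi1 I.ideal x₀,
          (∀ w : ClosedWalk x₀, F (BoundQuiverPi1.mk I₀.ideal w) = BoundQuiverPi1.mk I.ideal w) ∧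
          Function.Surjective F) ∧
      -- for every presentation whatsoever, there is a surjective morphism
      (∀ (I : AdmissibleIdeal k V), Nonempty ((PathAlgebra k V ⧸ I.ideal) ≃ₐ[k] A) →
        ∀ x₀ y₀ : V, ∃ F : BoundQuiverPi1 I₀.ideal x₀ →* BoundQuiverPi1 I.ideal y₀,
          Function.Surjective F) := by
  have hcomm := hbasic.commutator_mem_jacobson k
  have hid : ∀ x, IsIdempotentElem (e x) := he.1.idem
  have hsub := hdb.subsingleton_hom
  obtain ⟨I₀, F₀, h₀, hfin⟩ := exists_finest_presentation hid hdb
    (exists_presentation hcomm he hQ hdb)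
  obtain ⟨φ₀, hφ₀, -⟩ := h₀.exists_respectsVertices hid
  have hsurj : ∀ (I : AdmissibleIdeal k V) (F : PathAlgebra k V →ₐ[k] A),
      IsPresentation e F I.ideal → ∀ x₀ : V,
      ∃ F : BoundQuiverPi1 I₀.ideal x₀ →* BoundQuiverPi1 I.ideal x₀,
        (∀ w : ClosedWalk x₀, F (BoundQuiverPi1.mk I₀.ideal w) = BoundQuiverPi1.mk I.ideal w) ∧
        Function.Surjective F := fun I F h x₀ =>
    BoundQuiverPi1.exists_surjective_hom (fun w => w) (fun _ _ => .refl _)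
      (fun u v huv => hfin I F h huv) (fun w => ⟨w, .refl w⟩)
  refine ⟨I₀, φ₀, hφ₀, fun I φ hφ => hsurj I _ (hφ.isPresentation hid), ?_⟩
  rintro I ⟨φ⟩ x₀ y₀
  let F : PathAlgebra k V →ₐ[k] A := φ.toAlgHom.comp (Ideal.Quotient.mkₐ k I.ideal)
  have hF : Function.Surjective F := φ.surjective.comp Ideal.Quotient.mk_surjective
  have hF0 : ∀ f, F f = 0 ↔ f ∈ I.ideal := fun f => by
    change φ (Ideal.Quotient.mk I.ideal f) = 0 ↔ f ∈ I.ideal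
    rw [EmbeddingLike.map_eq_zero_iff, Ideal.Quotient.eq_zero_iff_mem]
  obtain ⟨G, hG, hmap, hGe⟩ := exists_prefunctor_of_presentation hcomm he hdb h₀ hF hF0
  obtain ⟨z, rfl⟩ := hG.2 y₀
  -- After renumbering by `G` the presentation respects the vertices, so (1) applies to it.
  have hJ : IsPresentation e (F.comp (PathAlgebra.mapQuiver k hG)) (I.comapQuiver hG).ideal :=
    { surjective := hF.comp (PathAlgebra.mapQuiver_surjective hG hmap)
      map_eq_zero_iff := fun f => hF0 _
      cornerIso := fun x => by
        rw [AlgHom.comp_apply, PathAlgebra.mapQuiver_ofPath]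
        exact hGe x }
  -- The morphism is a change of base point from `x₀` to `z`, then the one from (1), then the action
  -- of `G`, which sends `z` to the target base point.
  obtain ⟨w⟩ := hconn.nonempty_walk h₀.surjective h₀.map_eq_zero_iff x₀ z
  obtain ⟨f₁, hf₁⟩ := BoundQuiverPi1.exists_surjective_hom_of_walk I₀.ideal w
  obtain ⟨f₂, -, hf₂⟩ := hsurj _ _ hJ z
  obtain ⟨f₃, hf₃⟩ := BoundQuiverPi1.exists_surjective_hom_mapQuiver hG hmap I.ideal z
  exact ⟨(f₃.comp f₂).comp f₁, (hf₃.comp hf₂).comp hf₁⟩
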